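/- Let $N\ge 1$ be an integer, $1<p<q<\infty$, and for $R>0$ let $B_R\subset\mathbb R^N$ be the open ball of radius $R$ centred at the origin, with outer unit normal $\nu$. Consider the Neumann problem $$(P_R)\qquad -\Delta_p u+u^{p-1}=u^{q-1}\ \text{ in }B_R,\qquad u>0\ \text{ in }B_R,\qquad \partial_\nu u=0\ \text{ on }\partial B_R,$$ where $\Delta_p u=\operatorname{div}(|\nabla u|^{p-2}\nabla u)$. A solution is a function $u\in C^1(\overline{B_R})$ with $|\nabla u|^{p-2}\nabla u\in C^1(B_R;\mathbb R^N)$ satisfying $(P_R)$ pointwise; it is radial if $u(x)$ depends only on $r=|x|$, and the zeros of $u-1$ for a radial $u$ are counted as zeros of a function of $r\in[0,R]$. For $k\ge1$ let $\lambda_k^{\mathrm{rad}}=\lambda_k^{\mathrm{rad}}(R)$ be the $k$-th radial Neumann eigenvalue of $-\Delta_p$ in $B_R$: the $k$-th element, in increasing order, of the set of real numbers $\lambda$ for which there is a radial $\phi\not\equiv0$ (with the same regularity) such that $-\Delta_p\phi=\lambda|\phi|^{p-2}\phi$ in $B_R$ and $\partial_\nu\phi=0$ on $\partial B_R$; so $0=\lambda_1^{\mathrm{rad}}<\lambda_2^{\mathrm{rad}}<\cdots$.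 (i) If $p=2$, $R>0$ and $q-2>\lambda_{k+1}^{\mathrm{rad}}(R)$ for some integer $k\ge1$, then $(P_R)$ has at least $k$ different non-constant radial solutions $u_1,\dots,u_k$, and they can be chosen so that $u_j-1$ has exactly $j$ zeros for every $j=1,\dots,k$. (ii) If $p>2$, then for every $R>0$ problem $(P_R)$ has infinitely many non-constant radial solutions. (iii) If $1<p<2$, then for every integer $k\ge1$ there exists $R_*(k)>0$ (depending only on $k,N,p,q$) such that for every $R>R_*(k)$ problem $(P_R)$ has at least $2k$ different non-constant radial solutions $u_1^\pm,\dots,u_k^\pm$, and they can be chosen so that both $u_j^+-1$ and $u_j^--1$ have exactly $j$ zeros for every $j=1,\dots,k$. -/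

import Mathlib

open Set Metric

noncomputable section

/-- The space `ℝ^N` with its Euclidean norm. -/
abbrev RN (N : ℕ) : Type := EuclideanSpace ℝ (Fin N)

/-- The divergence `∑ i, ∂F_i/∂x_i` of a vector field on `ℝ^N`. -/
def divergence {N : ℕ} (F : RN N → RN N) (x : RN N) : ℝ :=
  ∑ i : Fin N, (fderiv ℝ F x (EuclideanSpace.single i 1)) i

/-- The vector field `|∇u|^(p-2) ∇u`. -/
def pFlux {N : ℕ} (p : ℝ) (u : RN N → ℝ) (x : RN N) : RN N :=
  ‖gradient u x‖ ^ (p - 2) • gradient u x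

/-- The `p`-Laplace operator `Δ_p u = div (|∇u|^(p-2) ∇u)`. -/
def pLaplacian {N : ℕ} (p : ℝ) (u : RN N → ℝ) (x : RN N) : ℝ :=
  divergence (pFlux p u) x

/-- The outer normal derivative on the sphere of radius `R` of a function on the closed ball `B_R`.
The derivative is taken within the closed ball, so values outside it play no role. -/
def normalDeriv {N : ℕ} (R : ℝ) (u : RN N → ℝ) (x : RN N) : ℝ :=
  fderivWithin ℝ u (closedBall 0 R) x (‖x‖⁻¹ • x)

/-- The regularity that makes `Δ_p u` and the normal derivative meaningful pointwise:
`u` is `C¹` up to the boundary of `B_R` and `|∇u|^(p-2) ∇u` is `C¹` in the open ball. -/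
structure IsPRegular {N : ℕ} (p R : ℝ) (u : RN N → ℝ) : Prop where
  contDiffOn : ContDiffOn ℝ 1 u (closedBall 0 R)
  flux_contDiffOn : ContDiffOn ℝ 1 (pFlux p u) (ball 0 R)

/-- `u` is a solution of `-Δ_p u + u^(p-1) = g(u)`, `u > 0` in `B_R`, `∂_ν u = 0` on `∂B_R`. -/
structure IsNeumannSolution {N : ℕ} (p : ℝ) (g : ℝ → ℝ) (R : ℝ) (u : RN N → ℝ) : Prop where
  regular : IsPRegular p R u
  equation : ∀ x ∈ ball (0 : RN N) R, -pLaplacian p u x + u x ^ (p - 1) = g (u x)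
  pos : ∀ x ∈ ball (0 : RN N) R, 0 < u x
  neumann : ∀ x ∈ sphere (0 : RN N) R, normalDeriv R u x = 0

/-- On the closed ball `B_R`, `u` depends only on `|x|`. -/
def IsRadial {N : ℕ} (R : ℝ) (u : RN N → ℝ) : Prop :=
  ∃ w : ℝ → ℝ, ∀ x ∈ closedBall (0 : RN N) R, u x = w ‖x‖

/-- `u` is not constant on the closed ball `B_R`. -/
def IsNonconstant {N : ℕ} (R : ℝ) (u : RN N → ℝ) : Prop :=
  ¬ ∃ c : ℝ, ∀ x ∈ closedBall (0 : RN N) R, u x = c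

/-- Non-constant radial solutions of the Neumann problem in `B_R`. -/
structure IsNonconstantRadialSolution {N : ℕ} (p : ℝ) (g : ℝ → ℝ) (R : ℝ) (u : RN N → ℝ) :
    Prop where
  solution : IsNeumannSolution p g R u
  radial : IsRadial R u
  nonconstant : IsNonconstant R u

/-- The zeros of `u - 1` for a radial function `u` on the closed ball `B_R`, as a function of
`r = |x| ∈ [0, R]`. -/
def zeroRadii {N : ℕ} (R : ℝ) (u : RN N → ℝ) : Set ℝ :=
  {r | r ∈ Icc 0 R ∧ ∃ x : RN N, ‖x‖ = r ∧ u x - 1 = 0}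

/-- `lam` is a radial eigenvalue of `-Δ_p` in `B_R ⊆ ℝ^N` with Neumann boundary conditions: there
is a radial `φ`, not identically zero, with `-Δ_p φ = lam |φ|^(p-2) φ` in `B_R` and `∂_ν φ = 0` on
`∂B_R`. -/
def IsRadialEigenvalue (N : ℕ) (p R lam : ℝ) : Prop :=
  ∃ φ : RN N → ℝ, IsPRegular p R φ ∧ IsRadial R φ ∧
    (∃ x ∈ closedBall (0 : RN N) R, φ x ≠ 0) ∧
    (∀ x ∈ ball (0 : RN N) R, -pLaplacian p φ x = lam * (|φ x| ^ (p - 2) * φ x)) ∧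
    (∀ x ∈ sphere (0 : RN N) R, normalDeriv R φ x = 0)

/-- `lam` is the `k`-th radial eigenvalue, where the distinct radial eigenvalues are listed in
increasing order starting from `k = 1`: it is an eigenvalue, and exactly `k - 1` eigenvalues are
smaller. -/
def IsKthRadialEigenvalue (N : ℕ) (p R : ℝ) (k : ℕ) (lam : ℝ) : Prop :=
  IsRadialEigenvalue N p R lam ∧
    {μ : ℝ | IsRadialEigenvalue N p R μ ∧ μ < lam}.encard + 1 = (k : ℕ∞)

end

namespace RadialShooting

noncomputable section

open Filter Topology MeasureTheory

/-! Put x = u - 1 and n = N - 1, let a be the exponent conjugate to p, Y = |x'|^(p-2) x' the flux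
and v = r^n Y the momentum. A radial solution is a trajectory of x' = |Y|^(a-2) Y, v' = -r^n g(x)
with v(0) = 0, and the parameter to shoot with is d = x(0) in (-1, 0). The clockwise angle of (x, v)
from the negative x-axis is strictly increasing; it is an odd multiple of π/2 exactly at the zeros
of x, and the Neumann condition v(R) = 0 says that it is a multiple of π at R. Hence a total angle
jπ gives a solution with exactly j zeros of u - 1 (`encard_zeros`), and the theorem becomes the
question which total angles occur.

The energy |Y|^a / a + G(x) decreases, while its product with r^(na) increases (`energy_antitoneOn`,
`rpow_mul_energy_monotoneOn`). The first fact keeps u between 1 + d > 0 and `topValue`, where the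
truncation of g does nothing; the second keeps the energy positive, so that (x, v) never meets the
origin and the angle is defined.

For d near -1 one has u' ≤ C u, so u stays below 1 on [0, R] and the total angle is below π/2. For d
near 0 the exponent decides. If p = 2, then g has slope q - 2 > λ at its zero, and by Sturm
comparison the angle exceeds that of an eigenfunction for λ, the (k+1)-st eigenvalue; the latter is
at least kπ, because the angle grows strictly with the eigenvalue and k eigenvalues lie below λ
(`exists_index_ge`). For p ≠ 2 the tool is `IsRadialSol.rotation`: as long as u stays above a fixed
positive level, the angle at 2r₀ is at least c r₀ e^(1/p-1/2) - π/2, with e the energy at r₀. If p >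
2 the exponent is negative and the bound blows up as d → 0. If p < 2 the angle is below π/2 for d
near 0 too, but some fixed d in between turns arbitrarily often once R is large, so every jπ is
attained on both sides of it, whence 2k solutions.

To hit jπ between a small and a large angle one wants continuous dependence on d, but no uniqueness
is available: for p > 2 the map y ↦ |y|^(a-2) y is not Lipschitz at 0. In
`exists_isRadialSol_phaseAngle_eq` the intermediate value theorem is therefore applied to Tonelli's
delayed equations, whose solutions are continuous in d, followed by an Arzelà–Ascoli limit; this
works because the angle bounds at the two endpoints hold for all solutions starting there. -/

/-- The odd power `|y|^(a-2) y`. -/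
def oddPow (a y : ℝ) : ℝ := |y| ^ (a - 2) * y

@[simp] lemma oddPow_zero (a : ℝ) : oddPow a 0 = 0 := by simp [oddPow]

@[simp] lemma oddPow_two (y : ℝ) : oddPow 2 y = y := by simp [oddPow]

lemma abs_oddPow {a : ℝ} (ha : 1 < a) (y : ℝ) : |oddPow a y| = |y| ^ (a - 1) := by
  rcases eq_or_ne y 0 with rfl | hy
  · simp [Real.zero_rpow (sub_pos.2 ha).ne']
  · have h : 0 < |y| := abs_pos.2 hy
    rw [oddPow, abs_mul, abs_of_nonneg (by positivity)]
    nth_rewrite 2 [← Real.rpow_one |y|]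
    rw [← Real.rpow_add h]
    congr 1
    ring

lemma mul_oddPow {a : ℝ} (ha : 1 < a) (y : ℝ) : y * oddPow a y = |y| ^ a := by
  rcases eq_or_ne y 0 with rfl | hy
  · simp [Real.zero_rpow (by linarith : a ≠ 0)]
  · have h : 0 < |y| := abs_pos.2 hy
    have h2 : y * oddPow a y = |y| ^ (a - 2) * |y| ^ (2 : ℝ) := by
      rw [oddPow, Real.rpow_two, sq_abs]
      ring
    rw [h2, ← Real.rpow_add h]
    congr 1
    ring

lemma continuous_oddPow {a : ℝ} (ha : 1 < a) : Continuous (oddPow a) := by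
  refine continuous_iff_continuousAt.2 fun y => ?_
  rcases eq_or_ne y 0 with rfl | hy
  · rw [ContinuousAt, oddPow_zero]
    refine squeeze_zero_norm (a := fun y : ℝ => |y| ^ (a - 1)) (fun y => ?_) ?_
    · rw [Real.norm_eq_abs, abs_oddPow ha]
    · have : ContinuousAt (fun y : ℝ => |y| ^ (a - 1)) 0 :=
        continuous_abs.continuousAt.rpow_const (Or.inr (by linarith))
      simpa [ContinuousAt, Real.zero_rpow (sub_pos.2 ha).ne'] using this
  · exact (continuous_abs.continuousAt.rpow_const (Or.inl (abs_ne_zero.2 hy))).mul continuousAt_id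

/-- The powers of |y| have exponents (a-1)(p-2) and a-2, which cancel for conjugate exponents; this
is how the flux is recovered from x'. -/
lemma oddPow_oddPow {p a : ℝ} (ha : 1 < a) (hpa : (p - 1) * (a - 1) = 1) (y : ℝ) :
    oddPow p (oddPow a y) = y := by
  rcases eq_or_ne y 0 with rfl | hy
  · simp
  · have h : 0 < |y| := abs_pos.2 hy
    have h1 : oddPow p (oddPow a y) = |y| ^ ((a - 1) * (p - 2)) * |y| ^ (a - 2) * y := by
      rw [oddPow, abs_oddPow ha, ← Real.rpow_mul h.le, oddPow, mul_assoc]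
    rw [h1, ← Real.rpow_add h, show (a - 1) * (p - 2) + (a - 2) = 0 by linear_combination hpa]
    simp

/-! ### Weighted averages: integrating the radial divergence without dividing by r -/

/-- The weighted mean `∫ t in 0..1, t^n k(r t)`. -/
def radAvg (n : ℕ) (k : ℝ → ℝ) (r : ℝ) : ℝ := ∫ t in (0 : ℝ)..1, t ^ n * k (r * t)

/-- `-r` times the weighted mean: the solution `Y` of `(r^n Y)' = -r^n k` that vanishes at `0`. -/
def radFlux (n : ℕ) (k : ℝ → ℝ) (r : ℝ) : ℝ := -(r * radAvg n k r)

/-- The primitive of `-r^n k` that vanishes at `0`. -/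
def radMom (n : ℕ) (k : ℝ → ℝ) (r : ℝ) : ℝ := r ^ n * radFlux n k r

/-- After the substitution s = r t the integral runs over a fixed interval, so joint continuity
holds through r = 0. -/
lemma continuous_radAvg_param {X : Type*} [TopologicalSpace X] (n : ℕ) {k : X → ℝ → ℝ}
    (hk : Continuous (Function.uncurry k)) :
    Continuous fun z : X × ℝ => radAvg n (k z.1) z.2 := by
  unfold radAvg
  refine intervalIntegral.continuous_parametric_intervalIntegral_of_continuous'
    (f := fun (z : X × ℝ) t => t ^ n * k z.1 (z.2 * t)) ?_ 0 1
  have : Continuous fun w : (X × ℝ) × ℝ => Function.uncurry k (w.1.1, w.1.2 * w.2) :=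
    hk.comp (by fun_prop)
  exact (continuous_snd.pow n).mul this

lemma continuous_radFlux_param {X : Type*} [TopologicalSpace X] (n : ℕ) {k : X → ℝ → ℝ}
    (hk : Continuous (Function.uncurry k)) :
    Continuous fun z : X × ℝ => radFlux n (k z.1) z.2 :=
  (continuous_snd.mul (continuous_radAvg_param n hk)).neg

lemma continuous_radAvg (n : ℕ) {k : ℝ → ℝ} (hk : Continuous k) : Continuous (radAvg n k) := by
  have := continuous_radAvg_param (X := Unit) n (k := fun _ => k) (hk.comp continuous_snd)
  exact this.comp (Continuous.prodMk (continuous_const (y := ())) continuous_id)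

lemma continuous_radFlux (n : ℕ) {k : ℝ → ℝ} (hk : Continuous k) : Continuous (radFlux n k) :=
  (continuous_id.mul (continuous_radAvg n hk)).neg

lemma continuous_radMom (n : ℕ) {k : ℝ → ℝ} (hk : Continuous k) : Continuous (radMom n k) :=
  (continuous_id.pow n).mul (continuous_radFlux n hk)

lemma radMom_eq (n : ℕ) (k : ℝ → ℝ) (r : ℝ) :
    radMom n k r = -∫ s in (0 : ℝ)..r, s ^ n * k s := by
  have h := intervalIntegral.mul_integral_comp_mul_left (a := 0) (b := 1)
    (f := fun s => s ^ n * k s) r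
  rw [mul_zero, mul_one] at h
  rw [← h, radMom, radFlux, radAvg, mul_neg, ← mul_assoc, mul_comm (r ^ n), mul_assoc,
    ← intervalIntegral.integral_const_mul]
  simp_rw [mul_pow, mul_assoc]

lemma hasDerivAt_radMom (n : ℕ) {k : ℝ → ℝ} (hk : Continuous k) (r : ℝ) :
    HasDerivAt (radMom n k) (-(r ^ n * k r)) r := by
  have hc : Continuous fun s => s ^ n * k s := (continuous_id.pow n).mul hk
  have : radMom n k = fun r => -∫ s in (0 : ℝ)..r, s ^ n * k s := funext (radMom_eq n k)
  rw [this]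
  exact (intervalIntegral.integral_hasDerivAt_right (hc.intervalIntegrable _ _)
    hc.stronglyMeasurable.stronglyMeasurableAtFilter hc.continuousAt).neg

@[simp] lemma radFlux_at_zero (n : ℕ) (k : ℝ → ℝ) : radFlux n k 0 = 0 := by simp [radFlux]

@[simp] lemma radMom_at_zero (n : ℕ) (k : ℝ → ℝ) : radMom n k 0 = 0 := by simp [radMom]

lemma radAvg_at_zero (n : ℕ) (k : ℝ → ℝ) : (n + 1 : ℝ) * radAvg n k 0 = k 0 := by
  have : (n : ℝ) + 1 ≠ 0 := by positivity
  simp [radAvg]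
  field_simp

lemma radAvg_eq_of_pos (n : ℕ) (k : ℝ → ℝ) {r : ℝ} (hr : 0 < r) :
    radAvg n k r = -(radMom n k r / r ^ (n + 1)) := by
  rw [radMom, radFlux]
  field_simp
  ring

lemma hasDerivAt_radAvg (n : ℕ) {k : ℝ → ℝ} (hk : Continuous k) {r : ℝ} (hr : 0 < r) :
    HasDerivAt (radAvg n k) ((k r - (n + 1) * radAvg n k r) / r) r := by
  have h := ((hasDerivAt_radMom n hk r).div (hasDerivAt_pow (n + 1) r)
    (pow_pos hr (n + 1)).ne').neg
  have h2 : HasDerivAt (radAvg n k)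
      (-((-(r ^ n * k r) * r ^ (n + 1) - radMom n k r * (((n + 1 : ℕ) : ℝ) * r ^ (n + 1 - 1)))
        / (r ^ (n + 1)) ^ 2)) r := by
    refine h.congr_of_eventuallyEq ?_
    filter_upwards [lt_mem_nhds hr] with s hs
    exact radAvg_eq_of_pos n k hs
  refine h2.congr_deriv ?_
  rw [radMom, radFlux, Nat.add_sub_cancel]
  push_cast
  field_simp
  ring

/-- The equation in friction form: the term n/r Y is the source of all energy loss. -/
lemma hasDerivAt_radFlux (n : ℕ) {k : ℝ → ℝ} (hk : Continuous k) {r : ℝ} (hr : 0 < r) :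
    HasDerivAt (radFlux n k) (-(k r) - n / r * radFlux n k r) r := by
  refine ((hasDerivAt_id r).mul (hasDerivAt_radAvg n hk hr)).neg.congr_deriv ?_
  simp only [radFlux, id]
  field_simp
  ring

/-- Only values on [0, r] enter, so functions on [0, R] may be extended to the line at will. -/
lemma radAvg_congr (n : ℕ) {k l : ℝ → ℝ} {R r : ℝ} (h : ∀ s ∈ Icc 0 R, k s = l s)
    (hr : r ∈ Icc 0 R) : radAvg n k r = radAvg n l r := by
  refine intervalIntegral.integral_congr fun t ht => ?_
  rw [uIcc_of_le zero_le_one] at ht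
  have : r * t ∈ Icc 0 R :=
    ⟨mul_nonneg hr.1 ht.1, (mul_le_of_le_one_right hr.1 ht.2).trans hr.2⟩
  simp only [h _ this]

lemma radFlux_congr (n : ℕ) {k l : ℝ → ℝ} {R r : ℝ} (h : ∀ s ∈ Icc 0 R, k s = l s)
    (hr : r ∈ Icc 0 R) : radFlux n k r = radFlux n l r := by
  rw [radFlux, radFlux, radAvg_congr n h hr]

lemma abs_radAvg_le (n : ℕ) {k : ℝ → ℝ} {B : ℝ} (h : ∀ s, |k s| ≤ B) (r : ℝ) :
    |radAvg n k r| ≤ B := by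
  have := intervalIntegral.norm_integral_le_of_norm_le_const (a := 0) (b := 1)
    (f := fun t => t ^ n * k (r * t)) (C := B) ?_
  · simpa [radAvg] using this
  · intro t ht
    rw [uIoc_of_le zero_le_one] at ht
    have h1 : |t ^ n| ≤ 1 := by
      rw [abs_of_nonneg (pow_nonneg ht.1.le n)]
      exact pow_le_one₀ ht.1.le ht.2
    rw [Real.norm_eq_abs, abs_mul]
    calc |t ^ n| * |k (r * t)| ≤ 1 * B :=
          mul_le_mul h1 (h _) (abs_nonneg _) zero_le_one
      _ = B := one_mul B

lemma abs_radFlux_le (n : ℕ) {k : ℝ → ℝ} {B R : ℝ} (h : ∀ s, |k s| ≤ B) {r : ℝ}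
    (hr : r ∈ Icc 0 R) : |radFlux n k r| ≤ R * B := by
  rw [radFlux, abs_neg, abs_mul, abs_of_nonneg hr.1]
  exact mul_le_mul hr.2 (abs_radAvg_le n h r) (abs_nonneg _) (hr.1.trans hr.2)

/-! ### The radial equation in integrated form -/

/-- `x` solves `(r^n |x'|^(p-2) x')' = -r^n g(x)`, `x'(0) = 0` on `[0, R]`, in integrated form and
with `a` the exponent conjugate to `p`. -/
structure IsRadialSol (n : ℕ) (a : ℝ) (g : ℝ → ℝ) (R : ℝ) (x : ℝ → ℝ) : Prop where
  contDiff : ContDiff ℝ 1 x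
  deriv_eq : ∀ r ∈ Icc 0 R, deriv x r = oddPow a (radFlux n (g ∘ x) r)

namespace IsRadialSol

variable {n : ℕ} {a R : ℝ} {g x : ℝ → ℝ}

lemma continuous (h : IsRadialSol n a g R x) : Continuous x := h.contDiff.continuous

lemma hasDerivAt (h : IsRadialSol n a g R x) {r : ℝ} (hr : r ∈ Icc 0 R) :
    HasDerivAt x (oddPow a (radFlux n (g ∘ x) r)) r := by
  rw [← h.deriv_eq r hr]
  exact (h.contDiff.differentiable one_ne_zero r).hasDerivAt

lemma mono (h : IsRadialSol n a g R x) {S : ℝ} (hS : S ≤ R) : IsRadialSol n a g S x :=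
  ⟨h.contDiff, fun r hr => h.deriv_eq r ⟨hr.1, hr.2.trans hS⟩⟩

/-- A solution of the integral equation on `[0, R]` agrees there with a solution that is `C¹` on
the line. -/
lemma exists_of_integral_eq (ha : 1 < a) (hg : Continuous g) {u : ℝ → ℝ} (hR : 0 ≤ R)
    (hu : ContinuousOn u (Icc 0 R))
    (h : ∀ r ∈ Icc 0 R, u r = u 0 + ∫ s in (0 : ℝ)..r, oddPow a (radFlux n (g ∘ u) s)) :
    ∃ x, IsRadialSol n a g R x ∧ EqOn x u (Icc 0 R) := by
  let w : ℝ → ℝ := IccExtend hR ((Icc 0 R).domRestrict u)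
  have hw : Continuous w := (continuousOn_iff_continuous_domRestrict.1 hu).Icc_extend'
  have hwu : ∀ s ∈ Icc 0 R, w s = u s := fun s hs => IccExtend_of_mem hR _ hs
  have hc : Continuous fun s => oddPow a (radFlux n (g ∘ w) s) :=
    (continuous_oddPow ha).comp (continuous_radFlux n (hg.comp hw))
  let x : ℝ → ℝ := fun r => u 0 + ∫ s in (0 : ℝ)..r, oddPow a (radFlux n (g ∘ w) s)
  have hx : ∀ r, HasDerivAt x (oddPow a (radFlux n (g ∘ w) r)) r := fun r =>
    (intervalIntegral.integral_hasDerivAt_right (hc.intervalIntegrable _ _)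
      hc.stronglyMeasurable.stronglyMeasurableAtFilter hc.continuousAt).const_add _
  have hd : deriv x = fun s => oddPow a (radFlux n (g ∘ w) s) := funext fun r => (hx r).deriv
  have hxu : EqOn x u (Icc 0 R) := by
    intro r hr
    rw [h r hr]
    simp only [x]
    congr 1
    refine intervalIntegral.integral_congr fun s hs => ?_
    rw [uIcc_of_le hr.1] at hs
    have hs' : s ∈ Icc 0 R := ⟨hs.1, hs.2.trans hr.2⟩
    exact congrArg _ (radFlux_congr n (fun t ht => congrArg g (hwu t ht)) hs')
  refine ⟨x, ⟨contDiff_one_iff_deriv.2 ⟨fun r => (hx r).differentiableAt, hd ▸ hc⟩, ?_⟩, hxu⟩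
  intro r hr
  rw [hd]
  exact congrArg _ (radFlux_congr n (fun t ht => congrArg g ((hwu t ht).trans (hxu ht).symm)) hr)

/-! ### The energy -/

/-- The energy `|Y|^a / a + G(x)` with `Y` the flux. -/
def _root_.RadialShooting.energy (n : ℕ) (a : ℝ) (G g x : ℝ → ℝ) (r : ℝ) : ℝ :=
  |radFlux n (g ∘ x) r| ^ a / a + G (x r)

section energy

variable {G : ℝ → ℝ}

lemma continuous_energy (ha : 1 < a) (hg : Continuous g) (hG : ∀ s, HasDerivAt G (g s) s)
    (h : IsRadialSol n a g R x) : Continuous (energy n a G g x) := by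
  have hGc : Continuous G := continuous_iff_continuousAt.2 fun s => (hG s).continuousAt
  have h1 := (continuous_radFlux n (hg.comp h.continuous)).abs
  exact ((h1.rpow_const fun _ => Or.inr (by linarith)).div_const a).add (hGc.comp h.continuous)

/-- The contributions of g to Y' and to G(x)' cancel, because x' is the derivative of |Y|^a / a with
respect to Y; only friction remains. -/
lemma hasDerivAt_energy (ha : 1 < a) (hg : Continuous g) (hG : ∀ s, HasDerivAt G (g s) s)
    (h : IsRadialSol n a g R x) {r : ℝ} (hr : r ∈ Ioc 0 R) :
    HasDerivAt (energy n a G g x) (-(n / r * |radFlux n (g ∘ x) r| ^ a)) r := by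
  have h1 := (((hasDerivAt_abs_rpow (radFlux n (g ∘ x) r) ha).comp r
    (hasDerivAt_radFlux n (hg.comp h.continuous) hr.1)).div_const a).add
    ((hG (x r)).comp r (h.hasDerivAt ⟨hr.1.le, hr.2⟩))
  refine h1.congr_deriv ?_
  rw [← mul_oddPow ha]
  have : a ≠ 0 := by linarith
  simp only [oddPow, Function.comp]
  field_simp
  ring

lemma energy_antitoneOn (ha : 1 < a) (hg : Continuous g) (hG : ∀ s, HasDerivAt G (g s) s)
    (h : IsRadialSol n a g R x) : AntitoneOn (energy n a G g x) (Icc 0 R) := by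
  refine antitoneOn_of_hasDerivWithinAt_nonpos (convex_Icc 0 R)
    (h.continuous_energy ha hg hG).continuousOn (fun r hr => ?_) (fun r hr => ?_)
    (f' := fun r => -(n / r * |radFlux n (g ∘ x) r| ^ a))
  · rw [interior_Icc] at hr
    exact (h.hasDerivAt_energy ha hg hG ⟨hr.1, hr.2.le⟩).hasDerivWithinAt
  · rw [interior_Icc] at hr
    have := hr.1
    exact neg_nonpos.2 (by positivity)

/-- Since |Y|^a is at most a times the energy, friction consumes energy at relative rate at most n a
/ r; the weight compensates this, and what is left over is a nonnegative multiple of G(x). -/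
lemma rpow_mul_energy_monotoneOn (ha : 1 < a) (hg : Continuous g)
    (hG : ∀ s, HasDerivAt G (g s) s) (hG0 : ∀ s, 0 ≤ G s) (h : IsRadialSol n a g R x) :
    MonotoneOn (fun r => r ^ (n * a) * energy n a G g x r) (Icc 0 R) := by
  have hna : 0 ≤ n * a := by positivity
  refine monotoneOn_of_hasDerivWithinAt_nonneg (convex_Icc 0 R)
    (((Real.continuous_rpow_const hna).mul (h.continuous_energy ha hg hG)).continuousOn)
    (fun r hr => ?_) (fun r hr => ?_)
    (f' := fun r => n * a * r ^ (n * a - 1) * energy n a G g x r +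
      r ^ (n * a) * -(n / r * |radFlux n (g ∘ x) r| ^ a))
  · rw [interior_Icc] at hr
    exact ((Real.hasDerivAt_rpow_const (Or.inl hr.1.ne')).mul
      (h.hasDerivAt_energy ha hg hG ⟨hr.1, hr.2.le⟩)).hasDerivWithinAt
  · rw [interior_Icc] at hr
    have hr0 := hr.1
    have hG0 := hG0 (x r)
    have ha0 : 0 < a := by linarith
    have : n * a * r ^ (n * a - 1) * energy n a G g x r +
      r ^ (n * a) * -(n / r * |radFlux n (g ∘ x) r| ^ a) =
      n * a * r ^ (n * a - 1) * G (x r) := by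
      rw [Real.rpow_sub_one hr0.ne', energy]
      field_simp
      ring
    rw [this]
    positivity

lemma energy_le (ha : 1 < a) (hg : Continuous g) (hG : ∀ s, HasDerivAt G (g s) s)
    (h : IsRadialSol n a g R x) {r : ℝ} (hr : r ∈ Icc 0 R) :
    energy n a G g x r ≤ G (x 0) := by
  have := h.energy_antitoneOn ha hg hG ⟨le_rfl, hr.1.trans hr.2⟩ hr hr.1
  simpa [energy, Real.zero_rpow (by linarith : a ≠ 0)] using this

lemma potential_le_energy (ha : 1 < a) (r : ℝ) : G (x r) ≤ energy n a G g x r := by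
  have : 0 ≤ |radFlux n (g ∘ x) r| ^ a / a := by positivity
  rw [energy]
  linarith

lemma potential_le (ha : 1 < a) (hg : Continuous g) (hG : ∀ s, HasDerivAt G (g s) s)
    (h : IsRadialSol n a g R x) {r : ℝ} (hr : r ∈ Icc 0 R) : G (x r) ≤ G (x 0) :=
  (potential_le_energy ha r).trans (h.energy_le ha hg hG hr)

lemma energy_pos (ha : 1 < a) (hg : Continuous g) (hG : ∀ s, HasDerivAt G (g s) s)
    (hG0 : ∀ s, 0 ≤ G s) (h : IsRadialSol n a g R x) (hx : 0 < G (x 0)) {r : ℝ}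
    (hr : r ∈ Icc 0 R) : 0 < energy n a G g x r := by
  have h0 : 0 < energy n a G g x 0 := hx.trans_le (potential_le_energy ha 0)
  rcases hr.1.eq_or_lt with rfl | hr0
  · exact h0
  -- The weight r^(na) can vanish at r = 0, so the monotonicity is started at a small s > 0 where
  -- the energy is still positive by continuity.
  have hev : ∀ᶠ s in 𝓝[>] (0 : ℝ), 0 < energy n a G g x s :=
    ((h.continuous_energy ha hg hG).continuousAt.eventually (lt_mem_nhds h0)).filter_mono
      nhdsWithin_le_nhds
  obtain ⟨s, hs, hsr⟩ := (hev.and (Ioo_mem_nhdsGT hr0)).exists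
  have hm := h.rpow_mul_energy_monotoneOn ha hg hG hG0 ⟨hsr.1.le, hsr.2.le.trans hr.2⟩ hr hsr.2.le
  have h1 : 0 < s ^ (n * a) * energy n a G g x s := mul_pos (Real.rpow_pos_of_pos hsr.1 _) hs
  exact pos_of_mul_pos_right (h1.trans_le hm) (Real.rpow_pos_of_pos hr0 _).le

/-- A solution with positive initial energy never meets the origin of the phase plane. -/
lemma phase_ne_zero (ha : 1 < a) (hg : Continuous g) (hG : ∀ s, HasDerivAt G (g s) s)
    (hG0 : ∀ s, 0 ≤ G s) (hG00 : G 0 = 0) (h : IsRadialSol n a g R x) (hx : 0 < G (x 0)) {r : ℝ}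
    (hr : r ∈ Icc 0 R) : x r ≠ 0 ∨ radMom n (g ∘ x) r ≠ 0 := by
  by_contra! hc
  have he := h.energy_pos ha hg hG hG0 hx hr
  rcases hr.1.eq_or_lt with rfl | hr0
  · rw [hc.1, hG00] at hx
    exact lt_irrefl _ hx
  · have hY : radFlux n (g ∘ x) r = 0 := by
      have := hc.2
      rw [radMom] at this
      exact (mul_eq_zero.1 this).resolve_left (pow_pos hr0 n).ne'
    rw [energy, hY, hc.1, hG00, abs_zero, Real.zero_rpow (by linarith)] at he
    simp at he

end energy

end IsRadialSol

/-! ### Angles of plane curves -/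

/-- The clockwise angular speed of the curve `(x, y)` with velocity `(x', y')`. -/
def angularSpeed (x y x' y' : ℝ) : ℝ := (y * x' - x * y') / (x ^ 2 + y ^ 2)

lemma phase_sq_pos {x y : ℝ} (h : x ≠ 0 ∨ y ≠ 0) : 0 < x ^ 2 + y ^ 2 := by
  rcases h with h | h <;> positivity

/-- Polar coordinates, measured clockwise from the negative first axis, along a plane curve that
avoids the origin. -/
lemma exists_polar {x y x' y' : ℝ → ℝ} {R : ℝ}
    (hx : ∀ r ∈ Icc 0 R, HasDerivAt x (x' r) r) (hy : ∀ r ∈ Icc 0 R, HasDerivAt y (y' r) r)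
    (hx' : ContinuousOn x' (Icc 0 R)) (hy' : ContinuousOn y' (Icc 0 R))
    (hne : ∀ r ∈ Icc 0 R, x r ≠ 0 ∨ y r ≠ 0) (hx0 : x 0 < 0) (hy0 : y 0 = 0)
    {r : ℝ} (hr : r ∈ Icc 0 R) :
    ∃ ρ > 0, x r = -(ρ * Real.cos (∫ s in (0 : ℝ)..r, angularSpeed (x s) (y s) (x' s) (y' s))) ∧
      y r = ρ * Real.sin (∫ s in (0 : ℝ)..r, angularSpeed (x s) (y s) (x' s) (y' s)) := by
  have hR : 0 ≤ R := hr.1.trans hr.2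
  have hxc : ContinuousOn x (Icc 0 R) := fun s hs => (hx s hs).continuousAt.continuousWithinAt
  have hyc : ContinuousOn y (Icc 0 R) := fun s hs => (hy s hs).continuousAt.continuousWithinAt
  have hden : ∀ s ∈ Icc 0 R, x s ^ 2 + y s ^ 2 ≠ 0 := fun s hs => (phase_sq_pos (hne s hs)).ne'
  set w : ℝ → ℝ := fun s => angularSpeed (x s) (y s) (x' s) (y' s) with hw
  have hwc : ContinuousOn w (Icc 0 R) :=
    ((hyc.mul hx').sub (hxc.mul hy')).div ((hxc.pow 2).add (hyc.pow 2)) hden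
  set Θ : ℝ → ℝ := fun r => ∫ s in (0 : ℝ)..r, w s with hΘ
  have hΘc : ContinuousOn Θ (Icc 0 R) := by
    have := intervalIntegral.continuousOn_primitive_interval (μ := volume)
      (hwc.integrableOn_Icc.mono_set (by rw [uIcc_of_le hR]))
    rwa [uIcc_of_le hR] at this
  have hΘd : ∀ s ∈ Ioo 0 R, HasDerivAt Θ (w s) s := by
    intro s hs
    have hnb : Icc 0 R ∈ 𝓝 s := Icc_mem_nhds hs.1 hs.2
    exact intervalIntegral.integral_hasDerivAt_right
      ((hwc.mono (Icc_subset_Icc le_rfl hs.2.le)).intervalIntegrable_of_Icc hs.1.le)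
      (hwc.stronglyMeasurableAtFilter_nhdsWithin measurableSet_Icc s |>.filter_mono
        (by rw [nhdsWithin_eq_nhds.2 hnb])) (hwc.continuousAt hnb)
  have hΘ0 : Θ 0 = 0 := by simp [hΘ]
  set ρ : ℝ → ℝ := fun s => Real.sqrt (x s ^ 2 + y s ^ 2) with hρ
  have hρpos : ∀ s ∈ Icc 0 R, 0 < ρ s := fun s hs => Real.sqrt_pos.2 (phase_sq_pos (hne s hs))
  have hρsq : ∀ s, ρ s ^ 2 = x s ^ 2 + y s ^ 2 := fun s => Real.sq_sqrt (by positivity)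
  have hρd : ∀ s ∈ Icc 0 R, HasDerivAt ρ
      ((x s * x' s + y s * y' s) / ρ s) s := by
    intro s hs
    refine ((((hx s hs).pow 2).add ((hy s hs).pow 2)).sqrt (hden s hs)).congr_deriv ?_
    have := hρpos s hs
    simp only [Pi.add_apply, Pi.pow_apply]
    change _ / (2 * ρ s) = _
    field_simp
    ring
  have hρc : ContinuousOn ρ (Icc 0 R) := fun s hs => (hρd s hs).continuousAt.continuousWithinAt
  have key : ∀ (A : ℝ → ℝ) (c : ℝ), ContinuousOn A (Icc 0 R) →
      (∀ s ∈ Ioo 0 R, HasDerivAt A 0 s) → A 0 = c → A r = c := by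
    intro A c hA hAd h0
    rcases hr.1.eq_or_lt with h | hr0
    · rw [← h, h0]
    obtain ⟨s, hs, hs'⟩ := exists_hasDerivAt_eq_slope A (fun _ => 0) hr0
      (hA.mono (Icc_subset_Icc le_rfl hr.2)) (fun s hs => hAd s ⟨hs.1, hs.2.trans_le hr.2⟩)
    rw [eq_comm, div_eq_zero_iff] at hs'
    rcases hs' with hs' | hs' <;> linarith
  have e : ∀ s ∈ Icc 0 R, ∀ P' P D : ℝ, P' * ρ s ^ 2 = P * D →
      (P' * ρ s - P * (D / ρ s)) / ρ s ^ 2 = 0 := by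
    intro s hs P' P D hPD
    have := hρpos s hs
    field_simp
    linear_combination hPD
  have hwρ : ∀ s ∈ Icc 0 R, w s * ρ s ^ 2 = y s * x' s - x s * y' s := by
    intro s hs
    rw [hρsq]
    exact div_mul_cancel₀ _ (hden s hs)
  -- The unit vector (-x, y)/ρ turned back by the angle Θ has zero derivative, so both of its
  -- coordinates keep their initial values 1 and 0.
  have hA := key (fun s => (-(x s) * Real.cos (Θ s) + y s * Real.sin (Θ s)) / ρ s) 1
    (((hxc.neg.mul (Real.continuous_cos.comp_continuousOn hΘc)).add (hyc.mul (Real.continuous_sin.comp_continuousOn hΘc))).div hρc fun s hs => (hρpos s hs).ne') ?_ ?_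
  have hB := key (fun s => (x s * Real.sin (Θ s) + y s * Real.cos (Θ s)) / ρ s) 0
    (((hxc.mul (Real.continuous_sin.comp_continuousOn hΘc)).add (hyc.mul (Real.continuous_cos.comp_continuousOn hΘc))).div hρc fun s hs => (hρpos s hs).ne') ?_ ?_
  · refine ⟨ρ r, hρpos r hr, ?_, ?_⟩
    · rw [div_eq_iff (hρpos r hr).ne'] at hA hB
      change x r = -(ρ r * Real.cos (Θ r))
      linear_combination (-Real.cos (Θ r)) * hA + Real.sin (Θ r) * hB -
        x r * Real.sin_sq_add_cos_sq (Θ r)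
    · rw [div_eq_iff (hρpos r hr).ne'] at hA hB
      change y r = ρ r * Real.sin (Θ r)
      linear_combination (Real.sin (Θ r)) * hA + Real.cos (Θ r) * hB -
        y r * Real.sin_sq_add_cos_sq (Θ r)
  · intro s hs
    have hs' := Ioo_subset_Icc_self hs
    have hp := hρpos s hs'
    have hsq := hρsq s
    have h1 := hΘd s hs
    refine ((((hx s hs').mul h1.sin).add ((hy s hs').mul h1.cos)).div (hρd s hs')
      hp.ne').congr_deriv ?_
    refine e s hs' _ _ _ ?_
    simp only [Pi.add_apply, Pi.mul_apply]
    linear_combination (x' s * Real.sin (Θ s) + y' s * Real.cos (Θ s)) * hsq +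
      (x s * Real.cos (Θ s) - y s * Real.sin (Θ s)) * hwρ s hs'
  · simp [hΘ0, hy0]
  · intro s hs
    have hs' := Ioo_subset_Icc_self hs
    have hp := hρpos s hs'
    have hsq := hρsq s
    have h1 := hΘd s hs
    refine ((((hx s hs').neg.mul h1.cos).add ((hy s hs').mul h1.sin)).div (hρd s hs')
      hp.ne').congr_deriv ?_
    refine e s hs' _ _ _ ?_
    simp only [Pi.add_apply, Pi.mul_apply, Pi.neg_apply]
    linear_combination (-x' s * Real.cos (Θ s) + y' s * Real.sin (Θ s)) * hsq +
      (x s * Real.sin (Θ s) + y s * Real.cos (Θ s)) * hwρ s hs'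
  · simp only [hΘ0, hρ, hy0]
    rw [Real.cos_zero, zero_pow two_ne_zero, add_zero, Real.sqrt_sq_eq_abs, abs_of_neg hx0]
    have := hx0.ne
    field_simp
    simp

/-- The angle, measured clockwise from the negative first axis, of the curve `(x, m v)` with `v` the
momentum. -/
def phaseAngle (n : ℕ) (a : ℝ) (g x : ℝ → ℝ) (m r : ℝ) : ℝ :=
  ∫ s in (0 : ℝ)..r, angularSpeed (x s) (m * radMom n (g ∘ x) s)
    (oddPow a (radFlux n (g ∘ x) s)) (m * -(s ^ n * g (x s)))

@[simp] lemma phaseAngle_zero (n : ℕ) (a : ℝ) (g x : ℝ → ℝ) (m : ℝ) :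
    phaseAngle n a g x m 0 = 0 := by
  simp [phaseAngle]

/-- In this form the speed is visibly nonnegative for m, s ≥ 0 wherever x g(x) ≥ 0. -/
lemma angularSpeed_phase {a : ℝ} (ha : 1 < a) (n : ℕ) (g x : ℝ → ℝ) (m s : ℝ) :
    angularSpeed (x s) (m * radMom n (g ∘ x) s) (oddPow a (radFlux n (g ∘ x) s))
      (m * -(s ^ n * g (x s))) =
    m * s ^ n * (|radFlux n (g ∘ x) s| ^ a + x s * g (x s)) /
      (x s ^ 2 + (m * radMom n (g ∘ x) s) ^ 2) := by
  rw [angularSpeed, ← mul_oddPow ha]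
  congr 1
  simp only [radMom]
  ring

namespace IsRadialSol

variable {n : ℕ} {a R m : ℝ} {g x : ℝ → ℝ}

lemma phase_ne_zero_mul (hm : 0 < m)
    (hne : ∀ r ∈ Icc 0 R, x r ≠ 0 ∨ radMom n (g ∘ x) r ≠ 0) :
    ∀ r ∈ Icc 0 R, x r ≠ 0 ∨ m * radMom n (g ∘ x) r ≠ 0 :=
  fun r hr => (hne r hr).imp_right fun h => mul_ne_zero hm.ne' h

lemma continuousOn_angularSpeed (ha : 1 < a) (hg : Continuous g) (h : IsRadialSol n a g R x)
    (hm : 0 < m) (hne : ∀ r ∈ Icc 0 R, x r ≠ 0 ∨ radMom n (g ∘ x) r ≠ 0) :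
    ContinuousOn (fun s => angularSpeed (x s) (m * radMom n (g ∘ x) s)
      (oddPow a (radFlux n (g ∘ x) s)) (m * -(s ^ n * g (x s)))) (Icc 0 R) := by
  have hx := h.continuous
  have h1 := continuous_radMom n (hg.comp hx)
  have h2 := (continuous_oddPow ha).comp (continuous_radFlux n (hg.comp hx))
  have h3 := hg.comp hx
  refine ContinuousOn.div (Continuous.continuousOn ?_) (Continuous.continuousOn ?_)
    fun s hs => (phase_sq_pos (phase_ne_zero_mul hm hne s hs)).ne'
  · exact ((continuous_const.mul h1).mul h2).sub
      (hx.mul (continuous_const.mul ((continuous_id.pow n).mul h3).neg))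
  · exact (hx.pow 2).add ((continuous_const.mul h1).pow 2)

lemma polar (ha : 1 < a) (hg : Continuous g) (h : IsRadialSol n a g R x) (hm : 0 < m)
    (hne : ∀ r ∈ Icc 0 R, x r ≠ 0 ∨ radMom n (g ∘ x) r ≠ 0) (hx0 : x 0 < 0)
    {r : ℝ} (hr : r ∈ Icc 0 R) :
    ∃ ρ > 0, x r = -(ρ * Real.cos (phaseAngle n a g x m r)) ∧
      m * radMom n (g ∘ x) r = ρ * Real.sin (phaseAngle n a g x m r) := by
  have hgx := hg.comp h.continuous
  exact exists_polar (y := fun r => m * radMom n (g ∘ x) r) (fun r hr => h.hasDerivAt hr)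
    (fun r _ => (hasDerivAt_radMom n hgx r).const_mul m)
    ((continuous_oddPow ha).comp (continuous_radFlux n hgx)).continuousOn
    (continuous_const.mul ((continuous_id.pow n).mul hgx).neg).continuousOn
    (phase_ne_zero_mul hm hne) hx0 (by simp) hr

lemma continuousOn_phaseAngle (ha : 1 < a) (hg : Continuous g) (h : IsRadialSol n a g R x)
    (hm : 0 < m) (hne : ∀ r ∈ Icc 0 R, x r ≠ 0 ∨ radMom n (g ∘ x) r ≠ 0) (hR : 0 ≤ R) :
    ContinuousOn (phaseAngle n a g x m) (Icc 0 R) := by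
  have := intervalIntegral.continuousOn_primitive_interval (μ := volume)
    ((h.continuousOn_angularSpeed ha hg hm hne).integrableOn_Icc.mono_set (by rw [uIcc_of_le hR]))
  rwa [uIcc_of_le hR] at this

lemma hasDerivAt_phaseAngle (ha : 1 < a) (hg : Continuous g) (h : IsRadialSol n a g R x)
    (hm : 0 < m) (hne : ∀ r ∈ Icc 0 R, x r ≠ 0 ∨ radMom n (g ∘ x) r ≠ 0) {r : ℝ}
    (hr : r ∈ Ioo 0 R) :
    HasDerivAt (phaseAngle n a g x m) (m * r ^ n * (|radFlux n (g ∘ x) r| ^ a + x r * g (x r)) /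
      (x r ^ 2 + (m * radMom n (g ∘ x) r) ^ 2)) r := by
  rw [← angularSpeed_phase ha]
  have hc := h.continuousOn_angularSpeed ha hg hm hne
  have hnb : Icc 0 R ∈ 𝓝 r := Icc_mem_nhds hr.1 hr.2
  exact intervalIntegral.integral_hasDerivAt_right
    ((hc.mono (Icc_subset_Icc le_rfl hr.2.le)).intervalIntegrable_of_Icc hr.1.le)
    (hc.stronglyMeasurableAtFilter_nhdsWithin measurableSet_Icc r |>.filter_mono
      (by rw [nhdsWithin_eq_nhds.2 hnb])) (hc.continuousAt hnb)

/-- The terms |Y|^a and x g(x) are nonnegative and cannot vanish together, because the curve avoids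
the origin. -/
lemma phaseAngle_strictMonoOn (ha : 1 < a) (hg : Continuous g) (h : IsRadialSol n a g R x)
    (hm : 0 < m) (hne : ∀ r ∈ Icc 0 R, x r ≠ 0 ∨ radMom n (g ∘ x) r ≠ 0) (hR : 0 ≤ R)
    (hs : ∀ r ∈ Icc 0 R, x r ≠ 0 → 0 < x r * g (x r)) :
    StrictMonoOn (phaseAngle n a g x m) (Icc 0 R) := by
  refine strictMonoOn_of_hasDerivWithinAt_pos (convex_Icc 0 R)
    (h.continuousOn_phaseAngle ha hg hm hne hR) (fun r hr => ?_) (fun r hr => ?_)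
    (f' := fun r => m * r ^ n * (|radFlux n (g ∘ x) r| ^ a + x r * g (x r)) /
      (x r ^ 2 + (m * radMom n (g ∘ x) r) ^ 2))
  · rw [interior_Icc] at hr
    exact (h.hasDerivAt_phaseAngle ha hg hm hne hr).hasDerivWithinAt
  · rw [interior_Icc] at hr
    have hr' := Ioo_subset_Icc_self hr
    have hr0 := hr.1
    refine div_pos (mul_pos (by positivity) ?_) (phase_sq_pos (phase_ne_zero_mul hm hne r hr'))
    by_cases hx : x r = 0
    · have : radFlux n (g ∘ x) r ≠ 0 := by
        have := (hne r hr').resolve_left (not_not.2 hx)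
        rw [radMom] at this
        exact right_ne_zero_of_mul this
      rw [hx, zero_mul, add_zero]
      exact Real.rpow_pos_of_pos (abs_pos.2 this) a
    · exact add_pos_of_nonneg_of_pos (Real.rpow_nonneg (abs_nonneg _) a) (hs r hr' hx)

/-- Rescaling the momentum changes the angle by less than a quarter turn. -/
lemma abs_phaseAngle_sub_lt (ha : 1 < a) (hg : Continuous g) (h : IsRadialSol n a g R x)
    (hm : 0 < m) (hne : ∀ r ∈ Icc 0 R, x r ≠ 0 ∨ radMom n (g ∘ x) r ≠ 0) (hx0 : x 0 < 0)
    {r : ℝ} (hr : r ∈ Icc 0 R) :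
    |phaseAngle n a g x m r - phaseAngle n a g x 1 r| < Real.pi / 2 := by
  have hR : 0 ≤ R := hr.1.trans hr.2
  set D : ℝ → ℝ := fun r => |phaseAngle n a g x m r - phaseAngle n a g x 1 r| with hD
  have hDc : ContinuousOn D (Icc 0 r) :=
    ((h.continuousOn_phaseAngle ha hg hm hne hR).sub
      (h.continuousOn_phaseAngle ha hg one_pos hne hR)).abs.mono (Icc_subset_Icc le_rfl hr.2)
  have hcos : ∀ s ∈ Icc 0 R, 0 < Real.cos (D s) := by
    intro s hs
    obtain ⟨ρ, hρ, h1, h2⟩ := h.polar ha hg hm hne hx0 hs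
    obtain ⟨σ, hσ, h3, h4⟩ := h.polar ha hg one_pos hne hx0 hs
    rw [one_mul] at h4
    rw [hD, Real.cos_abs, Real.cos_sub]
    -- The inner product of (x, m v) and (x, v) is positive, so the cosine of the angle between them
    -- is too; by continuity from 0 the difference never reaches π/2.
    have h5 : 0 < x s * x s + (m * radMom n (g ∘ x) s) * radMom n (g ∘ x) s := by
      rcases hne s hs with h | h
      · have := mul_self_pos.2 h
        nlinarith [mul_self_nonneg (radMom n (g ∘ x) s)]
      · have := mul_self_pos.2 h
        nlinarith [mul_self_nonneg (x s), mul_pos hm this]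
    have h6 : x s * x s + (m * radMom n (g ∘ x) s) * radMom n (g ∘ x) s = ρ * σ *
        (Real.cos (phaseAngle n a g x m s) * Real.cos (phaseAngle n a g x 1 s) +
        Real.sin (phaseAngle n a g x m s) * Real.sin (phaseAngle n a g x 1 s)) := by
      nth_rewrite 1 [h1, h3]
      rw [h2, h4]
      ring
    rw [h6] at h5
    exact pos_of_mul_pos_right h5 (by positivity)
  by_contra! hc
  have hD0 : D 0 = 0 := by simp [hD]
  obtain ⟨s, hs, hs'⟩ := intermediate_value_Icc hr.1 hDc
    (show Real.pi / 2 ∈ Icc (D 0) (D r) from ⟨by rw [hD0]; positivity, hc⟩)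
  have := hcos s ⟨hs.1, hs.2.trans hr.2⟩
  rw [hs', Real.cos_pi_div_two] at this
  exact lt_irrefl _ this

/-- The angle starts at 0 and is continuous; at the value π/2 the curve would lie on the axis x = 0.
-/
lemma phaseAngle_lt_of_neg (ha : 1 < a) (hg : Continuous g) (h : IsRadialSol n a g R x)
    (hR : 0 ≤ R) (hneg : ∀ r ∈ Icc 0 R, x r < 0) : phaseAngle n a g x 1 R < Real.pi / 2 := by
  have hne : ∀ r ∈ Icc 0 R, x r ≠ 0 ∨ radMom n (g ∘ x) r ≠ 0 := fun r hr => Or.inl (hneg r hr).ne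
  by_contra! hc
  obtain ⟨s, hs, hs'⟩ := intermediate_value_Icc hR
    (h.continuousOn_phaseAngle ha hg one_pos hne hR)
    (show Real.pi / 2 ∈ Icc _ _ from ⟨by rw [phaseAngle_zero]; positivity, hc⟩)
  obtain ⟨ρ, hρ, h1, h2⟩ := h.polar ha hg one_pos hne (hneg 0 ⟨le_rfl, hR⟩) hs
  rw [hs', Real.cos_pi_div_two, mul_zero, neg_zero] at h1
  exact (hneg s hs).ne h1

/-- At a multiple of π the curve is on the horizontal axis: this is the Neumann condition at R. -/
lemma radFlux_eq_zero_of_phaseAngle (ha : 1 < a) (hg : Continuous g) (h : IsRadialSol n a g R x)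
    (hR : 0 < R) (hne : ∀ r ∈ Icc 0 R, x r ≠ 0 ∨ radMom n (g ∘ x) r ≠ 0) (hx0 : x 0 < 0)
    {j : ℕ} (hj : phaseAngle n a g x 1 R = j * Real.pi) : radFlux n (g ∘ x) R = 0 := by
  obtain ⟨ρ, hρ, h1, h2⟩ := h.polar ha hg one_pos hne hx0 ⟨hR.le, le_rfl⟩
  rw [hj, Real.sin_nat_mul_pi, mul_zero, one_mul, radMom] at h2
  exact (mul_eq_zero.1 h2).resolve_left (pow_pos hR n).ne'

/-- If the total angle is `j π` then `x` has exactly `j` zeros. -/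
lemma encard_zeros (ha : 1 < a) (hg : Continuous g) (h : IsRadialSol n a g R x)
    (hR : 0 < R) (hne : ∀ r ∈ Icc 0 R, x r ≠ 0 ∨ radMom n (g ∘ x) r ≠ 0) (hx0 : x 0 < 0)
    (hs : ∀ r ∈ Icc 0 R, x r ≠ 0 → 0 < x r * g (x r))
    {j : ℕ} (hj : phaseAngle n a g x 1 R = j * Real.pi) :
    {r | r ∈ Icc 0 R ∧ x r = 0}.encard = j := by
  set Θ := phaseAngle n a g x 1 with hΘ
  have hmono := h.phaseAngle_strictMonoOn ha hg one_pos hne hR.le hs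
  have hcont := h.continuousOn_phaseAngle ha hg one_pos hne hR.le
  -- The angle runs injectively from 0 to jπ, and x vanishes exactly at the values iπ + π/2, of
  -- which those with i < j occur.
  have himg : Θ '' {r | r ∈ Icc 0 R ∧ x r = 0} =
      (fun i : ℕ => (i : ℝ) * Real.pi + Real.pi / 2) '' (Finset.range j : Set ℕ) := by
    have hpi := Real.pi_pos
    ext θ
    constructor
    · rintro ⟨r, ⟨hr, hxr⟩, rfl⟩
      obtain ⟨ρ, hρ, h1, -⟩ := h.polar ha hg one_pos hne hx0 hr
      rw [hxr, eq_comm, neg_eq_zero, mul_eq_zero, or_iff_right hρ.ne', Real.cos_eq_zero_iff] at h1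
      obtain ⟨i, hi⟩ := h1
      have h0 : 0 ≤ Θ r := by
        rw [← phaseAngle_zero n a g x 1]
        exact hmono.monotoneOn ⟨le_rfl, hR.le⟩ hr hr.1
      have h1 : Θ r ≤ j * Real.pi := by
        rw [← hj]
        exact hmono.monotoneOn hr ⟨hR.le, le_rfl⟩ hr.2
      have hi' : Θ r = ((i : ℝ) + 1 / 2) * Real.pi := by
        rw [hΘ, hi]
        ring
      rw [hi'] at h0 h1
      have h2 : (-1 : ℝ) < i := by
        have := nonneg_of_mul_nonneg_left h0 hpi
        linarith
      have h3 : (i : ℝ) < j := by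
        have := le_of_mul_le_mul_right h1 hpi
        linarith
      lift i to ℕ using by
        have : (-1 : ℤ) < i := by exact_mod_cast h2
        omega
      refine ⟨i, by simpa using (by exact_mod_cast h3 : i < j), ?_⟩
      rw [hi']
      push_cast
      ring
    · rintro ⟨i, hi, rfl⟩
      have hi : i < j := by simpa using hi
      have hi' : (i : ℝ) + 1 ≤ j := by exact_mod_cast hi
      obtain ⟨r, hr, hr'⟩ := intermediate_value_Icc hR.le hcont
        (show (i : ℝ) * Real.pi + Real.pi / 2 ∈ Icc _ _ from
          ⟨by rw [phaseAngle_zero]; positivity, by rw [← hΘ, hj]; nlinarith⟩)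
      refine ⟨r, ⟨hr, ?_⟩, hr'⟩
      obtain ⟨ρ, hρ, h1, -⟩ := h.polar ha hg one_pos hne hx0 hr
      rw [h1, hr', neg_eq_zero, mul_eq_zero]
      refine Or.inr (Real.cos_eq_zero_iff.2 ⟨i, ?_⟩)
      push_cast
      ring
  have h1 : (Θ '' {r | r ∈ Icc 0 R ∧ x r = 0}).encard = {r | r ∈ Icc 0 R ∧ x r = 0}.encard :=
    (hmono.injOn.mono fun r hr => hr.1).encard_image
  have hinj : Function.Injective fun i : ℕ => (i : ℝ) * Real.pi + Real.pi / 2 := by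
    intro i k hik
    have := mul_right_cancel₀ Real.pi_ne_zero (add_right_cancel hik)
    exact_mod_cast this
  rw [← h1, himg, hinj.encard_image, Set.encard_coe_eq_coe_finsetCard, Finset.card_range]

end IsRadialSol

/-! ### Quantitative lower bound for the rotation -/

/-- The constant in the lower bound for the rotation over `[r₀, 2 r₀]`. -/
def rotationConst (n : ℕ) (a k₁ k₂ : ℝ) : ℝ :=
  min (2 * k₁ / k₂) 1 * ((2 : ℝ) ^ (n * a))⁻¹ / (2 / k₁ + 4 ^ n * a ^ (2 / a))

lemma rotationConst_pos (n : ℕ) {a k₁ k₂ : ℝ} (ha : 1 < a) (hk₁ : 0 < k₁) (hk₂ : 0 < k₂) :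
    0 < rotationConst n a k₁ k₂ := by
  have : 0 < min (2 * k₁ / k₂) 1 := lt_min (by positivity) one_pos
  unfold rotationConst
  positivity

/-- Lower bound for the rotation over `[r₀, 2 r₀]` in terms of the energy at `r₀`. -/
lemma IsRadialSol.rotation {n : ℕ} {a R : ℝ} {g x G : ℝ → ℝ} (ha : 1 < a) (hg : Continuous g)
    (hG : ∀ s, HasDerivAt G (g s) s) (hG0 : ∀ s, 0 ≤ G s) (hgs : ∀ s, 0 ≤ s * g s)
    (h : IsRadialSol n a g R x)
    (hne : ∀ r ∈ Icc 0 R, x r ≠ 0 ∨ radMom n (g ∘ x) r ≠ 0) (hx0 : x 0 < 0)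
    {k₁ k₂ r₀ : ℝ} (hk₁ : 0 < k₁) (hk₂ : 0 < k₂) (hr₀ : 0 < r₀) (hr₀R : 2 * r₀ ≤ R)
    (h1 : ∀ r ∈ Icc r₀ (2 * r₀), k₁ * x r ^ 2 ≤ x r * g (x r))
    (h2 : ∀ r ∈ Icc r₀ (2 * r₀), k₁ / 2 * x r ^ 2 ≤ G (x r))
    (h3 : ∀ r ∈ Icc r₀ (2 * r₀), G (x r) ≤ k₂ / 2 * x r ^ 2)
    (he : 0 < energy n a G g x r₀) :
    rotationConst n a k₁ k₂ * r₀ * energy n a G g x r₀ ^ (1 / 2 - 1 / a) - Real.pi / 2 ≤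
      phaseAngle n a g x 1 (2 * r₀) := by
  set e := energy n a G g x r₀ with he'
  -- At energy at most e, |x| is at most of order e^(1/2) and |Y| at most of order e^(1/a).
  -- Rescaling the momentum by m = μ / r₀^n brings both coordinates to order e^(1/2) on [r₀, 2r₀],
  -- while the numerator of the speed is at least of order μ e; hence the speed is at least of order
  -- μ.
  set μ := e ^ (1 / 2 - 1 / a) with hμ
  have hμ0 : 0 < μ := Real.rpow_pos_of_pos he _
  set m := μ / r₀ ^ n with hm
  have hm0 : 0 < m := by positivity
  have ha0 : 0 < a := by linarith
  have hR : 0 ≤ R := by linarith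
  have hsub : Icc r₀ (2 * r₀) ⊆ Icc 0 R := Icc_subset_Icc hr₀.le hr₀R
  set c := rotationConst n a k₁ k₂ with hc
  have hspeed : ∀ r ∈ Icc r₀ (2 * r₀), μ * c ≤
      m * r ^ n * (|radFlux n (g ∘ x) r| ^ a + x r * g (x r)) /
      (x r ^ 2 + (m * radMom n (g ∘ x) r) ^ 2) := by
    intro r hr
    have hr0 : 0 < r := hr₀.trans_le hr.1
    set Y := radFlux n (g ∘ x) r with hY
    have he1 : energy n a G g x r ≤ e := h.energy_antitoneOn ha hg hG
      (hsub ⟨le_rfl, by linarith⟩) (hsub hr) hr.1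
    -- While r at most doubles, the energy loses at most the factor 2^(na).
    have he2 : ((2 : ℝ) ^ (n * a))⁻¹ * e ≤ energy n a G g x r := by
      have hmon := h.rpow_mul_energy_monotoneOn ha hg hG hG0
        (hsub ⟨le_rfl, by linarith⟩) (hsub hr) hr.1
      simp only at hmon
      have hna : 0 ≤ n * a := by positivity
      have hle : r ^ (n * a) ≤ (2 * r₀) ^ (n * a) := Real.rpow_le_rpow hr0.le hr.2 hna
      rw [Real.mul_rpow zero_le_two hr₀.le] at hle
      have hpos : 0 ≤ energy n a G g x r := (hG0 _).trans (IsRadialSol.potential_le_energy ha r)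
      have := hmon.trans (mul_le_mul_of_nonneg_right hle hpos)
      rw [inv_mul_le_iff₀ (by positivity)]
      have hp : 0 < r₀ ^ (n * a) := Real.rpow_pos_of_pos hr₀ _
      nlinarith
    have hnum : min (2 * k₁ / k₂) 1 * (((2 : ℝ) ^ (n * a))⁻¹ * e) ≤ |Y| ^ a + x r * g (x r) := by
      have hmin : 0 < min (2 * k₁ / k₂) 1 := lt_min (by positivity) one_pos
      refine (mul_le_mul_of_nonneg_left he2 hmin.le).trans ?_
      rw [energy, ← hY, mul_add]
      have hya : 0 ≤ |Y| ^ a / a := by positivity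
      have i1 : min (2 * k₁ / k₂) 1 * (|Y| ^ a / a) ≤ |Y| ^ a := by
        calc _ ≤ 1 * (|Y| ^ a / a) := mul_le_mul_of_nonneg_right (min_le_right _ _) hya
          _ ≤ |Y| ^ a := by
            rw [one_mul]
            exact div_le_self (by positivity) ha.le
      have i2 : min (2 * k₁ / k₂) 1 * G (x r) ≤ x r * g (x r) := by
        calc _ ≤ (2 * k₁ / k₂) * G (x r) := mul_le_mul_of_nonneg_right (min_le_left _ _) (hG0 _)
          _ ≤ (2 * k₁ / k₂) * (k₂ / 2 * x r ^ 2) :=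
            mul_le_mul_of_nonneg_left (h3 r hr) (by positivity)
          _ = k₁ * x r ^ 2 := by field_simp
          _ ≤ _ := h1 r hr
      linarith
    have hratio1 : 1 ≤ r ^ n / r₀ ^ n := by
      rw [one_le_div (by positivity)]
      exact pow_le_pow_left₀ hr₀.le hr.1 n
    have hratio2 : r ^ n / r₀ ^ n ≤ 2 ^ n := by
      rw [div_le_iff₀ (by positivity), ← mul_pow]
      exact pow_le_pow_left₀ hr0.le hr.2 n
    have hden : x r ^ 2 + (m * radMom n (g ∘ x) r) ^ 2 ≤
        e * (2 / k₁ + 4 ^ n * a ^ (2 / a)) := by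
      have i1 : x r ^ 2 ≤ e * (2 / k₁) := by
        have := (h2 r hr).trans ((IsRadialSol.potential_le_energy ha r).trans he1)
        calc x r ^ 2 = k₁ / 2 * x r ^ 2 * (2 / k₁) := by field_simp
          _ ≤ e * (2 / k₁) := mul_le_mul_of_nonneg_right this (by positivity)
      have i2 : Y ^ 2 ≤ (a * e) ^ (2 / a) := by
        have i3 : |Y| ^ a ≤ a * e := by
          have h4 : |Y| ^ a / a ≤ e := by
            have := hG0 (x r)
            rw [energy, ← hY] at he1
            linarith
          rwa [div_le_iff₀' ha0] at h4
        calc Y ^ 2 = (|Y| ^ a) ^ (2 / a) := by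
              rw [← Real.rpow_mul (abs_nonneg _), mul_div_cancel₀ _ ha0.ne', Real.rpow_two, sq_abs]
          _ ≤ (a * e) ^ (2 / a) := Real.rpow_le_rpow (by positivity) i3 (by positivity)
      have i4 : (m * radMom n (g ∘ x) r) ^ 2 = (r ^ n / r₀ ^ n) ^ 2 * (μ ^ 2 * Y ^ 2) := by
        rw [radMom, ← hY, hm]
        field_simp
      have i5 : μ ^ 2 * (a * e) ^ (2 / a) = e * a ^ (2 / a) := by
        rw [Real.mul_rpow ha0.le he.le, hμ, ← Real.rpow_natCast, ← Real.rpow_mul he.le,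
          mul_left_comm, ← Real.rpow_add he]
        rw [show (1 / 2 - 1 / a) * ((2 : ℕ) : ℝ) + 2 / a = 1 by push_cast; field_simp; ring,
          Real.rpow_one]
        ring
      have i6 : (r ^ n / r₀ ^ n) ^ 2 ≤ 4 ^ n := by
        calc (r ^ n / r₀ ^ n) ^ 2 ≤ (2 ^ n) ^ 2 := pow_le_pow_left₀ (by positivity) hratio2 2
          _ = 4 ^ n := by rw [← pow_mul, mul_comm, pow_mul]; norm_num
      have i7 : (m * radMom n (g ∘ x) r) ^ 2 ≤ 4 ^ n * (e * a ^ (2 / a)) := by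
        rw [i4, ← i5]
        exact mul_le_mul i6 (mul_le_mul_of_nonneg_left i2 (by positivity)) (by positivity)
          (by positivity)
      linarith
    rw [le_div_iff₀ (phase_sq_pos (phase_ne_zero_mul hm0 hne r (hsub hr)))]
    have hmr : μ ≤ m * r ^ n := by
      have : m * r ^ n = μ * (r ^ n / r₀ ^ n) := by rw [hm]; field_simp
      rw [this]
      exact le_mul_of_one_le_right hμ0.le hratio1
    have hmin : 0 < min (2 * k₁ / k₂) 1 := lt_min (by positivity) one_pos
    calc μ * c * (x r ^ 2 + (m * radMom n (g ∘ x) r) ^ 2)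
        ≤ μ * c * (e * (2 / k₁ + 4 ^ n * a ^ (2 / a))) :=
          mul_le_mul_of_nonneg_left hden
            (mul_pos hμ0 (rotationConst_pos n ha hk₁ hk₂)).le
      _ = μ * (min (2 * k₁ / k₂) 1 * (((2 : ℝ) ^ (n * a))⁻¹ * e)) := by
          rw [hc, rotationConst]
          field_simp
      _ ≤ m * r ^ n * (|Y| ^ a + x r * g (x r)) :=
          mul_le_mul hmr hnum (by positivity) (by positivity)
  have hcont := h.continuousOn_phaseAngle ha hg hm0 hne hR
  have hmono : MonotoneOn (phaseAngle n a g x m) (Icc 0 R) := by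
    refine monotoneOn_of_hasDerivWithinAt_nonneg (convex_Icc 0 R) hcont (fun r hr => ?_)
      (fun r hr => ?_)
      (f' := fun r => m * r ^ n * (|radFlux n (g ∘ x) r| ^ a + x r * g (x r)) /
        (x r ^ 2 + (m * radMom n (g ∘ x) r) ^ 2))
    · rw [interior_Icc] at hr
      exact (h.hasDerivAt_phaseAngle ha hg hm0 hne hr).hasDerivWithinAt
    · rw [interior_Icc] at hr
      have := hr.1
      have := hgs (x r)
      positivity
  have hstart : 0 ≤ phaseAngle n a g x m r₀ := by
    rw [← phaseAngle_zero n a g x m]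
    exact hmono ⟨le_rfl, hR⟩ (hsub ⟨le_rfl, by linarith⟩) hr₀.le
  have hgrow : μ * c * (2 * r₀ - r₀) ≤ phaseAngle n a g x m (2 * r₀) - phaseAngle n a g x m r₀ := by
    refine Convex.mul_sub_le_image_sub_of_le_deriv (convex_Icc r₀ (2 * r₀)) (hcont.mono hsub)
      (fun r hr => ?_) (fun r hr => ?_) r₀ ⟨le_rfl, by linarith⟩ (2 * r₀) ⟨by linarith, le_rfl⟩
      (by linarith)
    all_goals
      rw [interior_Icc] at hr
      have hd := h.hasDerivAt_phaseAngle ha hg hm0 hne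
        (r := r) ⟨hr₀.trans hr.1, hr.2.trans_le hr₀R⟩
    · exact hd.differentiableAt.differentiableWithinAt
    · rw [hd.deriv]
      exact hspeed r (Ioo_subset_Icc_self hr)
  -- Returning from the rescaled angle to the one with m = 1 costs the π/2 in the statement.
  have hcmp := abs_lt.1 (h.abs_phaseAngle_sub_lt ha hg hm0 hne hx0
    (hsub (⟨by linarith, le_rfl⟩ : 2 * r₀ ∈ Icc r₀ (2 * r₀))))
  nlinarith [hcmp.2]

/-! ### Compactness and Tonelli's delayed approximations -/

/-- Arzelà–Ascoli for equi-Lipschitz sequences on a compact interval. -/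
lemma exists_subseq_tendstoUniformlyOn {R C D : ℝ} (hR : 0 ≤ R) (u : ℕ → ℝ → ℝ)
    (hD : ∀ k, ∀ r ∈ Icc 0 R, |u k r| ≤ D)
    (hL : ∀ k, ∀ r ∈ Icc 0 R, ∀ s ∈ Icc 0 R, |u k r - u k s| ≤ C * |r - s|) :
    ∃ w : ℝ → ℝ, ∃ φ : ℕ → ℕ, StrictMono φ ∧ ContinuousOn w (Icc 0 R) ∧
      TendstoUniformlyOn (fun k => u (φ k)) w atTop (Icc 0 R) := by
  have hC : ∀ k, LipschitzWith C.toNNReal fun r : Icc (0 : ℝ) R => u k r := by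
    intro k
    refine LipschitzWith.of_dist_le_mul fun r s => ?_
    rw [Real.dist_eq, Subtype.dist_eq, Real.dist_eq]
    exact (hL k r r.2 s s.2).trans
      (mul_le_mul_of_nonneg_right (Real.le_coe_toNNReal C) (abs_nonneg _))
  let U : ℕ → BoundedContinuousFunction (Icc (0 : ℝ) R) ℝ := fun k =>
    BoundedContinuousFunction.mkOfCompact ⟨fun r => u k r, (hC k).continuous⟩
  have hcomp : IsCompact (closure (range U)) := by
    refine BoundedContinuousFunction.arzela_ascoli (Icc (-D) D) isCompact_Icc _ ?_ ?_
    · rintro f r ⟨k, rfl⟩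
      exact abs_le.1 (hD k r r.2)
    · refine (LipschitzWith.uniformEquicontinuous _ C.toNNReal ?_).equicontinuous
      rintro ⟨f, k, rfl⟩
      exact hC k
  obtain ⟨W, -, φ, hφ, hlim⟩ := hcomp.tendsto_subseq fun k => subset_closure (mem_range_self k)
  rw [BoundedContinuousFunction.tendsto_iff_tendstoUniformly] at hlim
  refine ⟨IccExtend hR W, φ, hφ, (W.continuous.Icc_extend').continuousOn, ?_⟩
  rw [Metric.tendstoUniformlyOn_iff]
  rw [Metric.tendstoUniformly_iff] at hlim
  intro ε hε
  filter_upwards [hlim ε hε] with k hk r hr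
  rw [IccExtend_of_mem hR _ hr]
  exact hk ⟨r, hr⟩

/-- Iterates of the Volterra operator delayed by `h`. -/
def delayedIterate (n : ℕ) (a : ℝ) (g : ℝ → ℝ) (h d : ℝ) : ℕ → ℝ → ℝ
  | 0 => fun _ => d
  | m + 1 => fun r => d + ∫ s in (0 : ℝ)..max (r - h) 0,
      oddPow a (radFlux n (g ∘ delayedIterate n a g h d m) s)

lemma continuous_delayedIterate {n : ℕ} {a : ℝ} (ha : 1 < a) {g : ℝ → ℝ} (hg : Continuous g)
    (h : ℝ) (m : ℕ) : Continuous (Function.uncurry fun d => delayedIterate n a g h d m) := by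
  induction m with
  | zero => exact continuous_fst
  | succ m ih =>
    have h1 : Continuous (Function.uncurry fun d s =>
        oddPow a (radFlux n (g ∘ delayedIterate n a g h d m) s)) :=
      (continuous_oddPow ha).comp (continuous_radFlux_param n
        (k := fun d => g ∘ delayedIterate n a g h d m) (hg.comp ih))
    have h2 := (intervalIntegral.continuous_parametric_primitive_of_continuous
      (a₀ := (0 : ℝ)) (μ := volume) h1).comp
      (show Continuous fun z : ℝ × ℝ => (z.1, max (z.2 - h) 0) by fun_prop)
    exact continuous_fst.add h2

/-- The value at r uses the previous iterate on [0, r - h] only, so each iteration settles one more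
interval of length h. Finitely many iterations solve the delayed equation on [0, R], and they are
continuous in d. -/
lemma delayedIterate_succ_eq (n : ℕ) (a : ℝ) (g : ℝ → ℝ) {h : ℝ} (hh : 0 < h) (d : ℝ) (m : ℕ) :
    ∀ r ∈ Icc 0 (m * h), delayedIterate n a g h d m r = delayedIterate n a g h d (m + 1) r := by
  induction m with
  | zero =>
    intro r hr
    have : max (r - h) 0 = 0 := max_eq_right (by
      have := hr.2
      simp at this
      linarith)
    simp [delayedIterate, this]
  | succ m ih =>
    intro r hr
    have h1 : max (r - h) 0 ≤ m * h := by
      refine max_le ?_ (by positivity)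
      have := hr.2
      push_cast at this
      linarith
    change d + (∫ s in (0 : ℝ)..max (r - h) 0,
        oddPow a (radFlux n (g ∘ delayedIterate n a g h d m) s)) =
      d + ∫ s in (0 : ℝ)..max (r - h) 0,
        oddPow a (radFlux n (g ∘ delayedIterate n a g h d (m + 1)) s)
    congr 1
    refine intervalIntegral.integral_congr fun s hs => ?_
    rw [uIcc_of_le (le_max_right _ _)] at hs
    exact congrArg _ (radFlux_congr n (fun t ht => congrArg g (ih t ht)) ⟨hs.1, hs.2.trans h1⟩)

/-- `u` solves on `[0, R]` the integral equation delayed by `h` with initial value `d`. -/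
structure IsDelayedSol (n : ℕ) (a : ℝ) (g : ℝ → ℝ) (R h d : ℝ) (u : ℝ → ℝ) : Prop where
  continuous : Continuous u
  eq : ∀ r ∈ Icc 0 R, u r = d + ∫ s in (0 : ℝ)..max (r - h) 0, oddPow a (radFlux n (g ∘ u) s)

lemma isDelayedSol_delayedIterate {n : ℕ} {a : ℝ} (ha : 1 < a) {g : ℝ → ℝ} (hg : Continuous g)
    {h R : ℝ} (hh : 0 < h) (d : ℝ) {m : ℕ} (hm : R ≤ m * h) :
    IsDelayedSol n a g R h d (delayedIterate n a g h d m) where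
  continuous := (continuous_delayedIterate ha hg h m).comp (Continuous.prodMk_right d)
  eq r hr := delayedIterate_succ_eq n a g hh d m r ⟨hr.1, hr.2.trans hm⟩

lemma abs_radAvg_le_on (n : ℕ) {k : ℝ → ℝ} {B R : ℝ} (h : ∀ s ∈ Icc 0 R, |k s| ≤ B) {r : ℝ}
    (hr : r ∈ Icc 0 R) : |radAvg n k r| ≤ B := by
  have hR : 0 ≤ R := hr.1.trans hr.2
  rw [radAvg_congr n (l := IccExtend hR ((Icc 0 R).domRestrict k))
    (fun s hs => (IccExtend_of_mem hR ((Icc 0 R).domRestrict k) hs).symm) hr]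
  exact abs_radAvg_le n (fun s => h _ (projIcc 0 R hR s).2) r

lemma radAvg_sub (n : ℕ) {k l : ℝ → ℝ} (hk : Continuous k) (hl : Continuous l) (r : ℝ) :
    radAvg n k r - radAvg n l r = radAvg n (fun s => k s - l s) r := by
  simp only [radAvg]
  rw [← intervalIntegral.integral_sub]
  · simp_rw [mul_sub]
  · exact Continuous.intervalIntegrable (by fun_prop) _ _
  · exact Continuous.intervalIntegrable (by fun_prop) _ _

/-- Averaging does not increase the supremum norm on [0, R]. -/
lemma tendstoUniformlyOn_radAvg (n : ℕ) {k : ℕ → ℝ → ℝ} {l : ℝ → ℝ} {R : ℝ}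
    (hk : ∀ i, Continuous (k i)) (hl : Continuous l)
    (h : TendstoUniformlyOn k l atTop (Icc 0 R)) :
    TendstoUniformlyOn (fun i => radAvg n (k i)) (radAvg n l) atTop (Icc 0 R) := by
  rw [Metric.tendstoUniformlyOn_iff] at h ⊢
  intro ε hε
  filter_upwards [h (ε / 2) (half_pos hε)] with i hi r hr
  rw [Real.dist_eq, radAvg_sub n hl (hk i)]
  exact (abs_radAvg_le_on n (fun s hs => (hi s hs).le) hr).trans_lt (half_lt_self hε)

namespace IsDelayedSol

variable {n : ℕ} {a R h d B : ℝ} {g u : ℝ → ℝ}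

lemma abs_oddPow_radFlux_le (ha : 1 < a) (hB : ∀ s, |g s| ≤ B) (w : ℝ → ℝ) {s : ℝ}
    (hs : s ∈ Icc 0 R) : |oddPow a (radFlux n (g ∘ w) s)| ≤ (R * B) ^ (a - 1) := by
  rw [abs_oddPow ha]
  exact Real.rpow_le_rpow (abs_nonneg _) (abs_radFlux_le n (fun t => hB (w t)) hs)
    (by linarith)

/-- The constant depends on neither the delay nor the initial value, which is what the compactness
argument needs as h → 0. -/
lemma lipschitz (ha : 1 < a) (hg : Continuous g) (hB : ∀ s, |g s| ≤ B) (hh : 0 < h)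
    (hu : IsDelayedSol n a g R h d u) :
    ∀ r ∈ Icc 0 R, ∀ s ∈ Icc 0 R, |u r - u s| ≤ (R * B) ^ (a - 1) * |r - s| := by
  intro r hr s hs
  have hc : Continuous fun s => oddPow a (radFlux n (g ∘ u) s) :=
    (continuous_oddPow ha).comp (continuous_radFlux n (hg.comp hu.continuous))
  rw [hu.eq r hr, hu.eq s hs, add_sub_add_left_eq_sub,
    intervalIntegral.integral_interval_sub_left (hc.intervalIntegrable _ _)
      (hc.intervalIntegrable _ _)]
  have hmem : ∀ r ∈ Icc 0 R, max (r - h) 0 ∈ Icc 0 R := fun r hr =>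
    ⟨le_max_right _ _, max_le (by linarith [hr.2]) (hr.1.trans hr.2)⟩
  have h1 := intervalIntegral.norm_integral_le_of_norm_le_const (a := max (s - h) 0)
    (b := max (r - h) 0) (f := fun s => oddPow a (radFlux n (g ∘ u) s)) (C := (R * B) ^ (a - 1))
    fun t ht => abs_oddPow_radFlux_le ha hB u
      ((uIcc_subset_Icc (hmem s hs) (hmem r hr)) (uIoc_subset_uIcc ht))
  refine h1.trans (mul_le_mul_of_nonneg_left ?_ ?_)
  · have := abs_max_sub_max_le_abs (r - h) (s - h) 0
    simpa using this
  · exact (abs_nonneg _).trans (abs_oddPow_radFlux_le (n := n) ha hB u hr)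

end IsDelayedSol

/-- Solutions of the delayed equations accumulate at solutions of the radial equation. -/
lemma exists_subseq_tendsto_isRadialSol {n : ℕ} {a R B : ℝ} {g : ℝ → ℝ} (ha : 1 < a)
    (hg : UniformContinuous g) (hB : ∀ s, |g s| ≤ B) (hR : 0 ≤ R) {h d : ℕ → ℝ} {u : ℕ → ℝ → ℝ}
    (hh : ∀ k, 0 < h k) (hh0 : Tendsto h atTop (𝓝 0))
    {K : Set ℝ} (hK : IsCompact K) (hd : ∀ k, d k ∈ K)
    (hu : ∀ k, IsDelayedSol n a g R (h k) (d k) (u k)) :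
    ∃ x, IsRadialSol n a g R x ∧ x 0 ∈ K ∧ ∃ φ : ℕ → ℕ, StrictMono φ ∧
      TendstoUniformlyOn (fun k => u (φ k)) x atTop (Icc 0 R) := by
  have h0mem : (0 : ℝ) ∈ Icc 0 R := ⟨le_rfl, hR⟩
  have hu0 : ∀ k, u k 0 = d k := by
    intro k
    rw [(hu k).eq 0 h0mem, max_eq_right (by linarith [hh k])]
    simp
  obtain ⟨D, hD⟩ := hK.isBounded.exists_norm_le
  set C := (R * B) ^ (a - 1) with hC
  have hC0 : 0 ≤ C := (abs_nonneg _).trans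
    (IsDelayedSol.abs_oddPow_radFlux_le (n := n) ha hB (u 0) h0mem)
  have hL := fun k => (hu k).lipschitz ha hg.continuous hB (hh k)
  obtain ⟨w, φ, hφ, hwc, hlim⟩ := exists_subseq_tendstoUniformlyOn (D := D + C * R) hR u
    (fun k r hr => by
      have h1 := hL k r hr 0 h0mem
      rw [sub_zero, abs_of_nonneg hr.1, hu0] at h1
      have h2 : C * r ≤ C * R := mul_le_mul_of_nonneg_left hr.2 hC0
      have h3 : |d k| ≤ D := hD _ (hd k)
      have h4 := abs_sub_abs_le_abs_sub (u k r) (d k)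
      linarith) hL
  have hdlim : Tendsto (fun k => d (φ k)) atTop (𝓝 (w 0)) := by
    simpa only [hu0] using hlim.tendsto_at h0mem
  have hwK : w 0 ∈ K := hK.isClosed.mem_of_tendsto hdlim (Eventually.of_forall fun k => hd _)
  set W : ℝ → ℝ := IccExtend hR ((Icc 0 R).domRestrict w) with hW
  have hWc : Continuous W := (continuousOn_iff_continuous_domRestrict.1 hwc).Icc_extend'
  have hWw : EqOn W w (Icc 0 R) := fun s hs => IccExtend_of_mem hR _ hs
  have hlimW : TendstoUniformlyOn (fun k => u (φ k)) W atTop (Icc 0 R) :=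
    hlim.congr_right hWw.symm
  have havg := tendstoUniformlyOn_radAvg n (fun k => hg.continuous.comp (hu (φ k)).continuous)
    (hg.continuous.comp hWc) (hg.comp_tendstoUniformlyOn hlimW)
  have hflux : ∀ s ∈ Icc 0 R, Tendsto (fun k => oddPow a (radFlux n (g ∘ u (φ k)) s)) atTop
      (𝓝 (oddPow a (radFlux n (g ∘ W) s))) := fun s hs =>
    ((continuous_oddPow ha).tendsto _).comp ((tendsto_const_nhds.mul (havg.tendsto_at hs)).neg)
  have heq : ∀ r ∈ Icc 0 R, W r = W 0 + ∫ s in (0 : ℝ)..r, oddPow a (radFlux n (g ∘ W) s) := by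
    intro r hr
    have hc : ∀ k, Continuous fun s => oddPow a (radFlux n (g ∘ u (φ k)) s) := fun k =>
      (continuous_oddPow ha).comp (continuous_radFlux n (hg.continuous.comp (hu _).continuous))
    have hint : Tendsto (fun k => ∫ s in (0 : ℝ)..r, oddPow a (radFlux n (g ∘ u (φ k)) s)) atTop
        (𝓝 (∫ s in (0 : ℝ)..r, oddPow a (radFlux n (g ∘ W) s))) := by
      refine intervalIntegral.tendsto_integral_filter_of_dominated_convergence (fun _ => C)
        (Eventually.of_forall fun k => (hc k).aestronglyMeasurable)
        (Eventually.of_forall fun k => Eventually.of_forall fun s hs => ?_)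
        intervalIntegrable_const (Eventually.of_forall fun s hs => hflux s ?_)
      all_goals rw [uIoc_of_le hr.1] at hs
      · exact IsDelayedSol.abs_oddPow_radFlux_le ha hB _ ⟨hs.1.le, hs.2.trans hr.2⟩
      · exact ⟨hs.1.le, hs.2.trans hr.2⟩
    -- The piece of the integral removed by the delay has length at most h and a bounded integrand.
    have hdiff : Tendsto (fun k => ∫ s in max (r - h (φ k)) 0..r,
        oddPow a (radFlux n (g ∘ u (φ k)) s)) atTop (𝓝 0) := by
      refine squeeze_zero_norm (a := fun k => C * h (φ k)) (fun k => ?_) ?_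
      · have hle : max (r - h (φ k)) 0 ≤ r := max_le (by linarith [hh (φ k)]) hr.1
        refine (intervalIntegral.norm_integral_le_of_norm_le_const (C := C) fun s hs => ?_).trans
          (mul_le_mul_of_nonneg_left ?_ hC0)
        · rw [uIoc_of_le hle] at hs
          exact IsDelayedSol.abs_oddPow_radFlux_le ha hB _
            ⟨(le_max_right _ _).trans hs.1.le, hs.2.trans hr.2⟩
        · rw [abs_of_nonneg (sub_nonneg.2 hle)]
          linarith [le_max_left (r - h (φ k)) 0]
      · simpa using (hh0.comp hφ.tendsto_atTop).const_mul C
    have hsum := (hdlim.add hint).sub hdiff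
    rw [sub_zero, ← hWw h0mem] at hsum
    refine tendsto_nhds_unique (hlimW.tendsto_at hr) (hsum.congr fun k => ?_)
    rw [(hu (φ k)).eq r hr, add_sub_assoc,
      sub_eq_of_eq_add (intervalIntegral.integral_add_adjacent_intervals
        ((hc k).intervalIntegrable 0 (max (r - h (φ k)) 0))
        ((hc k).intervalIntegrable (max (r - h (φ k)) 0) r)).symm]
  obtain ⟨x, hx, hxW⟩ := IsRadialSol.exists_of_integral_eq ha hg.continuous hR hWc.continuousOn heq
  refine ⟨x, hx, ?_, φ, hφ, hlimW.congr_right hxW.symm⟩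
  rw [hxW h0mem, hWw h0mem]
  exact hwK

/-! ### Shooting without uniqueness -/

/-- The angle functional with its denominator cut off at `h`. -/
def cutAngle (n : ℕ) (a : ℝ) (g : ℝ → ℝ) (R h : ℝ) (u : ℝ → ℝ) : ℝ :=
  ∫ s in (0 : ℝ)..R, (radMom n (g ∘ u) s * oddPow a (radFlux n (g ∘ u) s) +
    u s * (s ^ n * g (u s))) / max (u s ^ 2 + radMom n (g ∘ u) s ^ 2) h

/-- The limit curve keeps a positive distance from the origin, so the denominators are eventually
bounded below uniformly; dominated convergence applies and the cut-off disappears in the limit. -/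
lemma tendsto_cutAngle {n : ℕ} {a R : ℝ} {g x : ℝ → ℝ} (ha : 1 < a)
    (hg : UniformContinuous g) (hR : 0 ≤ R) {h : ℕ → ℝ} {u : ℕ → ℝ → ℝ}
    (hh : ∀ k, 0 < h k) (hh0 : Tendsto h atTop (𝓝 0)) (hu : ∀ k, Continuous (u k))
    (hx : Continuous x) (hne : ∀ r ∈ Icc 0 R, x r ≠ 0 ∨ radMom n (g ∘ x) r ≠ 0)
    (hlim : TendstoUniformlyOn u x atTop (Icc 0 R)) :
    Tendsto (fun k => cutAngle n a g R (h k) (u k)) atTop (𝓝 (phaseAngle n a g x 1 R)) := by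
  have hgx := hg.continuous.comp hx
  have hgu := fun k => hg.continuous.comp (hu k)
  have hglim := hg.comp_tendstoUniformlyOn hlim
  have havg := tendstoUniformlyOn_radAvg n hgu hgx hglim
  -- numerator and denominator as continuous functions of `(s, u, g(u), avg)`
  let N : ℝ → ℝ × ℝ × ℝ → ℝ := fun s z =>
    (s ^ n * -(s * z.2.2)) * oddPow a (-(s * z.2.2)) + z.1 * (s ^ n * z.2.1)
  let D : ℝ → ℝ × ℝ × ℝ → ℝ := fun s z => z.1 ^ 2 + (s ^ n * -(s * z.2.2)) ^ 2
  have hN : Continuous (Function.uncurry N) := by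
    have := continuous_oddPow ha
    simp only [N, Function.uncurry_def]
    fun_prop
  have hD : Continuous (Function.uncurry D) := by
    simp only [D, Function.uncurry_def]
    fun_prop
  let z : ℕ → ℝ → ℝ × ℝ × ℝ := fun k s => (u k s, g (u k s), radAvg n (g ∘ u k) s)
  let y : ℝ → ℝ × ℝ × ℝ := fun s => (x s, g (x s), radAvg n (g ∘ x) s)
  have hy : Continuous y := hx.prodMk (hgx.prodMk (continuous_radAvg n hgx))
  have hzc : ∀ k, Continuous (z k) := fun k =>
    (hu k).prodMk ((hgu k).prodMk (continuous_radAvg n (hgu k)))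
  have hz : TendstoUniformlyOn z y atTop (Icc 0 R) := by
    rw [Metric.tendstoUniformlyOn_iff] at hlim hglim havg ⊢
    intro ε hε
    filter_upwards [hlim ε hε, hglim ε hε, havg ε hε] with k h1 h2 h3 s hs
    exact max_lt (h1 s hs) (max_lt (h2 s hs) (h3 s hs))
  -- the values stay in a compact set
  let T : Set (ℝ × (ℝ × ℝ × ℝ)) := (fun s => (s, y s)) '' Icc 0 R
  have hT : IsCompact T := isCompact_Icc.image (continuous_id.prodMk hy)
  have hDpos : ∀ w ∈ T, 0 < D w.1 w.2 := by
    rintro w ⟨s, hs, rfl⟩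
    exact phase_sq_pos (hne s hs)
  obtain ⟨c, hc, hcT⟩ : ∃ c > 0, ∀ w ∈ T, c < D w.1 w.2 := by
    obtain ⟨w, hw, hmin⟩ := hT.exists_isMinOn ((nonempty_Icc.2 hR).image _)
      hD.continuousOn
    refine ⟨D w.1 w.2 / 2, half_pos (hDpos w hw), fun v hv => ?_⟩
    exact (half_lt_self (hDpos w hw)).trans_le (hmin hv)
  obtain ⟨A, hA⟩ := hT.exists_bound_of_continuousOn hN.continuousOn
  have hopen : IsOpen {w : ℝ × (ℝ × ℝ × ℝ) | c < D w.1 w.2 ∧ |N w.1 w.2| < A + 1} :=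
    (isOpen_lt continuous_const hD).inter (isOpen_lt hN.abs continuous_const)
  obtain ⟨δ, hδ, hδT⟩ := hT.exists_thickening_subset_open hopen
    (fun w hw => ⟨hcT w hw, (hA w hw).trans_lt (lt_add_one A)⟩)
  have hev : ∀ᶠ k in atTop, ∀ s ∈ Icc 0 R, c < D s (z k s) ∧ |N s (z k s)| < A + 1 := by
    filter_upwards [Metric.tendstoUniformlyOn_iff.1 hz δ hδ] with k hk s hs
    refine @hδT (s, z k s) (Metric.mem_thickening_iff.2 ⟨(s, y s), mem_image_of_mem _ hs, ?_⟩)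
    rw [Prod.dist_eq, dist_self, dist_comm]
    exact max_lt hδ (hk s hs)
  have hphase : phaseAngle n a g x 1 R = ∫ s in (0 : ℝ)..R, N s (y s) / D s (y s) := by
    refine intervalIntegral.integral_congr fun s _ => ?_
    simp only [angularSpeed, N, D, y, radMom, radFlux]
    ring_nf
  rw [hphase]
  refine intervalIntegral.tendsto_integral_filter_of_dominated_convergence
    (fun _ => (A + 1) / c) (Eventually.of_forall fun k => ?_) ?_ intervalIntegrable_const
    (Eventually.of_forall fun s hs => ?_)
  · refine Continuous.aestronglyMeasurable ?_
    have hNz : Continuous fun s => N s (z k s) := hN.comp (continuous_id.prodMk (hzc k))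
    have hDz : Continuous fun s => D s (z k s) := hD.comp (continuous_id.prodMk (hzc k))
    exact hNz.div (hDz.max continuous_const) fun s => ((hh k).trans_le (le_max_right _ _)).ne'
  · filter_upwards [hev] with k hk
    refine Eventually.of_forall fun s hs => ?_
    rw [uIoc_of_le hR] at hs
    obtain ⟨h1, h2⟩ := hk s ⟨hs.1.le, hs.2⟩
    have h3 : c < max (D s (z k s)) (h k) := h1.trans_le (le_max_left _ _)
    change ‖N s (z k s) / max (D s (z k s)) (h k)‖ ≤ _
    rw [norm_div, Real.norm_eq_abs, Real.norm_eq_abs, abs_of_pos (hc.trans h3)]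
    exact div_le_div₀ ((abs_nonneg _).trans h2.le) h2.le hc h3.le
  · rw [uIoc_of_le hR] at hs
    have hs' : s ∈ Icc 0 R := ⟨hs.1.le, hs.2⟩
    have hzs : Tendsto (fun k => (s, z k s)) atTop (𝓝 (s, y s)) :=
      tendsto_const_nhds.prodMk_nhds (hz.tendsto_at hs')
    have h1 := (hN.tendsto (s, y s)).comp hzs
    have h2 := ((hD.tendsto (s, y s)).comp hzs).max hh0
    have h3 : 0 < D s (y s) := phase_sq_pos (hne s hs')
    have h4 : max (Function.uncurry D (s, y s)) 0 = D s (y s) := max_eq_left h3.le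
    rw [h4] at h2
    exact h1.div h2 h3.ne'

/-- A delayed solution has no decreasing energy and might pass through the origin of the phase
plane; the cut-off keeps the integrand continuous even then. -/
lemma continuous_cutAngle {n : ℕ} {a : ℝ} {g : ℝ → ℝ} (ha : 1 < a) (hg : Continuous g) (R : ℝ)
    {h : ℝ} (hh : 0 < h) (m : ℕ) :
    Continuous fun d => cutAngle n a g R h (delayedIterate n a g h d m) := by
  have hu := continuous_delayedIterate (n := n) ha hg h m
  have hfl := continuous_radFlux_param n (k := fun d => g ∘ delayedIterate n a g h d m)
    (hg.comp hu)
  have hmo : Continuous fun z : ℝ × ℝ => radMom n (g ∘ delayedIterate n a g h z.1 m) z.2 :=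
    (continuous_snd.pow n).mul hfl
  refine intervalIntegral.continuous_parametric_intervalIntegral_of_continuous' ?_ 0 R
  refine Continuous.div ?_ ?_ fun z => (hh.trans_le (le_max_right _ _)).ne'
  · exact (hmo.mul ((continuous_oddPow ha).comp hfl)).add
      (hu.mul ((continuous_snd.pow n).mul (hg.comp hu)))
  · exact ((hu.pow 2).add (hmo.pow 2)).max continuous_const

/-- Shooting without uniqueness: an angle that separates all solutions starting at `A` from all
solutions starting at `B` is attained by a solution starting in between. -/
theorem exists_isRadialSol_phaseAngle_eq {n : ℕ} {a R M A B τ : ℝ} {g : ℝ → ℝ} (ha : 1 < a)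
    (hg : UniformContinuous g) (hM : ∀ s, |g s| ≤ M) (hR : 0 ≤ R)
    (hne : ∀ x, IsRadialSol n a g R x → x 0 ∈ uIcc A B →
      ∀ r ∈ Icc 0 R, x r ≠ 0 ∨ radMom n (g ∘ x) r ≠ 0)
    (hA : ∀ x, IsRadialSol n a g R x → x 0 = A → phaseAngle n a g x 1 R < τ)
    (hB : ∀ x, IsRadialSol n a g R x → x 0 = B → τ < phaseAngle n a g x 1 R) :
    ∃ x, IsRadialSol n a g R x ∧ x 0 ∈ uIcc A B ∧ phaseAngle n a g x 1 R = τ := by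
  let h : ℕ → ℝ := fun k => 1 / (k + 1)
  have hh : ∀ k, 0 < h k := fun k => by positivity
  have hh0 : Tendsto h atTop (𝓝 0) := tendsto_one_div_add_atTop_nhds_zero_nat
  choose m hm using fun k => exists_nat_ge (R / h k)
  have hm' : ∀ k, R ≤ m k * h k := fun k => (div_le_iff₀ (hh k)).1 (hm k)
  let U : ℕ → ℝ → ℝ → ℝ := fun k d => delayedIterate n a g (h k) d (m k)
  let Θ : ℕ → ℝ → ℝ := fun k d => cutAngle n a g R (h k) (U k d)
  have hΘ : ∀ k, Continuous (Θ k) := fun k => continuous_cutAngle ha hg.continuous R (hh k) (m k)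
  -- accumulation along any subsequence of parameters
  have hacc : ∀ (ψ : ℕ → ℕ) (d : ℕ → ℝ) (K : Set ℝ), StrictMono ψ → IsCompact K → K ⊆ uIcc A B →
      (∀ k, d k ∈ K) → ∃ x, IsRadialSol n a g R x ∧ x 0 ∈ K ∧ ∃ φ : ℕ → ℕ, StrictMono φ ∧
        Tendsto (fun k => Θ (ψ (φ k)) (d (φ k))) atTop (𝓝 (phaseAngle n a g x 1 R)) := by
    intro ψ d K hψ hK hKs hd
    have hu := fun k => isDelayedSol_delayedIterate (n := n) ha hg.continuous (hh (ψ k)) (d k)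
      (hm' (ψ k))
    obtain ⟨x, hx, hx0, φ, hφ, hlim⟩ := exists_subseq_tendsto_isRadialSol ha hg hM hR
      (fun k => hh (ψ k)) (hh0.comp hψ.tendsto_atTop) hK hd hu
    exact ⟨x, hx, hx0, φ, hφ, tendsto_cutAngle ha hg hR (fun k => hh (ψ (φ k)))
      ((hh0.comp hψ.tendsto_atTop).comp hφ.tendsto_atTop) (fun k => (hu (φ k)).continuous)
      hx.continuous (hne x hx (hKs hx0)) hlim⟩
  -- Otherwise a subsequence would converge to a true solution starting at A with angle at least τ.
  -- This is where `hA` is needed for every solution from A.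
  have hAev : ∀ᶠ k in atTop, Θ k A < τ := by
    by_contra hc
    rw [not_eventually] at hc
    obtain ⟨ψ, hψ, hψ'⟩ := extraction_of_frequently_atTop hc
    obtain ⟨x, hx, hx0, φ, -, hlim⟩ := hacc ψ (fun _ => A) {A} hψ isCompact_singleton
      (singleton_subset_iff.2 left_mem_uIcc) fun _ => rfl
    exact (hA x hx hx0).not_ge (ge_of_tendsto' hlim fun k => not_lt.1 (hψ' _))
  have hBev : ∀ᶠ k in atTop, τ < Θ k B := by
    by_contra hc
    rw [not_eventually] at hc
    obtain ⟨ψ, hψ, hψ'⟩ := extraction_of_frequently_atTop hc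
    obtain ⟨x, hx, hx0, φ, -, hlim⟩ := hacc ψ (fun _ => B) {B} hψ isCompact_singleton
      (singleton_subset_iff.2 right_mem_uIcc) fun _ => rfl
    exact (hB x hx hx0).not_ge (le_of_tendsto' hlim fun k => not_lt.1 (hψ' _))
  obtain ⟨ψ, hψ, hψ'⟩ := extraction_of_eventually_atTop (hAev.and hBev)
  -- The intermediate value theorem is used at fixed delay, where the angle is continuous in d; the
  -- resulting d need not converge, only accumulate.
  have hivt : ∀ k, ∃ d ∈ uIcc A B, Θ (ψ k) d = τ := fun k =>
    intermediate_value_uIcc (hΘ (ψ k)).continuousOn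
      (Icc_subset_uIcc ⟨(hψ' k).1.le, (hψ' k).2.le⟩)
  choose d hd hdτ using hivt
  obtain ⟨x, hx, hx0, φ, -, hlim⟩ := hacc ψ d _ hψ isCompact_uIcc Subset.rfl hd
  refine ⟨x, hx, hx0, tendsto_nhds_unique hlim ?_⟩
  simp only [hdτ]
  exact tendsto_const_nhds

/-- The function moves away from 0 upwards on both sides; used to integrate inequalities for s g(s)
into inequalities for G. -/
lemma nonneg_of_mul_deriv_nonneg {φ φ' : ℝ → ℝ} {x : ℝ} (h : ∀ s, HasDerivAt φ (φ' s) s)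
    (h0 : φ 0 = 0) (hs : ∀ s ∈ uIcc 0 x, 0 ≤ s * φ' s) : 0 ≤ φ x := by
  have hc : Continuous φ := continuous_iff_continuousAt.2 fun s => (h s).continuousAt
  rcases lt_trichotomy x 0 with hx | rfl | hx
  · obtain ⟨s, hs1, hs2⟩ := exists_hasDerivAt_eq_slope φ φ' hx hc.continuousOn fun s _ => h s
    have h1 := hs s (by rw [uIcc_of_ge hx.le]; exact Ioo_subset_Icc_self hs1)
    rw [eq_div_iff (by linarith), h0] at hs2
    have h2 : φ' s ≤ 0 := by
      by_contra! hc
      exact (mul_neg_of_neg_of_pos hs1.2 hc).not_ge h1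
    nlinarith
  · exact h0.ge
  · obtain ⟨s, hs1, hs2⟩ := exists_hasDerivAt_eq_slope φ φ' hx hc.continuousOn fun s _ => h s
    have h1 := hs s (by rw [uIcc_of_le hx.le]; exact Ioo_subset_Icc_self hs1)
    rw [eq_div_iff (by linarith), h0] at hs2
    have h2 : 0 ≤ φ' s := nonneg_of_mul_nonneg_right h1 hs1.1
    nlinarith

/-! ### The truncated nonlinearity and its potential well -/

/-- The nonlinearity `s^(q-1) - s^(p-1)`. -/
def nonlin (p q s : ℝ) : ℝ := s ^ (q - 1) - s ^ (p - 1)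

/-- The positive zero of `s^q/q - s^p/p`. -/
def topValue (p q : ℝ) : ℝ := (q / p) ^ (1 / (q - p))

/-- The nonlinearity centred at its zero `1` and made constant outside `[0, topValue]`. -/
def truncNonlin (p q x : ℝ) : ℝ := nonlin p q (max 0 (min (topValue p q) (1 + x)))

/-- The primitive of the truncated nonlinearity. -/
def potential (p q x : ℝ) : ℝ := ∫ s in (0 : ℝ)..x, truncNonlin p q s

section

variable {p q : ℝ}

lemma one_lt_topValue (hp : 1 < p) (hpq : p < q) : 1 < topValue p q :=
  Real.one_lt_rpow ((one_lt_div (by linarith)).2 hpq) (by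
    have : 0 < q - p := by linarith
    positivity)

lemma nonlin_zero (hp : 1 < p) (hpq : p < q) : nonlin p q 0 = 0 := by
  rw [nonlin, Real.zero_rpow (by linarith), Real.zero_rpow (by linarith), sub_zero]

lemma nonlin_one : nonlin p q 1 = 0 := by simp [nonlin]

lemma nonlin_neg (hpq : p < q) {s : ℝ} (h0 : 0 < s) (h1 : s < 1) : nonlin p q s < 0 :=
  sub_neg.2 (Real.rpow_lt_rpow_of_exponent_gt h0 h1 (by linarith))

lemma nonlin_pos (hpq : p < q) {s : ℝ} (h1 : 1 < s) : 0 < nonlin p q s :=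
  sub_pos.2 (Real.rpow_lt_rpow_of_exponent_lt h1 (by linarith))

lemma continuous_nonlin (hp : 1 < p) (hpq : p < q) : Continuous (nonlin p q) :=
  (Real.continuous_rpow_const (by linarith)).sub (Real.continuous_rpow_const (by linarith))

lemma truncNonlin_eq {x : ℝ} (h : x ∈ Icc (-1) (topValue p q - 1)) :
    truncNonlin p q x = nonlin p q (1 + x) := by
  rw [truncNonlin, min_eq_right (by linarith [h.2]), max_eq_right (by linarith [h.1])]

lemma uniformContinuous_truncNonlin (hp : 1 < p) (hpq : p < q) :
    UniformContinuous (truncNonlin p q) := by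
  have hM : 0 ≤ topValue p q := (zero_lt_one.trans (one_lt_topValue hp hpq)).le
  have h1 : UniformContinuous ((Icc 0 (topValue p q)).domRestrict (nonlin p q)) :=
    CompactSpace.uniformContinuous_of_continuous
      (continuous_nonlin hp hpq).continuousOn.domRestrict
  have h2 : UniformContinuous fun x : ℝ => projIcc 0 (topValue p q) hM (1 + x) :=
    (LipschitzWith.projIcc hM).uniformContinuous.comp
      (uniformContinuous_const.add uniformContinuous_id)
  exact h1.comp h2

lemma continuous_truncNonlin (hp : 1 < p) (hpq : p < q) : Continuous (truncNonlin p q) :=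
  (uniformContinuous_truncNonlin hp hpq).continuous

lemma exists_abs_truncNonlin_le (hp : 1 < p) (hpq : p < q) :
    ∃ B, ∀ x, |truncNonlin p q x| ≤ B := by
  have hM : 0 ≤ topValue p q := (zero_lt_one.trans (one_lt_topValue hp hpq)).le
  obtain ⟨B, hB⟩ := (isCompact_Icc (a := 0) (b := topValue p q)).exists_bound_of_continuousOn
    (continuous_nonlin hp hpq).continuousOn
  exact ⟨B, fun x => hB _ (projIcc 0 (topValue p q) hM (1 + x)).2⟩

lemma mul_truncNonlin_pos (hp : 1 < p) (hpq : p < q) {x : ℝ} (hx : -1 < x) (hx0 : x ≠ 0) :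
    0 < x * truncNonlin p q x := by
  have hM := one_lt_topValue hp hpq
  rcases hx0.lt_or_gt with h | h
  · rw [truncNonlin_eq ⟨hx.le, by linarith⟩]
    exact mul_pos_of_neg_of_neg h (nonlin_neg hpq (by linarith) (by linarith))
  · exact mul_pos h (nonlin_pos hpq (lt_max_of_lt_right (lt_min hM (by linarith))))

lemma mul_truncNonlin_nonneg (hp : 1 < p) (hpq : p < q) (x : ℝ) : 0 ≤ x * truncNonlin p q x := by
  rcases le_or_gt x (-1) with h | h
  · have hM := one_lt_topValue hp hpq
    rw [truncNonlin, min_eq_right (by linarith), max_eq_left (by linarith), nonlin_zero hp hpq,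
      mul_zero]
  · rcases eq_or_ne x 0 with rfl | h0
    · simp
    · exact (mul_truncNonlin_pos hp hpq h h0).le

lemma hasDerivAt_potential (hp : 1 < p) (hpq : p < q) (x : ℝ) :
    HasDerivAt (potential p q) (truncNonlin p q x) x := by
  have hc := continuous_truncNonlin hp hpq
  exact intervalIntegral.integral_hasDerivAt_right (hc.intervalIntegrable _ _)
    hc.stronglyMeasurable.stronglyMeasurableAtFilter hc.continuousAt

@[simp] lemma potential_zero : potential p q 0 = 0 := by simp [potential]

lemma potential_nonneg (hp : 1 < p) (hpq : p < q) (x : ℝ) : 0 ≤ potential p q x :=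
  nonneg_of_mul_deriv_nonneg (hasDerivAt_potential hp hpq) potential_zero
    fun s _ => mul_truncNonlin_nonneg hp hpq s

lemma continuous_potential (hp : 1 < p) (hpq : p < q) : Continuous (potential p q) :=
  continuous_iff_continuousAt.2 fun s => (hasDerivAt_potential hp hpq s).continuousAt

lemma potential_antitoneOn (hp : 1 < p) (hpq : p < q) : AntitoneOn (potential p q) (Iic 0) := by
  refine antitoneOn_of_hasDerivWithinAt_nonpos (convex_Iic 0)
    (continuous_potential hp hpq).continuousOn
    (fun x _ => (hasDerivAt_potential hp hpq x).hasDerivWithinAt) fun x hx => ?_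
  rw [interior_Iic] at hx
  exact nonpos_of_mul_nonneg_right (mul_truncNonlin_nonneg hp hpq x) hx

lemma potential_monotoneOn (hp : 1 < p) (hpq : p < q) : MonotoneOn (potential p q) (Ici 0) := by
  refine monotoneOn_of_hasDerivWithinAt_nonneg (convex_Ici 0)
    (continuous_potential hp hpq).continuousOn
    (fun x _ => (hasDerivAt_potential hp hpq x).hasDerivWithinAt) fun x hx => ?_
  rw [interior_Ici] at hx
  exact nonneg_of_mul_nonneg_right (mul_truncNonlin_nonneg hp hpq x) hx

/-- Strictness stops at -1, since the truncated nonlinearity vanishes to the left of it. -/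
lemma potential_strictAntiOn (hp : 1 < p) (hpq : p < q) :
    StrictAntiOn (potential p q) (Icc (-1) 0) := by
  refine strictAntiOn_of_hasDerivWithinAt_neg (convex_Icc (-1) 0)
    (continuous_potential hp hpq).continuousOn
    (fun x _ => (hasDerivAt_potential hp hpq x).hasDerivWithinAt) fun x hx => ?_
  rw [interior_Icc] at hx
  have := mul_truncNonlin_pos hp hpq hx.1 hx.2.ne
  by_contra! hc
  exact (mul_nonpos_of_nonpos_of_nonneg hx.2.le hc).not_gt this

/-- The primitive s^q/q - s^p/p vanishes both at 0 and at `topValue`, so the well has walls of equal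
height at the two ends of the truncation interval. -/
lemma potential_top (hp : 1 < p) (hpq : p < q) :
    potential p q (topValue p q - 1) = potential p q (-1) := by
  have hM := one_lt_topValue hp hpq
  set M := topValue p q with hMdef
  have hc := continuous_truncNonlin hp hpq
  have h1 : potential p q (M - 1) - potential p q (-1) = ∫ s in (-1)..(M - 1), truncNonlin p q s :=
    intervalIntegral.integral_interval_sub_left (hc.intervalIntegrable _ _)
      (hc.intervalIntegrable _ _)
  have h2 : ∫ s in (-1)..(M - 1), truncNonlin p q s =
      ((1 + (M - 1)) ^ q / q - (1 + (M - 1)) ^ p / p) - ((1 + -1) ^ q / q - (1 + -1) ^ p / p) := by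
    refine intervalIntegral.integral_eq_sub_of_hasDerivAt
      (f := fun s => (1 + s) ^ q / q - (1 + s) ^ p / p) (fun s hs => ?_)
      (hc.intervalIntegrable _ _)
    rw [uIcc_of_le (by linarith)] at hs
    rw [truncNonlin_eq hs, nonlin]
    have d : HasDerivAt (fun s : ℝ => 1 + s) 1 s := (hasDerivAt_id s).const_add 1
    refine (((d.rpow_const (Or.inr (by linarith))).div_const q).sub
      ((d.rpow_const (Or.inr (by linarith))).div_const p)).congr_deriv ?_
    have : p ≠ 0 := by linarith
    have : q ≠ 0 := by linarith
    field_simp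
  have h3 : M ^ q / q = M ^ p / p := by
    have hM0 : 0 < M := by linarith
    have h4 : M ^ q = M ^ p * M ^ (q - p) := by
      rw [← Real.rpow_add hM0]
      congr 1
      ring
    have h5 : M ^ (q - p) = q / p := by
      rw [hMdef, topValue, ← Real.rpow_mul (div_nonneg (by linarith) (by linarith)), one_div_mul_cancel (by linarith),
        Real.rpow_one]
    have : p ≠ 0 := by linarith
    have : q ≠ 0 := by linarith
    rw [h4, h5]
    field_simp
  rw [h2, add_sub_cancel, h3, add_neg_cancel, Real.zero_rpow (by linarith),
    Real.zero_rpow (by linarith), zero_div, zero_div] at h1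
  linarith

/-- The sublevel sets of the potential trap the solutions. -/
lemma mem_Icc_of_potential_le (hp : 1 < p) (hpq : p < q) {x₀ x : ℝ} (hx₀ : x₀ ∈ Ioo (-1) 0)
    (h : potential p q x ≤ potential p q x₀) : x ∈ Icc x₀ (topValue p q - 1) := by
  have hM := one_lt_topValue hp hpq
  have hlt : potential p q x₀ < potential p q (-1) :=
    potential_strictAntiOn hp hpq ⟨le_rfl, by norm_num⟩ ⟨hx₀.1.le, hx₀.2.le⟩ hx₀.1
  constructor
  · by_contra! hc
    refine h.not_gt ?_
    rcases le_or_gt (-1) x with h1 | h1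
    · exact potential_strictAntiOn hp hpq ⟨h1, hc.le.trans hx₀.2.le⟩ ⟨hx₀.1.le, hx₀.2.le⟩ hc
    · exact hlt.trans_le (potential_antitoneOn hp hpq (hc.le.trans hx₀.2.le)
        (by norm_num : (-1 : ℝ) ≤ 0) h1.le)
  · by_contra! hc
    refine h.not_gt (hlt.trans_le ?_)
    rw [← potential_top hp hpq]
    exact potential_monotoneOn hp hpq (by simp; linarith) (by simp; linarith) hc.le

lemma potential_pos (hp : 1 < p) (hpq : p < q) {x₀ : ℝ} (hx₀ : x₀ ∈ Ioo (-1) 0) :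
    0 < potential p q x₀ := by
  have := potential_strictAntiOn hp hpq ⟨hx₀.1.le, hx₀.2.le⟩ ⟨by norm_num, le_rfl⟩ hx₀.2
  rwa [potential_zero] at this

/-- This slope is the number compared with the eigenvalues when p = 2. -/
lemma hasDerivAt_nonlin_one : HasDerivAt (nonlin p q) (q - p) 1 := by
  refine ((Real.hasDerivAt_rpow_const (Or.inl one_ne_zero)).sub
    (Real.hasDerivAt_rpow_const (Or.inl one_ne_zero))).congr_deriv ?_
  simp

/-- Dividing out the zero at 1 leaves a continuous factor, positive for s > 0, whose extrema on
compact intervals give the quadratic bounds. -/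
lemma sub_one_mul_dslope (s : ℝ) : (s - 1) * dslope (nonlin p q) 1 s = nonlin p q s := by
  have := sub_smul_dslope (nonlin p q) 1 s
  rwa [smul_eq_mul, nonlin_one, sub_zero] at this

lemma continuous_dslope_nonlin (hp : 1 < p) (hpq : p < q) :
    Continuous (dslope (nonlin p q) 1) := by
  rw [← continuousOn_univ, continuousOn_dslope univ_mem]
  exact ⟨(continuous_nonlin hp hpq).continuousOn, hasDerivAt_nonlin_one.differentiableAt⟩

lemma dslope_nonlin_pos (hpq : p < q) {s : ℝ} (hs : 0 < s) : 0 < dslope (nonlin p q) 1 s := by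
  rcases lt_trichotomy s 1 with h | rfl | h
  · have h1 := nonlin_neg hpq hs h
    rw [← sub_one_mul_dslope s] at h1
    exact pos_of_mul_neg_right h1 (by linarith)
  · rw [dslope_same, hasDerivAt_nonlin_one.deriv]
    linarith
  · have h1 := nonlin_pos hpq h
    rw [← sub_one_mul_dslope s] at h1
    exact pos_of_mul_pos_right h1 (by linarith)

lemma mul_truncNonlin_eq_dslope {x : ℝ} (h : x ∈ Icc (-1) (topValue p q - 1)) :
    x * truncNonlin p q x = dslope (nonlin p q) 1 (1 + x) * x ^ 2 := by
  rw [truncNonlin_eq h, ← sub_one_mul_dslope]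
  ring

/-- Quadratic bounds for the truncated nonlinearity and its potential away from `x = -1`. -/
lemma exists_quadratic_bounds (hp : 1 < p) (hpq : p < q) {δ : ℝ} (hδ : 0 < δ) (hδ1 : δ < 1) :
    ∃ k₁ > 0, ∃ k₂ > 0, ∀ x ∈ Icc (δ - 1) (topValue p q - 1),
      k₁ * x ^ 2 ≤ x * truncNonlin p q x ∧ k₁ / 2 * x ^ 2 ≤ potential p q x ∧
      potential p q x ≤ k₂ / 2 * x ^ 2 := by
  have hM := one_lt_topValue hp hpq
  have hc := (continuous_dslope_nonlin hp hpq).continuousOn (s := Icc δ (topValue p q))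
  have hne : (Icc δ (topValue p q)).Nonempty := nonempty_Icc.2 (by linarith)
  -- The constants k₁ and k₂ are the extrema of the divided difference on [δ, topValue]; δ > 0 makes
  -- them positive.
  obtain ⟨s₁, hs₁, hmin⟩ := isCompact_Icc.exists_isMinOn hne hc
  obtain ⟨s₂, hs₂, hmax⟩ := isCompact_Icc.exists_isMaxOn hne hc
  set k₁ := dslope (nonlin p q) 1 s₁ with hk₁
  set k₂ := dslope (nonlin p q) 1 s₂ with hk₂
  have hb : ∀ x ∈ Icc (δ - 1) (topValue p q - 1),
      k₁ * x ^ 2 ≤ x * truncNonlin p q x ∧ x * truncNonlin p q x ≤ k₂ * x ^ 2 := by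
    intro x hx
    have hx' : 1 + x ∈ Icc δ (topValue p q) := ⟨by linarith [hx.1], by linarith [hx.2]⟩
    rw [mul_truncNonlin_eq_dslope ⟨by linarith [hx.1], hx.2⟩]
    exact ⟨mul_le_mul_of_nonneg_right (hmin hx') (sq_nonneg x),
      mul_le_mul_of_nonneg_right (hmax hx') (sq_nonneg x)⟩
  have hsub : ∀ x ∈ Icc (δ - 1) (topValue p q - 1),
      uIcc 0 x ⊆ Icc (δ - 1) (topValue p q - 1) := fun x hx =>
    uIcc_subset_Icc ⟨by linarith, by linarith⟩ hx
  have hsq : ∀ k s : ℝ, HasDerivAt (fun s => k / 2 * s ^ 2) (k * s) s := by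
    intro k s
    refine ((hasDerivAt_pow 2 s).const_mul (k / 2)).congr_deriv ?_
    norm_num
    ring
  refine ⟨k₁, dslope_nonlin_pos hpq (hδ.trans_le hs₁.1), k₂,
    dslope_nonlin_pos hpq (hδ.trans_le hs₂.1), fun x hx => ⟨(hb x hx).1, ?_, ?_⟩⟩
  · have := nonneg_of_mul_deriv_nonneg (x := x)
      (fun s => (hasDerivAt_potential hp hpq s).sub (hsq k₁ s)) (by simp) fun s hs => by
        have := (hb s (hsub x hx hs)).1
        nlinarith
    simp only [Pi.sub_apply] at this
    linarith
  · have := nonneg_of_mul_deriv_nonneg (x := x)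
      (fun s => (hsq k₂ s).sub (hasDerivAt_potential hp hpq s)) (by simp) fun s hs => by
        have := (hb s (hsub x hx hs)).2
        nlinarith
    simp only [Pi.sub_apply] at this
    linarith

/-- Near its zero the truncated nonlinearity dominates every linear function of slope below
`q - p`. -/
lemma exists_mul_truncNonlin_ge (hp : 1 < p) (hpq : p < q) {μ : ℝ} (hμ : μ < q - p) :
    ∃ η > 0, ∀ x, |x| ≤ η → μ * x ^ 2 ≤ x * truncNonlin p q x := by
  have hM := one_lt_topValue hp hpq
  have hc : ContinuousAt (fun x => dslope (nonlin p q) 1 (1 + x)) 0 :=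
    ((continuous_dslope_nonlin hp hpq).comp (continuous_const.add continuous_id)).continuousAt
  have h0 : μ < dslope (nonlin p q) 1 (1 + 0) := by
    rwa [add_zero, dslope_same, hasDerivAt_nonlin_one.deriv]
  have hmem : Icc (-1) (topValue p q - 1) ∈ 𝓝 (0 : ℝ) := Icc_mem_nhds (by norm_num) (by linarith)
  have hev := (hc.eventually (lt_mem_nhds h0)).and hmem
  obtain ⟨η, hη, hη'⟩ := Metric.eventually_nhds_iff.1 hev
  refine ⟨η / 2, half_pos hη, fun x hx => ?_⟩
  obtain ⟨h1, h2⟩ := hη' (y := x) (by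
    rw [Real.dist_eq, sub_zero]
    exact hx.trans_lt (half_lt_self hη))
  rw [mul_truncNonlin_eq_dslope h2]
  exact mul_le_mul_of_nonneg_right h1.le (sq_nonneg x)

/-- `G(x₀) - G(x) ≤ (1 + x)^p / p` for `x₀ ≤ x`. -/
lemma potential_sub_le (hp : 1 < p) (hpq : p < q) {x₀ x : ℝ} (hx₀ : -1 < x₀) (hx : x₀ ≤ x)
    (hxM : x ≤ topValue p q - 1) :
    potential p q x₀ - potential p q x ≤ (1 + x) ^ p / p := by
  -- Adding (1+s)^p / p cancels the negative term of g: the derivative is (1+s)^(q-1).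
  have hmono : MonotoneOn (fun s => potential p q s + (1 + s) ^ p / p) (Icc x₀ x) := by
    refine monotoneOn_of_hasDerivWithinAt_nonneg (convex_Icc x₀ x) ?_ (fun s hs => ?_)
      (fun s hs => ?_) (f' := fun s => truncNonlin p q s + (1 + s) ^ (p - 1))
    · have h1 : Continuous fun s : ℝ => (1 + s) ^ p :=
        (Real.continuous_rpow_const (by linarith)).comp (continuous_const.add continuous_id)
      exact ((continuous_potential hp hpq).add (h1.div_const p)).continuousOn
    · have d : HasDerivAt (fun s : ℝ => 1 + s) 1 s := (hasDerivAt_id s).const_add 1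
      refine HasDerivAt.hasDerivWithinAt (((hasDerivAt_potential hp hpq s).add
        ((d.rpow_const (Or.inr hp.le)).div_const p)).congr_deriv ?_)
      have : p ≠ 0 := by linarith
      field_simp
    · rw [interior_Icc] at hs
      rw [truncNonlin_eq ⟨by linarith [hs.1], by linarith [hs.2]⟩, nonlin, sub_add_cancel]
      exact Real.rpow_nonneg (by linarith [hs.1]) _
  have h1 := hmono ⟨le_rfl, hx⟩ ⟨hx, le_rfl⟩ hx
  have h2 : 0 ≤ (1 + x₀) ^ p / p := div_nonneg (Real.rpow_nonneg (by linarith) _) (by linarith)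
  simp only at h1
  linarith

end

/-! ### Rotation of the truncated solutions, depending on the initial value and on p -/

/-- The conjugate exponent `p / (p - 1)`. -/
def conjExp (p : ℝ) : ℝ := p / (p - 1)

lemma one_lt_conjExp {p : ℝ} (hp : 1 < p) : 1 < conjExp p :=
  (one_lt_div (by linarith)).2 (by linarith)

lemma sub_one_mul_conjExp_sub_one {p : ℝ} (hp : 1 < p) : (p - 1) * (conjExp p - 1) = 1 := by
  have : p - 1 ≠ 0 := by linarith
  rw [conjExp]
  field_simp
  ring

lemma conjExp_sub_one_div {p : ℝ} (hp : 1 < p) : (conjExp p - 1) / conjExp p = 1 / p := by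
  have : p - 1 ≠ 0 := by linarith
  have : p ≠ 0 := by linarith
  rw [conjExp]
  field_simp
  ring

lemma one_div_conjExp {p : ℝ} (hp : 1 < p) : 1 / conjExp p = 1 - 1 / p := by
  have : p - 1 ≠ 0 := by linarith
  have : p ≠ 0 := by linarith
  rw [conjExp]
  field_simp

lemma conjExp_two : conjExp 2 = 2 := by norm_num [conjExp]

/-- Solutions of the truncated radial problem, in the unknown `x = u - 1`. -/
abbrev IsTruncSol (n : ℕ) (p q R : ℝ) (x : ℝ → ℝ) : Prop :=
  IsRadialSol n (conjExp p) (truncNonlin p q) R x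

namespace IsTruncSol

variable {n : ℕ} {p q R : ℝ} {x : ℝ → ℝ}

/-- The decreasing energy traps x in the sublevel set of G(x(0)). So u = 1 + x stays positive and
the truncation is never active. -/
lemma mem_Icc (hp : 1 < p) (hpq : p < q) (h : IsTruncSol n p q R x) (hx : x 0 ∈ Ioo (-1) 0)
    {r : ℝ} (hr : r ∈ Icc 0 R) : x r ∈ Icc (x 0) (topValue p q - 1) :=
  mem_Icc_of_potential_le hp hpq hx (IsRadialSol.potential_le (one_lt_conjExp hp)
    (continuous_truncNonlin hp hpq) (hasDerivAt_potential hp hpq) h hr)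

lemma phase_ne_zero (hp : 1 < p) (hpq : p < q) (h : IsTruncSol n p q R x)
    (hx : x 0 ∈ Ioo (-1) 0) :
    ∀ r ∈ Icc 0 R, x r ≠ 0 ∨ radMom n (truncNonlin p q ∘ x) r ≠ 0 := fun _ hr =>
  IsRadialSol.phase_ne_zero (one_lt_conjExp hp) (continuous_truncNonlin hp hpq)
    (hasDerivAt_potential hp hpq) (potential_nonneg hp hpq) potential_zero h
    (potential_pos hp hpq hx) hr

lemma mul_pos (hp : 1 < p) (hpq : p < q) (h : IsTruncSol n p q R x) (hx : x 0 ∈ Ioo (-1) 0) :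
    ∀ r ∈ Icc 0 R, x r ≠ 0 → 0 < x r * truncNonlin p q (x r) := fun _ hr h0 =>
  mul_truncNonlin_pos hp hpq (hx.1.trans_le (mem_Icc hp hpq h hx hr).1) h0

/-- The speed is controlled by the drop of the potential. -/
lemma abs_velocity_le (hp : 1 < p) (hpq : p < q) (h : IsTruncSol n p q R x) {r : ℝ}
    (hr : r ∈ Icc 0 R) :
    |oddPow (conjExp p) (radFlux n (truncNonlin p q ∘ x) r)| ≤
      (conjExp p * (potential p q (x 0) - potential p q (x r))) ^ (1 / p) := by
  have ha := one_lt_conjExp hp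
  have ha0 : 0 < conjExp p := by linarith
  have he := IsRadialSol.energy_le ha (continuous_truncNonlin hp hpq)
    (hasDerivAt_potential hp hpq) h hr
  rw [energy] at he
  set Y := radFlux n (truncNonlin p q ∘ x) r
  rw [abs_oddPow ha]
  calc |Y| ^ (conjExp p - 1) = (|Y| ^ conjExp p) ^ (1 / p) := by
        rw [← Real.rpow_mul (abs_nonneg _), ← conjExp_sub_one_div hp,
          mul_div_cancel₀ _ ha0.ne']
    _ ≤ _ := by
        refine Real.rpow_le_rpow (by positivity) ?_ (by positivity)
        rw [← div_le_iff₀' ha0]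
        linarith

/-- Solutions starting near `-1` stay near `-1`. -/
lemma exists_forall_lt (hp : 1 < p) (hpq : p < q) {ε : ℝ} (hε : 0 < ε) (R : ℝ) :
    ∃ d₀ > 0, ∀ n : ℕ, ∀ x : ℝ → ℝ, ∀ S ≤ R, IsTruncSol n p q S x → x 0 ∈ Ioo (-1) 0 →
      1 + x 0 ≤ d₀ → ∀ r ∈ Icc 0 S, 1 + x r < ε := by
  set C := (conjExp p / p) ^ (1 / p) with hC
  have ha0 : 0 < conjExp p := zero_lt_one.trans (one_lt_conjExp hp)
  have hp0 : 0 < p := by linarith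
  have hC0 : 0 ≤ C := by positivity
  -- Grönwall: `abs_velocity_le` and `potential_sub_le` give u' ≤ C u for u = 1 + x, so u grows at
  -- most by the factor e^(CR); the half makes the final inequality strict.
  refine ⟨ε / 2 * Real.exp (-(C * R)), by positivity, fun n x S hS h hx hd r hr => ?_⟩
  have hanti : AntitoneOn (fun r => (1 + x r) * Real.exp (-(C * r))) (Icc 0 S) := by
    refine antitoneOn_of_hasDerivWithinAt_nonpos (convex_Icc 0 S) ?_ (fun s hs => ?_)
      (fun s hs => ?_) (f' := fun s => oddPow (conjExp p) (radFlux n (truncNonlin p q ∘ x) s) *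
        Real.exp (-(C * s)) + (1 + x s) * (Real.exp (-(C * s)) * -C))
    · have := h.continuous
      exact Continuous.continuousOn (by fun_prop)
    · rw [interior_Icc] at hs
      have d : HasDerivAt (fun s : ℝ => -(C * s)) (-C) s := by
        have := ((hasDerivAt_id s).const_mul C).neg
        rwa [mul_one] at this
      exact (((h.hasDerivAt (Ioo_subset_Icc_self hs)).const_add 1).mul d.exp).hasDerivWithinAt
    · rw [interior_Icc] at hs
      have hs' := Ioo_subset_Icc_self hs
      have hmem := mem_Icc hp hpq h hx hs'
      have hu : 0 < 1 + x s := by linarith [hmem.1, hx.1]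
      have h1 := abs_velocity_le hp hpq h hs'
      have h2 : (conjExp p * (potential p q (x 0) - potential p q (x s))) ^ (1 / p) ≤
          C * (1 + x s) := by
        calc _ ≤ (conjExp p / p * (1 + x s) ^ p) ^ (1 / p) := by
              refine Real.rpow_le_rpow (mul_nonneg ha0.le (sub_nonneg.2
                (IsRadialSol.potential_le (one_lt_conjExp hp) (continuous_truncNonlin hp hpq)
                  (hasDerivAt_potential hp hpq) h hs'))) ?_ (by positivity)
              rw [div_mul_eq_mul_div, mul_div_assoc]
              exact mul_le_mul_of_nonneg_left (potential_sub_le hp hpq hx.1 hmem.1 hmem.2) ha0.le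
          _ = C * (1 + x s) := by
              rw [Real.mul_rpow (by positivity) (by positivity), ← Real.rpow_mul hu.le,
                mul_one_div_cancel hp0.ne', Real.rpow_one]
      have h3 := (le_abs_self _).trans (h1.trans h2)
      nlinarith [Real.exp_pos (-(C * s))]
  have hS0 : 0 ≤ S := hr.1.trans hr.2
  have h1 := hanti ⟨le_rfl, hS0⟩ hr hr.1
  simp only [mul_zero, neg_zero, Real.exp_zero, mul_one] at h1
  have h2 : (1 + x r) * Real.exp (-(C * r)) ≤ ε / 2 * Real.exp (-(C * R)) := h1.trans hd
  have h3 : Real.exp (-(C * R)) ≤ Real.exp (-(C * r)) :=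
    Real.exp_le_exp.2 (neg_le_neg (mul_le_mul_of_nonneg_left (hr.2.trans hS) hC0))
  have h4 : (1 + x r) * Real.exp (-(C * r)) ≤ ε / 2 * Real.exp (-(C * r)) :=
    h2.trans (mul_le_mul_of_nonneg_left h3 (by positivity))
  have h5 := le_of_mul_le_mul_right h4 (Real.exp_pos _)
  linarith

/-- Solutions starting near `-1` do not leave the left half plane. -/
lemma exists_phaseAngle_lt_of_near_bot (hp : 1 < p) (hpq : p < q) (hR : 0 ≤ R) :
    ∃ d₀ > 0, ∀ n : ℕ, ∀ x : ℝ → ℝ, IsTruncSol n p q R x → x 0 ∈ Ioo (-1) 0 → 1 + x 0 ≤ d₀ →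
      phaseAngle n (conjExp p) (truncNonlin p q) x 1 R < Real.pi / 2 := by
  obtain ⟨d₀, hd₀, H⟩ := exists_forall_lt hp hpq one_pos R
  exact ⟨d₀, hd₀, fun n x h hx hd => h.phaseAngle_lt_of_neg (one_lt_conjExp hp)
    (continuous_truncNonlin hp hpq) hR fun r hr => by linarith [H n x R le_rfl h hx hd r hr]⟩

lemma potential_le_sq (hp : 1 < p) (hpq : p < q) :
    ∃ k > 0, ∀ x₀ ∈ Icc (-(1 / 2) : ℝ) 0, potential p q x₀ ≤ k * x₀ ^ 2 := by
  have hM := one_lt_topValue hp hpq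
  obtain ⟨k₁, hk₁, k₂, hk₂, H⟩ := exists_quadratic_bounds hp hpq (δ := 1 / 2) (by norm_num)
    (by norm_num)
  exact ⟨k₂ / 2, half_pos hk₂, fun x hx =>
    (H x ⟨by linarith [hx.1], by linarith [hx.2]⟩).2.2⟩

/-- For `p < 2`, solutions starting near `0` do not leave the left half plane. -/
lemma exists_phaseAngle_lt_of_near_zero (hp : 1 < p) (hpq : p < q) (hp2 : p < 2) (hR : 0 < R) :
    ∃ η > 0, ∀ n : ℕ, ∀ x : ℝ → ℝ, IsTruncSol n p q R x → x 0 ∈ Ioo (-1) 0 → -(x 0) < η →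
      phaseAngle n (conjExp p) (truncNonlin p q) x 1 R < Real.pi / 2 := by
  obtain ⟨k, hk, hk'⟩ := potential_le_sq hp hpq
  have ha0 : 0 < conjExp p := zero_lt_one.trans (one_lt_conjExp hp)
  have hp0 : 0 < p := by linarith
  -- With t = -x(0) the speed is O(t^(2/p)), so the displacement over [0, R] is at most C t^(2/p).
  -- As 2/p > 1 this is less than t for small t, and x cannot reach 0.
  set C := R * (conjExp p * k) ^ (1 / p) with hC
  have hC0 : 0 < C := by positivity
  have he : 0 < 2 / p - 1 := sub_pos.2 ((one_lt_div hp0).2 hp2)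
  have hlim : Tendsto (fun t : ℝ => C * t ^ (2 / p - 1)) (𝓝 0) (𝓝 0) := by
    have := ((Real.continuous_rpow_const he.le).tendsto 0).const_mul C
    simpa [Real.zero_rpow he.ne'] using this
  obtain ⟨η, hη, hη'⟩ := Metric.eventually_nhds_iff.1 (hlim.eventually (gt_mem_nhds one_pos))
  refine ⟨min η (1 / 2), lt_min hη (by norm_num), fun n x h hx hxη => ?_⟩
  set t := -(x 0) with ht
  have ht0 : 0 < t := by linarith [hx.2]
  have hlt : C * t ^ (2 / p - 1) < 1 := hη' (by
    rw [Real.dist_eq, sub_zero, abs_of_pos ht0]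
    exact hxη.trans_le (min_le_left _ _))
  have hvel : ∀ r ∈ Icc 0 R, |oddPow (conjExp p) (radFlux n (truncNonlin p q ∘ x) r)| ≤
      (conjExp p * k) ^ (1 / p) * t ^ (2 / p) := by
    intro r hr
    refine (abs_velocity_le hp hpq h hr).trans ?_
    have h1 : potential p q (x 0) - potential p q (x r) ≤ k * t ^ 2 := by
      have h2 := hk' (x 0) ⟨by linarith [hxη.trans_le (min_le_right _ _)], hx.2.le⟩
      have h3 := potential_nonneg hp hpq (x r)
      have h4 : t ^ 2 = x 0 ^ 2 := by rw [ht, neg_sq]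
      rw [h4]
      linarith
    calc _ ≤ (conjExp p * k * t ^ 2) ^ (1 / p) := by
          refine Real.rpow_le_rpow (mul_nonneg ha0.le (sub_nonneg.2
            (IsRadialSol.potential_le (one_lt_conjExp hp) (continuous_truncNonlin hp hpq)
              (hasDerivAt_potential hp hpq) h hr))) ?_ (by positivity)
          rw [mul_assoc]
          exact mul_le_mul_of_nonneg_left h1 ha0.le
      _ = _ := by
          rw [Real.mul_rpow (by positivity) (by positivity), ← Real.rpow_natCast,
            ← Real.rpow_mul ht0.le]
          congr 2
          push_cast
          ring
  refine h.phaseAngle_lt_of_neg (one_lt_conjExp hp) (continuous_truncNonlin hp hpq) hR.le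
    fun r hr => ?_
  have h1 := (convex_Icc 0 R).norm_image_sub_le_of_norm_hasDerivWithin_le
    (fun s hs => (h.hasDerivAt hs).hasDerivWithinAt) hvel ⟨le_rfl, hR.le⟩ hr
  rw [sub_zero, Real.norm_eq_abs, Real.norm_eq_abs, abs_of_nonneg hr.1] at h1
  have h2 : (conjExp p * k) ^ (1 / p) * t ^ (2 / p) * r ≤ C * t ^ (2 / p - 1) * t := by
    calc _ ≤ (conjExp p * k) ^ (1 / p) * t ^ (2 / p) * R :=
          mul_le_mul_of_nonneg_left hr.2 (by positivity)
      _ = _ := by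
          rw [Real.rpow_sub_one ht0.ne', hC]
          field_simp
  have h3 : C * t ^ (2 / p - 1) * t < 1 * t := mul_lt_mul_of_pos_right hlt ht0
  have h4 := le_abs_self (x r - x 0)
  linarith

/-- The rotation over `[r₀, 2 r₀]` of a solution that stays above `δ - 1`. -/
lemma exists_rotation (n : ℕ) (hp : 1 < p) (hpq : p < q) {δ : ℝ} (hδ : 0 < δ) (hδ1 : δ < 1) :
    ∃ c > 0, ∀ R r₀ : ℝ, ∀ x : ℝ → ℝ, IsTruncSol n p q R x → x 0 ∈ Ioo (-1) 0 → 0 < r₀ →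
      2 * r₀ ≤ R → (∀ r ∈ Icc r₀ (2 * r₀), δ - 1 ≤ x r) →
      c * r₀ * energy n (conjExp p) (potential p q) (truncNonlin p q) x r₀ ^ (1 / p - 1 / 2) -
        Real.pi / 2 ≤ phaseAngle n (conjExp p) (truncNonlin p q) x 1 (2 * r₀) := by
  obtain ⟨k₁, hk₁, k₂, hk₂, H⟩ := exists_quadratic_bounds hp hpq hδ hδ1
  have ha := one_lt_conjExp hp
  refine ⟨rotationConst n (conjExp p) k₁ k₂, rotationConst_pos n ha hk₁ hk₂,
    fun R r₀ x h hx hr₀ hr₀R hlow => ?_⟩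
  have hsub : Icc r₀ (2 * r₀) ⊆ Icc 0 R := Icc_subset_Icc hr₀.le hr₀R
  have hmem : ∀ r ∈ Icc r₀ (2 * r₀), x r ∈ Icc (δ - 1) (topValue p q - 1) := fun r hr =>
    ⟨hlow r hr, (mem_Icc hp hpq h hx (hsub hr)).2⟩
  have he : (1 / p - 1 / 2 : ℝ) = 1 / 2 - 1 / conjExp p := by
    rw [one_div_conjExp hp]
    ring
  rw [he]
  exact h.rotation ha (continuous_truncNonlin hp hpq) (hasDerivAt_potential hp hpq)
    (potential_nonneg hp hpq) (mul_truncNonlin_nonneg hp hpq) (phase_ne_zero hp hpq h hx) hx.2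
    hk₁ hk₂ hr₀ hr₀R (fun r hr => (H _ (hmem r hr)).1) (fun r hr => (H _ (hmem r hr)).2.1)
    (fun r hr => (H _ (hmem r hr)).2.2)
    (IsRadialSol.energy_pos ha (continuous_truncNonlin hp hpq) (hasDerivAt_potential hp hpq)
      (potential_nonneg hp hpq) h (potential_pos hp hpq hx) (hsub ⟨le_rfl, by linarith⟩))

/-- For `2 < p`, solutions starting near `0` rotate arbitrarily often. -/
lemma exists_lt_phaseAngle_of_near_zero (n : ℕ) (hp : 1 < p) (hpq : p < q) (hp2 : 2 < p)
    (hR : 0 < R) (T : ℝ) :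
    ∃ η > 0, ∀ x : ℝ → ℝ, IsTruncSol n p q R x → x 0 ∈ Ioo (-1) 0 → -(x 0) < η →
      T < phaseAngle n (conjExp p) (truncNonlin p q) x 1 R := by
  obtain ⟨k, hk, hk'⟩ := potential_le_sq hp hpq
  obtain ⟨c, hc, hrot⟩ := exists_rotation n hp hpq (δ := 1 / 2) (by norm_num) (by norm_num)
  have ha := one_lt_conjExp hp
  have hp0 : 0 < p := by linarith
  have he : 1 / p - 1 / 2 < 0 := sub_neg.2 (one_div_lt_one_div_of_lt two_pos hp2)
  -- The exponent is negative, so small positive energy at R/2 forces many turns on [R/2, R].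
  have hlim : Tendsto (fun e : ℝ => c * (R / 2) * e ^ (1 / p - 1 / 2)) (𝓝[>] 0) atTop :=
    (tendsto_rpow_neg_nhdsGT_zero he).const_mul_atTop (by positivity)
  have hev := hlim.eventually (eventually_gt_atTop (T + Real.pi / 2))
  rw [eventually_nhdsWithin_iff, Metric.eventually_nhds_iff] at hev
  obtain ⟨ε, hε, hε'⟩ := hev
  have hlim2 : Tendsto (fun t : ℝ => k * t ^ 2) (𝓝 0) (𝓝 0) := by
    have : Continuous fun t : ℝ => k * t ^ 2 := by fun_prop
    simpa using this.tendsto 0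
  obtain ⟨η, hη, hη'⟩ := Metric.eventually_nhds_iff.1 (hlim2.eventually (gt_mem_nhds hε))
  refine ⟨min η (1 / 2), lt_min hη (by norm_num), fun x h hx hxη => ?_⟩
  have hr₀ : R / 2 ∈ Icc 0 R := ⟨by positivity, by linarith⟩
  have hx1 : -(1 / 2) ≤ x 0 := by linarith [hxη.trans_le (min_le_right _ _)]
  set e := energy n (conjExp p) (potential p q) (truncNonlin p q) x (R / 2) with hedef
  have he0 : 0 < e := IsRadialSol.energy_pos ha (continuous_truncNonlin hp hpq)
    (hasDerivAt_potential hp hpq) (potential_nonneg hp hpq) h (potential_pos hp hpq hx) hr₀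
  have he1 : e < ε := by
    refine ((IsRadialSol.energy_le ha (continuous_truncNonlin hp hpq)
      (hasDerivAt_potential hp hpq) h hr₀).trans (hk' _ ⟨hx1, hx.2.le⟩)).trans_lt (hη' ?_)
    rw [Real.dist_eq, sub_zero, abs_of_neg hx.2]
    exact hxη.trans_le (min_le_left _ _)
  have h1 := hε' (y := e) (by rwa [Real.dist_eq, sub_zero, abs_of_pos he0]) he0
  have h2 := hrot R (R / 2) x h hx (by positivity) (by linarith) fun r hr => by
    have := (mem_Icc hp hpq h hx
      (⟨by linarith [hr.1], by linarith [hr.2]⟩ : r ∈ Icc 0 R)).1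
    linarith
  rw [mul_div_cancel₀ R two_ne_zero] at h2
  linarith

/-- For `p < 2` there is an initial value whose solutions rotate arbitrarily often on large
intervals. -/
lemma exists_lt_phaseAngle_of_large (n : ℕ) (hp : 1 < p) (hpq : p < q) (hp2 : p < 2) (T : ℝ) :
    ∃ x₀ ∈ Ioo (-1 : ℝ) 0, ∃ R₀ > 0, ∀ R ≥ R₀, ∀ x : ℝ → ℝ, IsTruncSol n p q R x → x 0 = x₀ →
      T < phaseAngle n (conjExp p) (truncNonlin p q) x 1 R := by
  have ha := one_lt_conjExp hp
  have hM := one_lt_topValue hp hpq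
  have he : 0 ≤ 1 / p - 1 / 2 :=
    (sub_pos.2 (one_div_lt_one_div_of_lt (by linarith) hp2)).le
  have hhalf : (-(1 / 2) : ℝ) ∈ Ioo (-1 : ℝ) 0 := ⟨by norm_num, by norm_num⟩
  set e₀ := potential p q (-(1 / 2)) with he₀
  have he₀pos : 0 < e₀ := potential_pos hp hpq hhalf
  set w := e₀ ^ (1 / p - 1 / 2) with hw
  have hwpos : 0 < w := Real.rpow_pos_of_pos he₀pos _
  -- enough room for the rotation of solutions that stay above `δ - 1`
  have room : ∀ c > 0, ∃ r : ℝ, 0 < r ∧ ∀ s ≥ r, T + Real.pi / 2 < c * s * w := by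
    intro c hc
    have hlim : Tendsto (fun s : ℝ => c * w * s) atTop atTop :=
      tendsto_id.const_mul_atTop (by positivity)
    obtain ⟨r, hr⟩ := eventually_atTop.1 (hlim.eventually (eventually_gt_atTop (T + Real.pi / 2)))
    refine ⟨max r 1, by positivity, fun s hs => ?_⟩
    have := hr s ((le_max_left _ _).trans hs)
    linarith [mul_right_comm c w s]
  -- The order of choices avoids a circle: r₁ uses the rotation constant for δ = 1/2 only, then d
  -- keeps the solution near -1 up to r₁, and r₂ uses the worse constant for δ = d.
  obtain ⟨c₁, hc₁, hrot₁⟩ := exists_rotation n hp hpq (δ := 1 / 2) (by norm_num) (by norm_num)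
  obtain ⟨r₁, hr₁, hroom₁⟩ := room c₁ hc₁
  obtain ⟨d₀, hd₀, hstay⟩ := exists_forall_lt hp hpq (ε := 1 / 2) (by norm_num) r₁
  set d := min d₀ (1 / 4) with hd
  have hdpos : 0 < d := lt_min hd₀ (by norm_num)
  have hd4 : d ≤ 1 / 4 := min_le_right _ _
  obtain ⟨c₂, hc₂, hrot₂⟩ := exists_rotation n hp hpq (δ := d) hdpos (by linarith)
  obtain ⟨r₂, hr₂, hroom₂⟩ := room c₂ hc₂
  set ρ := max r₁ r₂ with hρ
  have hρpos : 0 < ρ := hr₁.trans_le (le_max_left _ _)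
  refine ⟨d - 1, ⟨by linarith, by linarith⟩, 2 * ρ, by positivity, fun R hR x h hx0 => ?_⟩
  have hx : x 0 ∈ Ioo (-1) 0 := by
    rw [hx0]
    exact ⟨by linarith, by linarith⟩
  have hR0 : 0 ≤ R := by linarith
  set e := energy n (conjExp p) (potential p q) (truncNonlin p q) x with hedef
  have hemono : AntitoneOn e (Icc 0 R) := IsRadialSol.energy_antitoneOn ha
    (continuous_truncNonlin hp hpq) (hasDerivAt_potential hp hpq) h
  have hmono := h.phaseAngle_strictMonoOn ha (continuous_truncNonlin hp hpq) one_pos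
    (phase_ne_zero hp hpq h hx) hR0 (mul_pos hp hpq h hx)
  suffices hs : ∃ s, 0 < s ∧ 2 * s ≤ R ∧
      T < phaseAngle n (conjExp p) (truncNonlin p q) x 1 (2 * s) by
    obtain ⟨s, hs0, hsR, hs⟩ := hs
    exact hs.trans_le (hmono.monotoneOn ⟨by linarith, hsR⟩ ⟨hR0, le_rfl⟩ hsR)
  -- Either the energy is still at least e₀ at ρ, and the bound x ≥ d - 1 suffices on [ρ, 2ρ]; or it
  -- equals e₀ at some s in [r₁, ρ], after which x ≥ -1/2 and the better constant applies on [s,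
  -- 2s].
  by_cases hcase : e₀ ≤ e ρ
  · refine ⟨ρ, hρpos, hR, ?_⟩
    have h1 := hrot₂ R ρ x h hx hρpos hR fun r hr => by
      have := (mem_Icc hp hpq h hx
        (⟨by linarith [hr.1], by linarith [hr.2]⟩ : r ∈ Icc 0 R)).1
      linarith
    have h2 : w ≤ e ρ ^ (1 / p - 1 / 2) := Real.rpow_le_rpow he₀pos.le hcase he
    have h3 := hroom₂ ρ (le_max_right _ _)
    have h4 : c₂ * ρ * w ≤ c₂ * ρ * e ρ ^ (1 / p - 1 / 2) :=
      mul_le_mul_of_nonneg_left h2 (by positivity)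
    linarith
  · push Not at hcase
    have hr₁R : r₁ ∈ Icc 0 R := ⟨hr₁.le, by linarith [le_max_left r₁ r₂]⟩
    have h1 : e₀ ≤ e r₁ := by
      have h2 := hstay n x r₁ le_rfl (h.mono hr₁R.2) hx (by
        rw [hx0]
        linarith [min_le_left d₀ (1 / 4)]) r₁ ⟨hr₁.le, le_rfl⟩
      exact (potential_antitoneOn hp hpq (show x r₁ ≤ 0 by linarith)
        (show (-(1 / 2) : ℝ) ≤ 0 by norm_num) (by linarith)).trans
        (IsRadialSol.potential_le_energy ha r₁)
    have hec : Continuous e := IsRadialSol.continuous_energy ha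
      (continuous_truncNonlin hp hpq) (hasDerivAt_potential hp hpq) h
    obtain ⟨s, hs, hse⟩ := intermediate_value_Icc' (le_max_left r₁ r₂) hec.continuousOn
      (show e₀ ∈ Icc (e ρ) (e r₁) from ⟨hcase.le, h1⟩)
    have hs0 : 0 < s := hr₁.trans_le hs.1
    have hsR : 2 * s ≤ R := by linarith [hs.2]
    refine ⟨s, hs0, hsR, ?_⟩
    have h3 := hrot₁ R s x h hx hs0 hsR fun r hr => by
      have hr' : r ∈ Icc 0 R := ⟨by linarith [hr.1], by linarith [hr.2]⟩
      have h4 : potential p q (x r) ≤ potential p q (-(1 / 2)) := by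
        rw [← he₀, ← hse]
        exact (IsRadialSol.potential_le_energy ha r).trans
          (hemono ⟨hs0.le, by linarith⟩ hr' hr.1)
      have := (mem_Icc_of_potential_le hp hpq hhalf h4).1
      linarith
    have h4 := hroom₁ s hs.1
    rw [hedef] at hse
    rw [hse] at h3
    linarith

end IsTruncSol

/-! ### Calculus of radial functions and radial vector fields -/

section calculus

variable {E : Type*} [NormedAddCommGroup E] [InnerProductSpace ℝ E]

lemma hasFDerivAt_norm_of_ne {z : E} (hz : z ≠ 0) :
    HasFDerivAt (fun z : E => ‖z‖) (‖z‖⁻¹ • innerSL ℝ z) z := by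
  have hz' : ‖z‖ ≠ 0 := norm_ne_zero_iff.2 hz
  have h := (hasStrictFDerivAt_norm_sq z).hasFDerivAt.sqrt (pow_ne_zero 2 hz')
  simp only [Real.sqrt_sq (norm_nonneg _)] at h
  refine h.congr_fderiv ?_
  ext v
  simp
  field_simp

lemma hasFDerivAt_comp_norm {x : ℝ → ℝ} {x' : ℝ} {z : E} (hz : z ≠ 0)
    (hx : HasDerivAt x x' ‖z‖) :
    HasFDerivAt (fun z : E => x ‖z‖) ((x' / ‖z‖) • innerSL ℝ z) z := by
  refine (hx.comp_hasFDerivAt z (hasFDerivAt_norm_of_ne hz)).congr_fderiv ?_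
  rw [smul_smul, div_eq_mul_inv]

lemma hasFDerivAt_comp_norm_zero {x : ℝ → ℝ} (hx : HasDerivAt x 0 0) :
    HasFDerivAt (fun z : E => x ‖z‖) (0 : E →L[ℝ] ℝ) 0 := by
  rw [hasDerivAt_iff_isLittleO] at hx
  have ht : Tendsto (fun z : E => ‖z‖) (𝓝 0) (𝓝 0) := by
    simpa using (continuous_norm (E := E)).tendsto 0
  have h : (fun z : E => x ‖z‖ - x 0) =o[𝓝 0] fun z => ‖z‖ := by
    simpa [Function.comp_def] using hx.comp_tendsto ht
  rw [hasFDerivAt_iff_isLittleO]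
  simpa using Asymptotics.isLittleO_norm_right.1 h

/-- The derivative of a radial `C¹` function. -/
lemma hasFDerivAt_radial {x : ℝ → ℝ} (hx : ContDiff ℝ 1 x) (hx0 : deriv x 0 = 0) (z : E) :
    HasFDerivAt (fun z : E => x ‖z‖) ((deriv x ‖z‖ / ‖z‖) • innerSL ℝ z) z := by
  have hd := fun r => (hx.differentiable one_ne_zero r).hasDerivAt
  rcases eq_or_ne z 0 with rfl | hz
  · have h := hd 0
    rw [hx0] at h
    refine (hasFDerivAt_comp_norm_zero h).congr_fderiv ?_
    simp
  · exact hasFDerivAt_comp_norm hz (hd _)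

/-- The factor L z / |z|^m is bounded but may have no limit at 0; the vanishing of c there absorbs
it. -/
lemma continuous_div_norm_smul {V F : Type*} [NormedAddCommGroup V] [NormedAddCommGroup F] [NormedSpace ℝ F] {c : ℝ → ℝ}
    (hc : Continuous c) (hc0 : c 0 = 0) (m : ℕ) {L : V → F} (hL : Continuous L)
    (hLn : ∀ z, ‖L z‖ ≤ ‖z‖ ^ m) : Continuous fun z : V => (c ‖z‖ / ‖z‖ ^ m) • L z := by
  refine continuous_iff_continuousAt.2 fun z => ?_
  have hcn : Continuous fun z : V => c ‖z‖ := hc.comp continuous_norm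
  rcases eq_or_ne z 0 with rfl | hz
  · have h0 : (c ‖(0 : V)‖ / ‖(0 : V)‖ ^ m) • L 0 = 0 := by simp [hc0]
    rw [ContinuousAt, h0]
    refine squeeze_zero_norm (a := fun z : V => |c ‖z‖|) (fun z => ?_) ?_
    · rw [norm_smul, norm_div, norm_pow, norm_norm, Real.norm_eq_abs]
      rcases eq_or_ne (‖z‖ ^ m) 0 with h | h
      · rw [h]
        simp
      · have hpos : 0 < ‖z‖ ^ m := lt_of_le_of_ne (by positivity) (Ne.symm h)
        calc |c ‖z‖| / ‖z‖ ^ m * ‖L z‖ ≤ |c ‖z‖| / ‖z‖ ^ m * ‖z‖ ^ m :=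
              mul_le_mul_of_nonneg_left (hLn z) (by positivity)
          _ = |c ‖z‖| := div_mul_cancel₀ _ h
    · have := hcn.abs.tendsto 0
      simpa [hc0] using this
  · exact (hcn.continuousAt.div (continuous_norm.pow m).continuousAt
      (pow_ne_zero m (norm_ne_zero_iff.2 hz))).smul hL.continuousAt

lemma contDiff_radial {x : ℝ → ℝ} (hx : ContDiff ℝ 1 x) (hx0 : deriv x 0 = 0) :
    ContDiff ℝ 1 fun z : E => x ‖z‖ := by
  rw [contDiff_one_iff_fderiv]
  refine ⟨fun z => (hasFDerivAt_radial hx hx0 z).differentiableAt, ?_⟩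
  have : fderiv ℝ (fun z : E => x ‖z‖) = fun z => (deriv x ‖z‖ / ‖z‖ ^ 1) • innerSL ℝ z := by
    funext z
    rw [(hasFDerivAt_radial hx hx0 z).fderiv, pow_one]
  rw [this]
  exact continuous_div_norm_smul (hx.continuous_deriv le_rfl) hx0 1 (innerSL ℝ).continuous
    fun z => by rw [innerSL_apply_norm, pow_one]

lemma gradient_radial [CompleteSpace E] {x : ℝ → ℝ} (hx : ContDiff ℝ 1 x) (hx0 : deriv x 0 = 0)
    (z : E) : gradient (fun z : E => x ‖z‖) z = (deriv x ‖z‖ / ‖z‖) • z := by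
  have h : HasGradientAt (fun z : E => x ‖z‖) ((deriv x ‖z‖ / ‖z‖) • z) z := by
    rw [hasGradientAt_iff_hasFDerivAt]
    refine (hasFDerivAt_radial hx hx0 z).congr_fderiv ?_
    ext v
    simp
  exact h.gradient

/-- The derivative of a vector field `A(|z|) z` away from the origin. -/
lemma hasFDerivAt_radialField {A : ℝ → ℝ} {A' : ℝ} {z : E} (hz : z ≠ 0)
    (hA : HasDerivAt A A' ‖z‖) :
    HasFDerivAt (fun z : E => A ‖z‖ • z) (A ‖z‖ • ContinuousLinearMap.id ℝ E +
      (A' / ‖z‖) • (innerSL ℝ z).smulRight z) z := by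
  refine ((hasFDerivAt_comp_norm hz hA).smul (hasFDerivAt_id z)).congr_fderiv ?_
  ext v
  simp [smul_smul]

/-- Continuity of A suffices at the origin, because (A(|z|) - A(0)) z = o(|z|). -/
lemma hasFDerivAt_radialField_zero {A : ℝ → ℝ} (hA : ContinuousAt A 0) :
    HasFDerivAt (fun z : E => A ‖z‖ • z) (A 0 • ContinuousLinearMap.id ℝ E) 0 := by
  rw [hasFDerivAt_iff_isLittleO]
  have h1 : Tendsto (fun z : E => A ‖z‖ - A 0) (𝓝 0) (𝓝 0) := by
    have ht : Tendsto (fun z : E => ‖z‖) (𝓝 0) (𝓝 0) := by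
      simpa using (continuous_norm (E := E)).tendsto 0
    simpa using (hA.tendsto.comp ht).sub_const (A 0)
  have h2 := ((Asymptotics.isLittleO_one_iff ℝ).2 h1).smul_isBigO
    (Asymptotics.isBigO_refl (fun z : E => z) (𝓝 0))
  refine (h2.congr_left fun z => ?_).congr_right fun z => ?_
  · simp [sub_smul]
  · simp

end calculus

lemma sum_coord_eq {N : ℕ} (b c : ℝ) (z : RN N) :
    ∑ i : Fin N, ((b • ContinuousLinearMap.id ℝ (RN N) + c • (innerSL ℝ z).smulRight z)
      (EuclideanSpace.single i 1)) i = N * b + c * ‖z‖ ^ 2 := by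
  have h : ∀ i : Fin N, ((b • ContinuousLinearMap.id ℝ (RN N) + c • (innerSL ℝ z).smulRight z)
      (EuclideanSpace.single i 1)) i = b + c * (z i) ^ 2 := by
    intro i
    simp [EuclideanSpace.inner_single_right]
    left
    ring
  rw [Finset.sum_congr rfl fun i _ => h i, Finset.sum_add_distrib, ← Finset.mul_sum,
    EuclideanSpace.norm_sq_eq]
  simp

/-- The divergence of a vector field `A(|z|) z` away from the origin. -/
lemma divergence_radialField {N : ℕ} {F : RN N → RN N} {A : ℝ → ℝ} {A' : ℝ} {z : RN N}
    (hz : z ≠ 0) (hA : HasDerivAt A A' ‖z‖) (hF : F =ᶠ[𝓝 z] fun z => A ‖z‖ • z) :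
    divergence F z = N * A ‖z‖ + ‖z‖ * A' := by
  have hz' : ‖z‖ ≠ 0 := norm_ne_zero_iff.2 hz
  rw [divergence, ((hasFDerivAt_radialField hz hA).congr_of_eventuallyEq hF).fderiv, sum_coord_eq]
  field_simp

lemma divergence_radialField_zero {N : ℕ} {F : RN N → RN N} {A : ℝ → ℝ}
    (hA : ContinuousAt A 0) (hF : F =ᶠ[𝓝 0] fun z => A ‖z‖ • z) :
    divergence F 0 = N * A 0 := by
  have h := ((hasFDerivAt_radialField_zero (E := RN N) hA).congr_of_eventuallyEq hF).fderiv
  rw [divergence, h]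
  simp

section field

variable {n : ℕ} {k : ℝ → ℝ}

/-- One formula covers the origin as well: there the second summand contains the zero vector z. -/
lemma hasFDerivAt_avgField (hk : Continuous k) (z : RN (n + 1)) :
    HasFDerivAt (fun z : RN (n + 1) => (-radAvg n k ‖z‖) • z)
      ((-radAvg n k ‖z‖) • ContinuousLinearMap.id ℝ (RN (n + 1)) +
        (-(k ‖z‖ - (n + 1) * radAvg n k ‖z‖) / ‖z‖ ^ 2) • (innerSL ℝ z).smulRight z) z := by
  rcases eq_or_ne z 0 with rfl | hz
  · refine (hasFDerivAt_radialField_zero (A := fun r => -radAvg n k r)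
      (continuous_radAvg n hk).neg.continuousAt).congr_fderiv ?_
    ext v
    simp
  · have hz' : 0 < ‖z‖ := norm_pos_iff.2 hz
    refine (hasFDerivAt_radialField hz (hasDerivAt_radAvg n hk hz').neg).congr_fderiv ?_
    congr 2
    field_simp

/-- The singular coefficient k(r) - (n+1) avg(r) vanishes at r = 0 by `radAvg_at_zero`. -/
lemma contDiff_avgField (hk : Continuous k) :
    ContDiff ℝ 1 fun z : RN (n + 1) => (-radAvg n k ‖z‖) • z := by
  rw [contDiff_one_iff_fderiv]
  refine ⟨fun z => (hasFDerivAt_avgField hk z).differentiableAt, ?_⟩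
  have : fderiv ℝ (fun z : RN (n + 1) => (-radAvg n k ‖z‖) • z) = fun z =>
      ((-radAvg n k ‖z‖) • ContinuousLinearMap.id ℝ (RN (n + 1)) +
        (-(k ‖z‖ - (n + 1) * radAvg n k ‖z‖) / ‖z‖ ^ 2) • (innerSL ℝ z).smulRight z) :=
    funext fun z => (hasFDerivAt_avgField hk z).fderiv
  rw [this]
  have hav := continuous_radAvg n hk
  refine Continuous.add ?_ ?_
  · exact (hav.comp continuous_norm).neg.smul continuous_const
  · refine continuous_div_norm_smul (c := fun r => -(k r - (n + 1) * radAvg n k r))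
      (hk.sub (continuous_const.mul hav)).neg ?_ 2 ?_ fun z => ?_
    · rw [radAvg_at_zero, sub_self, neg_zero]
    · exact ((ContinuousLinearMap.smulRightL ℝ (RN (n + 1)) (RN (n + 1))).continuous.comp
        (innerSL ℝ).continuous).clm_apply continuous_id
    · rw [ContinuousLinearMap.norm_smulRight_apply, innerSL_apply_norm, sq]

lemma divergence_avgField (hk : Continuous k) {F : RN (n + 1) → RN (n + 1)} {z : RN (n + 1)}
    (hF : F =ᶠ[𝓝 z] fun z => (-radAvg n k ‖z‖) • z) : divergence F z = -k ‖z‖ := by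
  rcases eq_or_ne z 0 with rfl | hz
  · rw [divergence_radialField_zero (A := fun r => -radAvg n k r)
      (continuous_radAvg n hk).neg.continuousAt hF, norm_zero, ← radAvg_at_zero n k]
    push_cast
    ring
  · have hz' : 0 < ‖z‖ := norm_pos_iff.2 hz
    rw [divergence_radialField hz (hasDerivAt_radAvg n hk hz').neg hF, Pi.neg_apply]
    push_cast
    field_simp
    ring

end field

/-! ### From radial solutions to functions on the ball -/

namespace IsRadialSol

variable {n : ℕ} {p R : ℝ} {g x : ℝ → ℝ}

lemma deriv_zero {a : ℝ} (h : IsRadialSol n a g R x) (hR : 0 ≤ R) : deriv x 0 = 0 := by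
  rw [h.deriv_eq 0 ⟨le_rfl, hR⟩, radFlux_at_zero, oddPow_zero]

variable {c : ℝ}

lemma gradient_eq {a : ℝ} (h : IsRadialSol n a g R x) (hR : 0 ≤ R) (z : RN (n + 1)) :
    gradient (fun z : RN (n + 1) => c + x ‖z‖) z = (deriv x ‖z‖ / ‖z‖) • z := by
  have h1 := gradient_radial (E := RN (n + 1)) (x := fun r => c + x r)
    (contDiff_const.add h.contDiff) (by simpa using h.deriv_zero hR) z
  simpa using h1

/-- In terms of the average the flux is smooth across critical points of u, where |∇u|^(p-2) alone
may be singular or degenerate. -/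
lemma pFlux_eq (hp : 1 < p) (h : IsRadialSol n (conjExp p) g R x) {z : RN (n + 1)}
    (hz : z ∈ closedBall (0 : RN (n + 1)) R) :
    pFlux p (fun z : RN (n + 1) => c + x ‖z‖) z = (-radAvg n (g ∘ x) ‖z‖) • z := by
  rw [mem_closedBall_zero_iff] at hz
  have hR : 0 ≤ R := (norm_nonneg z).trans hz
  rw [pFlux, h.gradient_eq hR]
  rcases eq_or_ne z 0 with rfl | hz0
  · simp
  have hz' : ‖z‖ ≠ 0 := norm_ne_zero_iff.2 hz0
  rw [norm_smul, norm_div, norm_norm, div_mul_cancel₀ _ hz', Real.norm_eq_abs, smul_smul]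
  congr 1
  have h1 : oddPow p (deriv x ‖z‖) = radFlux n (g ∘ x) ‖z‖ := by
    rw [h.deriv_eq _ ⟨norm_nonneg z, hz⟩,
      oddPow_oddPow (one_lt_conjExp hp) (sub_one_mul_conjExp_sub_one hp)]
  rw [← mul_div_assoc, ← oddPow, h1, radFlux]
  field_simp

lemma isPRegular (hp : 1 < p) (hg : Continuous g) (h : IsRadialSol n (conjExp p) g R x)
    (hR : 0 ≤ R) : IsPRegular p R fun z : RN (n + 1) => c + x ‖z‖ where
  contDiffOn := (contDiff_const.add (contDiff_radial h.contDiff (h.deriv_zero hR))).contDiffOn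
  flux_contDiffOn := (contDiff_avgField (hg.comp h.continuous)).contDiffOn.congr fun _ hz =>
    h.pFlux_eq hp (ball_subset_closedBall hz)

lemma neg_pLaplacian_eq (hp : 1 < p) (hg : Continuous g) (h : IsRadialSol n (conjExp p) g R x)
    {z : RN (n + 1)} (hz : z ∈ ball (0 : RN (n + 1)) R) :
    -pLaplacian p (fun z : RN (n + 1) => c + x ‖z‖) z = g (x ‖z‖) := by
  have hF : pFlux p (fun z : RN (n + 1) => c + x ‖z‖) =ᶠ[𝓝 z]
      fun z => (-radAvg n (g ∘ x) ‖z‖) • z := by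
    filter_upwards [isOpen_ball.mem_nhds hz] with w hw
    exact h.pFlux_eq hp (ball_subset_closedBall hw)
  rw [pLaplacian, divergence_avgField (hg.comp h.continuous) hF, neg_neg, Function.comp]

lemma normalDeriv_eq {a : ℝ} (h : IsRadialSol n a g R x) (hR : 0 < R)
    {z : RN (n + 1)} (hz : z ∈ sphere (0 : RN (n + 1)) R) :
    normalDeriv R (fun z : RN (n + 1) => c + x ‖z‖) z = oddPow a (radFlux n (g ∘ x) R) := by
  rw [mem_sphere_zero_iff_norm] at hz
  have hd := (hasFDerivAt_radial (E := RN (n + 1)) h.contDiff (h.deriv_zero hR.le) z).const_add c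
  have hu : UniqueDiffWithinAt ℝ (closedBall (0 : RN (n + 1)) R) z := by
    refine (uniqueDiffOn_convex (convex_closedBall 0 R) ?_) z (by simp [hz])
    exact ⟨0, ball_subset_interior_closedBall (mem_ball_self hR)⟩
  rw [normalDeriv, hd.hasFDerivWithinAt.fderivWithin hu, ← h.deriv_eq R ⟨hR.le, le_rfl⟩]
  simp [hz]
  field_simp

end IsRadialSol

lemma exists_norm_eq (n : ℕ) {r : ℝ} (hr : 0 ≤ r) : ∃ z : RN (n + 1), ‖z‖ = r :=
  ⟨EuclideanSpace.single 0 r, by simp [abs_of_nonneg hr]⟩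

/-- Truncated radial solutions whose angle at `R` is `j π` yield solutions of the Neumann problem
with exactly `j` zeros of `u - 1`. -/
lemma IsTruncSol.isNonconstantRadialSolution {n : ℕ} {p q R : ℝ} {x : ℝ → ℝ} (hp : 1 < p)
    (hpq : p < q) (hR : 0 < R) (h : IsTruncSol n p q R x) (hx : x 0 ∈ Ioo (-1) 0) {j : ℕ}
    (hj : 1 ≤ j) (hΘ : phaseAngle n (conjExp p) (truncNonlin p q) x 1 R = j * Real.pi) :
    IsNonconstantRadialSolution p (fun s : ℝ => s ^ (q - 1)) R
      (fun z : RN (n + 1) => 1 + x ‖z‖) ∧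
    (zeroRadii R fun z : RN (n + 1) => 1 + x ‖z‖).encard = j := by
  have ha := one_lt_conjExp hp
  have hg := continuous_truncNonlin hp hpq
  have hne := IsTruncSol.phase_ne_zero hp hpq h hx
  have hzeros : zeroRadii R (fun z : RN (n + 1) => 1 + x ‖z‖) = {r | r ∈ Icc 0 R ∧ x r = 0} := by
    ext r
    simp only [zeroRadii, mem_ofPred_eq, add_sub_cancel_left]
    refine and_congr_right fun hr => ⟨?_, fun h0 => ?_⟩
    · rintro ⟨z, hz, h0⟩
      rwa [hz] at h0
    · obtain ⟨z, hz⟩ := exists_norm_eq n hr.1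
      exact ⟨z, hz, by rwa [hz]⟩
  have hcard := h.encard_zeros ha hg hR hne hx.2 (IsTruncSol.mul_pos hp hpq h hx) hΘ
  refine ⟨⟨⟨h.isPRegular hp hg hR.le, fun z hz => ?_, fun z hz => ?_, fun z hz => ?_⟩,
    ⟨fun r => 1 + x r, fun z _ => rfl⟩, ?_⟩, by rw [hzeros, hcard]⟩
  · have hz' : ‖z‖ ∈ Icc 0 R := ⟨norm_nonneg z, (mem_ball_zero_iff.1 hz).le⟩
    have hm := IsTruncSol.mem_Icc hp hpq h hx hz'
    rw [h.neg_pLaplacian_eq hp hg hz, truncNonlin_eq ⟨hx.1.le.trans hm.1, hm.2⟩, nonlin,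
      sub_add_cancel]
  · have hz' : ‖z‖ ∈ Icc 0 R := ⟨norm_nonneg z, (mem_ball_zero_iff.1 hz).le⟩
    have hm := IsTruncSol.mem_Icc hp hpq h hx hz'
    linarith [hm.1, hx.1]
  · rw [h.normalDeriv_eq hR hz, h.radFlux_eq_zero_of_phaseAngle ha hg hR hne hx.2 hΘ, oddPow_zero]
  · rintro ⟨c, hc⟩
    -- As j ≥ 1 the function u takes the value 1 somewhere, while u(0) < 1.
    have hpos : {r | r ∈ Icc 0 R ∧ x r = 0}.encard ≠ 0 := by
      rw [hcard]
      exact_mod_cast (by omega : j ≠ 0)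
    obtain ⟨r, hr, hr0⟩ := encard_ne_zero.1 hpos
    obtain ⟨z, hz⟩ := exists_norm_eq n hr.1
    have h1 : 1 + x ‖z‖ = c := hc z (by simp [hz, hr.2])
    have h2 : 1 + x ‖(0 : RN (n + 1))‖ = c := hc 0 (by simp [hR.le])
    rw [hz, hr0] at h1
    rw [norm_zero] at h2
    linarith [hx.2]

lemma eq_of_hasDerivAt_zero {A : ℝ → ℝ} {b c : ℝ} (hbc : b ≤ c) (hA : ContinuousOn A (Icc b c))
    (hd : ∀ s ∈ Ioo b c, HasDerivAt A 0 s) : A c = A b := by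
  rcases hbc.eq_or_lt with rfl | h
  · rfl
  obtain ⟨s, -, hs'⟩ := exists_hasDerivAt_eq_slope A (fun _ => 0) h hA hd
  rw [eq_comm, div_eq_zero_iff] at hs'
  rcases hs' with hs' | hs' <;> linarith

/-! ### Radial eigenfunctions of the Laplacian -/

lemma pFlux_two {N : ℕ} (u : RN N → ℝ) : pFlux 2 u = gradient u := by
  funext z
  simp [pFlux]

/-- A radial Neumann eigenfunction of the Laplacian solves the radial equation. -/
lemma exists_isRadialSol_of_eigenvalue {n : ℕ} {R lam : ℝ} (hR : 0 < R)
    (h : IsRadialEigenvalue (n + 1) 2 R lam) :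
    ∃ x, IsRadialSol n 2 (fun s => lam * s) R x ∧ (∃ r ∈ Icc 0 R, x r ≠ 0) ∧
      radFlux n ((fun s => lam * s) ∘ x) R = 0 := by
  obtain ⟨φ, hreg, ⟨w, hw⟩, ⟨z₀, hz₀, hφz₀⟩, heq, hneu⟩ := h
  set e : RN (n + 1) := EuclideanSpace.single 0 1 with he
  have hen : ‖e‖ = 1 := by simp [he]
  have hre : ∀ r : ℝ, ‖r • e‖ = |r| := fun r => by rw [norm_smul, hen, mul_one, Real.norm_eq_abs]
  have hmem : ∀ r ∈ Icc (-R) R, r • e ∈ closedBall (0 : RN (n + 1)) R := fun r hr => by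
    rw [mem_closedBall_zero_iff, hre]
    exact abs_le.2 hr
  have hmem' : ∀ r ∈ Ioo (-R) R, r • e ∈ ball (0 : RN (n + 1)) R := fun r hr => by
    rw [mem_ball_zero_iff, hre]
    exact abs_lt.2 hr
  set y : ℝ → ℝ := fun r => φ (r • e) with hy
  have hyw : ∀ r ∈ Icc (-R) R, y r = w |r| := fun r hr => by
    rw [hy, ← hre]
    exact hw _ (hmem r hr)
  have hφy : ∀ z ∈ closedBall (0 : RN (n + 1)) R, φ z = y ‖z‖ := fun z hz => by
    rw [hw z hz, hyw _ ⟨by linarith [norm_nonneg z], mem_closedBall_zero_iff.1 hz⟩, abs_norm]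
  have hyc : ContinuousOn y (Icc (-R) R) :=
    hreg.contDiffOn.continuousOn.comp (by fun_prop) hmem
  have hgradC : ContDiffOn ℝ 1 (gradient φ) (ball 0 R) := by
    rw [← pFlux_two]
    exact hreg.flux_contDiffOn
  have hφd : ∀ z ∈ ball (0 : RN (n + 1)) R, HasGradientAt φ (gradient φ z) z := fun z hz =>
    ((hreg.contDiffOn.contDiffAt (mem_of_superset (isOpen_ball.mem_nhds hz)
      ball_subset_closedBall)).differentiableAt one_ne_zero).hasGradientAt
  set D : ℝ → ℝ := fun r => inner ℝ (gradient φ (r • e)) e with hD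
  have hyD : ∀ r ∈ Ioo (-R) R, HasDerivAt y (D r) r := by
    intro r hr
    have h1 := (hφd _ (hmem' r hr)).hasFDerivAt.comp_hasDerivAt r ((hasDerivAt_id r).smul_const e)
    refine h1.congr_deriv ?_
    simp [hD]
  have hDC : ContDiffOn ℝ 1 D (Ioo (-R) R) := by
    have h1 : ContDiffOn ℝ 1 (fun r : ℝ => gradient φ (r • e)) (Ioo (-R) R) :=
      hgradC.comp (contDiff_id.smul contDiff_const).contDiffOn hmem'
    exact h1.inner ℝ contDiffOn_const
  have hDd : ∀ r ∈ Ioo (-R) R, HasDerivAt D (deriv D r) r := fun r hr =>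
    ((hDC.contDiffAt (isOpen_Ioo.mem_nhds hr)).differentiableAt one_ne_zero).hasDerivAt
  have h0mem : (0 : ℝ) ∈ Ioo (-R) R := ⟨by linarith, hR⟩
  -- The profile y is read along a whole diameter; it is even there, so its derivative vanishes at
  -- the centre.
  have hD0 : D 0 = 0 := by
    have h1 := hyD 0 h0mem
    have h2 : HasDerivAt (fun r => y (-r)) (-D 0) 0 := by
      have h3 : HasDerivAt y (D 0) (-0) := by rwa [neg_zero]
      refine (h3.comp (0 : ℝ) (hasDerivAt_neg (0 : ℝ))).congr_deriv (by simp)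
    have h3 : HasDerivAt y (-D 0) 0 := by
      refine h2.congr_of_eventuallyEq ?_
      filter_upwards [isOpen_Ioo.mem_nhds h0mem] with r hr
      rw [hyw r (Ioo_subset_Icc_self hr), hyw (-r) ⟨by linarith [hr.2], by linarith [hr.1]⟩, abs_neg]
    have := h1.unique h3
    linarith
  have hgrad : ∀ z ∈ ball (0 : RN (n + 1)) R, z ≠ 0 → gradient φ z = (D ‖z‖ / ‖z‖) • z := by
    intro z hz hz0
    have hzR := mem_ball_zero_iff.1 hz
    have h1 := hasFDerivAt_comp_norm hz0 (hyD ‖z‖ ⟨by linarith [norm_nonneg z], hzR⟩)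
    have h2 : HasGradientAt φ ((D ‖z‖ / ‖z‖) • z) z := by
      rw [hasGradientAt_iff_hasFDerivAt]
      refine (h1.congr_of_eventuallyEq ?_).congr_fderiv ?_
      · filter_upwards [isOpen_ball.mem_nhds hz] with v hv
        exact hφy v (ball_subset_closedBall hv)
      · ext v
        simp
    exact h2.gradient
  -- the equation on `(0, R)`
  have hDeq : ∀ r ∈ Ioo 0 R, HasDerivAt D (-(lam * y r) - n / r * D r) r := by
    intro r hr
    have hr' : r ∈ Ioo (-R) R := ⟨by linarith [hr.1], hr.2⟩
    have hr0 := hr.1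
    have hzb := hmem' r hr'
    have hzn : ‖r • e‖ = r := by rw [hre, abs_of_pos hr.1]
    have hz0 : r • e ≠ 0 := norm_pos_iff.1 (by rw [hzn]; exact hr.1)
    have hA : HasDerivAt (fun s => D s / s) ((deriv D r * r - D r * 1) / r ^ 2) ‖r • e‖ := by
      rw [hzn]
      exact (hDd r hr').div (hasDerivAt_id r) hr.1.ne'
    have hdiv := divergence_radialField (F := pFlux 2 φ) hz0 hA (by
      filter_upwards [isOpen_ball.mem_nhds hzb, isOpen_ne.mem_nhds hz0] with v hv hv0
      rw [pFlux_two]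
      exact hgrad v hv hv0)
    have h1 := heq _ hzb
    rw [pLaplacian, hdiv, hzn] at h1
    simp only [sub_self, Real.rpow_zero, one_mul] at h1
    refine (hDd r hr').congr_deriv ?_
    change _ = lam * y r at h1
    rw [← h1]
    push_cast
    field_simp
    ring
  -- comparison with the flux of the extended function
  have hR0 := hR.le
  have hyc' : ContinuousOn y (Icc 0 R) := hyc.mono (Icc_subset_Icc (by linarith) le_rfl)
  set Y : ℝ → ℝ := IccExtend hR0 ((Icc 0 R).domRestrict y) with hY
  have hYc : Continuous Y := (continuousOn_iff_continuous_domRestrict.1 hyc').Icc_extend'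
  have hYy : EqOn Y y (Icc 0 R) := fun s hs => IccExtend_of_mem hR0 _ hs
  have hg : Continuous fun s : ℝ => lam * s := by fun_prop
  set k : ℝ → ℝ := (fun s => lam * s) ∘ Y with hk
  have hkc : Continuous k := hg.comp hYc
  -- The functions r^n D and `radMom` have the same derivative on (0, R) and vanish at 0.
  have hDflux : ∀ r ∈ Ioo 0 R, D r = radFlux n k r := by
    intro r hr
    have h1 := eq_of_hasDerivAt_zero (A := fun s => s ^ n * D s - radMom n k s) hr.1.le ?_ ?_
    · simp only [hD0, mul_zero, radMom_at_zero, sub_zero] at h1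
      rw [sub_eq_zero, radMom] at h1
      exact mul_left_cancel₀ (pow_ne_zero n hr.1.ne') h1
    · refine ContinuousOn.sub (ContinuousOn.mul (by fun_prop) (hDC.continuousOn.mono ?_))
        (continuous_radMom n hkc).continuousOn
      exact fun s hs => ⟨by linarith [hs.1], hs.2.trans_lt hr.2⟩
    · intro s hs
      have hs' : s ∈ Ioo 0 R := ⟨hs.1, hs.2.trans hr.2⟩
      have hs0 := hs.1
      refine (((hasDerivAt_pow n s).mul (hDeq s hs')).sub
        (hasDerivAt_radMom n hkc s)).congr_deriv ?_
      have h2 : k s = lam * y s := congrArg (lam * ·) (hYy (Ioo_subset_Icc_self hs'))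
      rw [h2]
      rcases n with _ | m
      · simp
      · rw [Nat.add_sub_cancel]
        push_cast
        field_simp
        ring
  have hint : ∀ r ∈ Icc 0 R, Y r = Y 0 + ∫ s in (0 : ℝ)..r, oddPow 2 (radFlux n k s) := by
    intro r hr
    simp only [oddPow_two]
    have hfc := continuous_radFlux n hkc
    have hprim : ∀ s, HasDerivAt (fun r => ∫ s in (0 : ℝ)..r, radFlux n k s) (radFlux n k s) s :=
      fun s => intervalIntegral.integral_hasDerivAt_right (hfc.intervalIntegrable _ _)
        hfc.stronglyMeasurable.stronglyMeasurableAtFilter hfc.continuousAt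
    have h1 := eq_of_hasDerivAt_zero
      (A := fun s => Y s - ∫ s in (0 : ℝ)..s, radFlux n k s) hr.1 ?_ ?_
    · simp only [intervalIntegral.integral_same, sub_zero] at h1
      linarith
    · exact (hYc.sub (continuous_iff_continuousAt.2 fun s =>
        (hprim s).continuousAt)).continuousOn
    · intro s hs
      have hs' : s ∈ Ioo 0 R := ⟨hs.1, hs.2.trans_le hr.2⟩
      have h2 : HasDerivAt Y (D s) s := by
        refine (hyD s ⟨by linarith [hs.1], hs'.2⟩).congr_of_eventuallyEq ?_
        filter_upwards [isOpen_Ioo.mem_nhds hs'] with t ht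
        exact hYy (Ioo_subset_Icc_self ht)
      refine (h2.sub (hprim s)).congr_deriv ?_
      rw [hDflux s hs', sub_self]
  obtain ⟨x, hx, hxY⟩ := IsRadialSol.exists_of_integral_eq one_lt_two hg hR0 hYc.continuousOn hint
  have hφx : ∀ z ∈ closedBall (0 : RN (n + 1)) R, φ z = 0 + x ‖z‖ := fun z hz => by
    have hz' : ‖z‖ ∈ Icc 0 R := ⟨norm_nonneg z, mem_closedBall_zero_iff.1 hz⟩
    rw [hφy z hz, zero_add, hxY hz', hYy hz']
  refine ⟨x, hx, ⟨‖z₀‖, ⟨norm_nonneg _, mem_closedBall_zero_iff.1 hz₀⟩, ?_⟩, ?_⟩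
  · have := hφx z₀ hz₀
    rw [zero_add] at this
    rwa [← this]
  · have hzs : R • e ∈ sphere (0 : RN (n + 1)) R := by
      rw [mem_sphere_zero_iff_norm, hre, abs_of_pos hR]
    have h1 := hneu _ hzs
    have h2 : normalDeriv R φ (R • e) = normalDeriv R (fun z => 0 + x ‖z‖) (R • e) := by
      rw [normalDeriv, normalDeriv, fderivWithin_congr hφx (hφx _ (sphere_subset_closedBall hzs))]
    rw [h2, hx.normalDeriv_eq hR hzs, oddPow_two] at h1
    exact h1

/-! ### The angle index of a radial eigenvalue -/

section linear

variable {n : ℕ} {R lam : ℝ} {x : ℝ → ℝ}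

lemma hasDerivAt_quadratic (lam s : ℝ) : HasDerivAt (fun s => lam / 2 * s ^ 2) (lam * s) s := by
  refine ((hasDerivAt_pow 2 s).const_mul (lam / 2)).congr_deriv ?_
  norm_num
  ring

/-- Negative numbers are not eigenvalues. -/
lemma IsRadialSol.nonneg_of_radFlux_eq_zero (hR : 0 < R)
    (h : IsRadialSol n 2 (fun s => lam * s) R x) (hx : ∃ r ∈ Icc 0 R, x r ≠ 0)
    (hfl : radFlux n ((fun s => lam * s) ∘ x) R = 0) : 0 ≤ lam := by
  by_contra! hlam
  set k := (fun s => lam * s) ∘ x with hk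
  have hkc : Continuous k := (continuous_const.mul continuous_id).comp h.continuous
  -- Integration by parts: x v vanishes at 0 and at R, and its derivative r^n (Y² - λ x²) is
  -- nonnegative for λ < 0; so it is identically 0 and x vanishes.
  have hd : ∀ r ∈ Ioo 0 R, HasDerivAt (fun r => x r * radMom n k r)
      (r ^ n * (radFlux n k r ^ 2 - lam * x r ^ 2)) r := by
    intro r hr
    have h1 := h.hasDerivAt (Ioo_subset_Icc_self hr)
    rw [oddPow_two] at h1
    refine (h1.mul (hasDerivAt_radMom n hkc r)).congr_deriv ?_
    simp only [radMom, hk, Function.comp]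
    ring
  have hc : Continuous fun r => x r * radMom n k r := h.continuous.mul (continuous_radMom n hkc)
  have hmono : MonotoneOn (fun r => x r * radMom n k r) (Icc 0 R) := by
    refine monotoneOn_of_hasDerivWithinAt_nonneg (convex_Icc 0 R) hc.continuousOn
      (fun r hr => ?_) (fun r hr => ?_)
      (f' := fun r => r ^ n * (radFlux n k r ^ 2 - lam * x r ^ 2))
    · rw [interior_Icc] at hr
      exact (hd r hr).hasDerivWithinAt
    · rw [interior_Icc] at hr
      have := hr.1
      have h2 : 0 ≤ -lam * x r ^ 2 := mul_nonneg (by linarith) (sq_nonneg _)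
      exact mul_nonneg (by positivity) (by nlinarith [sq_nonneg (radFlux n k r)])
  have hzero : ∀ r ∈ Icc 0 R, x r * radMom n k r = 0 := by
    intro r hr
    have h1 := hmono ⟨le_rfl, hR.le⟩ hr hr.1
    have h2 := hmono hr ⟨hR.le, le_rfl⟩ hr.2
    simp only [radMom_at_zero, mul_zero] at h1
    have h3 : radMom n k R = 0 := by rw [radMom, hfl, mul_zero]
    simp only [h3, mul_zero] at h2
    exact le_antisymm h2 h1
  have hx0 : EqOn x (fun _ => 0) (Ioo 0 R) := by
    intro r hr
    have h1 : HasDerivAt (fun r => x r * radMom n k r) 0 r := by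
      refine (hasDerivAt_const r (0 : ℝ)).congr_of_eventuallyEq ?_
      filter_upwards [isOpen_Ioo.mem_nhds hr] with s hs
      exact hzero s (Ioo_subset_Icc_self hs)
    have h2 := (mul_eq_zero.1 ((hd r hr).unique h1)).resolve_left (pow_ne_zero n hr.1.ne')
    have h3 : 0 ≤ -lam * x r ^ 2 := mul_nonneg (by linarith) (sq_nonneg _)
    have h4 : -lam * x r ^ 2 = 0 := by nlinarith [sq_nonneg (radFlux n k r)]
    exact pow_eq_zero_iff two_ne_zero |>.1
      ((mul_eq_zero.1 h4).resolve_left (by linarith))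
  have hx1 := hx0.closure h.continuous continuous_const
  rw [closure_Ioo hR.ne] at hx1
  obtain ⟨r, hr, hr0⟩ := hx
  exact hr0 (hx1 hr)

lemma IsRadialSol.neg (h : IsRadialSol n 2 (fun s => lam * s) R x) :
    IsRadialSol n 2 (fun s => lam * s) R (fun r => -x r) where
  contDiff := h.contDiff.neg
  deriv_eq r hr := by
    have h1 := h.deriv_eq r hr
    rw [oddPow_two] at h1 ⊢
    have h2 : deriv (fun r => -x r) r = -deriv x r := deriv.fun_neg
    rw [h2, h1]
    simp [radFlux, radAvg]

lemma IsRadialSol.phase_ne_zero_linear (hlam : 0 < lam)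
    (h : IsRadialSol n 2 (fun s => lam * s) R x) (hx : x 0 ≠ 0) :
    ∀ r ∈ Icc 0 R, x r ≠ 0 ∨ radMom n ((fun s => lam * s) ∘ x) r ≠ 0 := fun _ hr =>
  IsRadialSol.phase_ne_zero one_lt_two (by fun_prop) (hasDerivAt_quadratic lam)
    (fun s => by positivity) (by simp) h (by positivity) hr

/-- The index of a nonnegative radial eigenvalue: its angle at `R` divided by `π`. -/
def HasIndex (n : ℕ) (R lam : ℝ) (i : ℕ) : Prop :=
  (lam = 0 ∧ i = 0) ∨ (0 < lam ∧ 1 ≤ i ∧ ∃ x, IsRadialSol n 2 (fun s => lam * s) R x ∧ x 0 < 0 ∧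
    phaseAngle n 2 (fun s => lam * s) x 1 R = i * Real.pi)

/-- For λ > 0 the energy forces x(0) ≠ 0, and a change of sign makes it negative. The Neumann
condition makes the angle at R a multiple of π, positive by strict monotonicity. -/
lemma exists_hasIndex (hR : 0 < R) (h : IsRadialEigenvalue (n + 1) 2 R lam) :
    ∃ i, HasIndex n R lam i := by
  obtain ⟨x, hx, hxne, hfl⟩ := exists_isRadialSol_of_eigenvalue hR h
  rcases (hx.nonneg_of_radFlux_eq_zero hR hxne hfl).eq_or_lt with h0 | hlam
  · exact ⟨0, Or.inl ⟨h0.symm, rfl⟩⟩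
  have hg : Continuous fun s : ℝ => lam * s := by fun_prop
  have hx0 : x 0 ≠ 0 := by
    intro hx0
    obtain ⟨r, hr, hr0⟩ := hxne
    have := hx.potential_le one_lt_two hg (hasDerivAt_quadratic lam) hr
    simp only [hx0] at this
    have h2 : 0 < lam / 2 * x r ^ 2 := by positivity
    linarith
  obtain ⟨y, hy, hy0, hyfl⟩ : ∃ y, IsRadialSol n 2 (fun s => lam * s) R y ∧ y 0 < 0 ∧
      radFlux n ((fun s => lam * s) ∘ y) R = 0 := by
    rcases hx0.lt_or_gt with h | h
    · exact ⟨x, hx, h, hfl⟩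
    · refine ⟨fun r => -x r, hx.neg, by linarith, ?_⟩
      have h1 : radFlux n ((fun s => lam * s) ∘ fun r => -x r) R =
          -radFlux n ((fun s => lam * s) ∘ x) R := by simp [radFlux, radAvg]
      rw [h1, hfl, neg_zero]
  have hne := hy.phase_ne_zero_linear hlam hy0.ne
  obtain ⟨ρ, hρ, -, h2⟩ := hy.polar one_lt_two hg one_pos hne hy0 ⟨hR.le, le_rfl⟩
  rw [radMom, hyfl, mul_zero, mul_zero, eq_comm, mul_eq_zero, or_iff_right hρ.ne',
    Real.sin_eq_zero_iff] at h2
  obtain ⟨i, hi⟩ := h2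
  have hpos : 0 < phaseAngle n 2 (fun s => lam * s) y 1 R := by
    have := hy.phaseAngle_strictMonoOn one_lt_two hg one_pos hne hR.le
      (fun r _ h0 => by
        have : 0 < lam * y r ^ 2 := by positivity
        linarith [show y r * (lam * y r) = lam * y r ^ 2 by ring])
      ⟨le_rfl, hR.le⟩ ⟨hR.le, le_rfl⟩ hR
    rwa [phaseAngle_zero] at this
  have hi0 : 0 < i := by
    rw [← hi] at hpos
    exact_mod_cast pos_of_mul_pos_left hpos Real.pi_pos.le
  lift i to ℕ using hi0.le
  exact ⟨i, Or.inr ⟨hlam, by exact_mod_cast hi0, y, hy, hy0, by rw [← hi]; push_cast; rfl⟩⟩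

end linear

/-! ### Sturm comparison -/

/-- A barrier argument gives δ ≥ 0. Then e^(Cr) δ is nondecreasing, with positive derivative near 0
where the source m is positive. -/
lemma pos_of_deriv_ge {δ δ' m : ℝ → ℝ} {C R : ℝ} (hR : 0 < R) (hC : 0 ≤ C)
    (hδ : ContinuousOn δ (Icc 0 R)) (hδ0 : δ 0 = 0) (hd : ∀ r ∈ Ioo 0 R, HasDerivAt δ (δ' r) r)
    (hge : ∀ r ∈ Ioo 0 R, m r - C * |δ r| ≤ δ' r) (hm : ∀ r ∈ Ioo 0 R, 0 ≤ m r)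
    (hm0 : ∀ᶠ r in 𝓝[>] 0, 0 < m r) : 0 < δ R := by
  have hnn : ∀ r ∈ Ioo 0 R, 0 ≤ δ r := by
    intro r hr
    by_contra! hneg
    -- Chosen so that the barrier ε e^((C+1)t) has the value -δ(r)/2 at t = r, below -δ(r). The
    -- comparison starts at some s > 0, since derivatives are known on the open interval only.
    set ε := -δ r / 2 * Real.exp (-((C + 1) * r)) with hε
    have hε0 : 0 < ε := mul_pos (by linarith) (Real.exp_pos _)
    have hev : ∀ᶠ s in 𝓝[>] (0 : ℝ), -ε < δ s := by
      have h1 : Tendsto δ (𝓝[>] 0) (𝓝 0) := by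
        have := (hδ 0 ⟨le_rfl, hR.le⟩).mono_left
          (nhdsWithin_le_of_mem (Icc_mem_nhdsGT hR))
        rwa [hδ0] at this
      exact h1.eventually (lt_mem_nhds (by linarith))
    obtain ⟨s, hs1, hs2⟩ := (hev.and (Ioo_mem_nhdsGT hr.1)).exists
    have hsub : Icc s r ⊆ Icc 0 R := Icc_subset_Icc hs2.1.le hr.2.le
    have key := image_le_of_deriv_right_lt_deriv_boundary (f := fun t => -δ t)
      (f' := fun t => -δ' t) (a := s) (b := r) (B := fun t => ε * Real.exp ((C + 1) * t))
      (B' := fun t => ε * (Real.exp ((C + 1) * t) * (C + 1))) (hδ.mono hsub).neg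
      (fun t ht => (hd t ⟨hs2.1.trans_le ht.1, ht.2.trans hr.2⟩).neg.hasDerivWithinAt) ?_ ?_ ?_
      (x := r) ⟨hs2.2.le, le_rfl⟩
    · rw [hε, mul_assoc, ← Real.exp_add, neg_add_cancel, Real.exp_zero] at key
      linarith
    · have h1 : 1 ≤ Real.exp ((C + 1) * s) :=
        Real.one_le_exp (mul_nonneg (by linarith) hs2.1.le)
      nlinarith
    · intro t
      have h1 : HasDerivAt (fun t => (C + 1) * t) (C + 1) t := by
        have := (hasDerivAt_id t).const_mul (C + 1)
        rwa [mul_one] at this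
      exact h1.exp.const_mul ε
    · intro t ht hteq
      have ht' : t ∈ Ioo 0 R := ⟨hs2.1.trans_le ht.1, ht.2.trans hr.2⟩
      have hpos : 0 < ε * Real.exp ((C + 1) * t) := by positivity
      have h1 := hge t ht'
      have h2 := hm t ht'
      have h3 : |δ t| = ε * Real.exp ((C + 1) * t) := by
        rw [← hteq, abs_of_neg (by linarith)]
      rw [h3] at h1
      nlinarith
  have hexp : ∀ r ∈ Ioo 0 R, HasDerivAt (fun r => Real.exp (C * r) * δ r)
      (Real.exp (C * r) * C * δ r + Real.exp (C * r) * δ' r) r := by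
    intro r hr
    have h1 : HasDerivAt (fun t => C * t) C r := by
      have := (hasDerivAt_id r).const_mul C
      rwa [mul_one] at this
    exact h1.exp.mul (hd r hr)
  have hcont : ContinuousOn (fun r => Real.exp (C * r) * δ r) (Icc 0 R) :=
    ContinuousOn.mul (by fun_prop) hδ
  have hlow : ∀ r ∈ Ioo 0 R, Real.exp (C * r) * m r ≤
      Real.exp (C * r) * C * δ r + Real.exp (C * r) * δ' r := by
    intro r hr
    have h1 := hge r hr
    rw [abs_of_nonneg (hnn r hr)] at h1
    have := Real.exp_pos (C * r)
    nlinarith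
  obtain ⟨ε, hε, hε'⟩ := mem_nhdsGT_iff_exists_Ioo_subset.1 hm0
  have hε0 : (0 : ℝ) < ε := hε
  set s := min ε R with hs
  have hs0 : 0 < s := lt_min hε0 hR
  obtain ⟨t, ht, ht'⟩ := exists_hasDerivAt_eq_slope _ _ hs0
    (hcont.mono (Icc_subset_Icc le_rfl (min_le_right _ _)))
    (fun r hr => hexp r ⟨hr.1, hr.2.trans_le (min_le_right _ _)⟩)
  have htR : t ∈ Ioo 0 R := ⟨ht.1, ht.2.trans_le (min_le_right _ _)⟩
  have h1 : 0 < Real.exp (C * t) * m t :=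
    mul_pos (Real.exp_pos _) (hε' ⟨ht.1, ht.2.trans_le (min_le_left _ _)⟩)
  have h2 := h1.trans_le (hlow t htR)
  rw [ht', hδ0, mul_zero, sub_zero, sub_zero] at h2
  have h3 : 0 < Real.exp (C * s) * δ s := by
    have := mul_pos h2 hs0
    rwa [div_mul_cancel₀ _ hs0.ne'] at this
  have hmono : MonotoneOn (fun r => Real.exp (C * r) * δ r) (Icc 0 R) := by
    refine monotoneOn_of_hasDerivWithinAt_nonneg (convex_Icc 0 R) hcont
      (fun r hr => ?_) (fun r hr => ?_)
      (f' := fun r => Real.exp (C * r) * C * δ r + Real.exp (C * r) * δ' r)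
    · rw [interior_Icc] at hr
      exact (hexp r hr).hasDerivWithinAt
    · rw [interior_Icc] at hr
      exact (mul_nonneg (Real.exp_pos _).le (hm r hr)).trans (hlow r hr)
  have h4 := h3.trans_le (hmono ⟨hs0.le, min_le_right _ _⟩ ⟨hR.le, le_rfl⟩ (min_le_right _ _))
  exact pos_of_mul_pos_right h4 (Real.exp_pos _).le

/-- Sturm comparison for the angles of two radial equations with `a = 2`. -/
lemma phaseAngle_lt_phaseAngle {n : ℕ} {R lam μ : ℝ} {g₁ g₂ x₁ x₂ : ℝ → ℝ} (hR : 0 < R)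
    (hg₁ : Continuous g₁) (hg₂ : Continuous g₂) (h₁ : IsRadialSol n 2 g₁ R x₁)
    (h₂ : IsRadialSol n 2 g₂ R x₂)
    (hne₁ : ∀ r ∈ Icc 0 R, x₁ r ≠ 0 ∨ radMom n (g₁ ∘ x₁) r ≠ 0)
    (hne₂ : ∀ r ∈ Icc 0 R, x₂ r ≠ 0 ∨ radMom n (g₂ ∘ x₂) r ≠ 0)
    (hx₁ : x₁ 0 < 0) (hx₂ : x₂ 0 < 0)
    (hle : ∀ r ∈ Icc 0 R, x₁ r * g₁ (x₁ r) ≤ lam * x₁ r ^ 2)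
    (hge : ∀ r ∈ Icc 0 R, μ * x₂ r ^ 2 ≤ x₂ r * g₂ (x₂ r)) (hlt : lam < μ) :
    phaseAngle n 2 g₁ x₁ 1 R < phaseAngle n 2 g₂ x₂ 1 R := by
  -- the sine of the angle is `O(r^n)`
  have hK : ∀ {g x : ℝ → ℝ}, Continuous g → (h : IsRadialSol n 2 g R x) →
      (∀ r ∈ Icc 0 R, x r ≠ 0 ∨ radMom n (g ∘ x) r ≠ 0) → x 0 < 0 →
      ∃ K, 0 ≤ K ∧ ∀ r ∈ Ioo 0 R, ∃ c, |c| ≤ K ∧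
        Real.sin (phaseAngle n 2 g x 1 r) = r ^ n * c ∧
        Real.cos (phaseAngle n 2 g x 1 r) ^ 2 = x r ^ 2 / (x r ^ 2 + radMom n (g ∘ x) r ^ 2) ∧
        c ^ 2 = radFlux n (g ∘ x) r ^ 2 / (x r ^ 2 + radMom n (g ∘ x) r ^ 2) := by
    intro g x hg h hne hx
    have hgx := hg.comp h.continuous
    have hfc := continuous_radFlux n hgx
    have hmc := continuous_radMom n hgx
    have hsq : Continuous fun r => Real.sqrt (x r ^ 2 + radMom n (g ∘ x) r ^ 2) :=
      ((h.continuous.pow 2).add (hmc.pow 2)).sqrt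
    obtain ⟨K, hK⟩ := (isCompact_Icc (a := 0) (b := R)).exists_bound_of_continuousOn
      (f := fun r => radFlux n (g ∘ x) r / Real.sqrt (x r ^ 2 + radMom n (g ∘ x) r ^ 2))
      (hfc.continuousOn.div hsq.continuousOn fun r hr =>
        (Real.sqrt_pos.2 (phase_sq_pos (hne r hr))).ne')
    refine ⟨K, (norm_nonneg _).trans (hK 0 ⟨le_rfl, hR.le⟩), fun r hr => ?_⟩
    have hr' := Ioo_subset_Icc_self hr
    obtain ⟨ρ, hρ, hx1, hy1⟩ := h.polar one_lt_two hg one_pos hne hx hr'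
    rw [one_mul] at hy1
    have hρ2 : x r ^ 2 + radMom n (g ∘ x) r ^ 2 = ρ ^ 2 := by
      rw [hy1]
      nth_rewrite 1 [hx1]
      linear_combination ρ ^ 2 * Real.sin_sq_add_cos_sq (phaseAngle n 2 g x 1 r)
    have hb := hK r hr'
    rw [hρ2, Real.sqrt_sq hρ.le] at hb
    refine ⟨_, hb, ?_, ?_, ?_⟩
    · rw [← mul_div_assoc, ← radMom, hy1, mul_div_cancel_left₀ _ hρ.ne']
    · rw [hρ2]
      nth_rewrite 1 [hx1]
      field_simp
    · rw [hρ2, div_pow]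
  obtain ⟨K₁, hK₁, H₁⟩ := hK hg₁ h₁ hne₁ hx₁
  obtain ⟨K₂, hK₂, H₂⟩ := hK hg₂ h₂ hne₂ hx₂
  set Θ₁ := phaseAngle n 2 g₁ x₁ 1 with hΘ₁
  set Θ₂ := phaseAngle n 2 g₂ x₂ 1 with hΘ₂
  have hc₁ := h₁.continuousOn_phaseAngle one_lt_two hg₁ one_pos hne₁ hR.le
  have hc₂ := h₂.continuousOn_phaseAngle one_lt_two hg₂ one_pos hne₂ hR.le
  -- Each angle has speed r^n (c² + (x g(x)/x²) cos²Θ) where x ≠ 0, with r^n c = sin Θ. The first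
  -- term is sin²Θ / r^n, singular at 0; since c is bounded by K it is nevertheless controlled by a
  -- Lipschitz bound in Θ, and the gap μ - lam supplies the source.
  have hpos := pos_of_deriv_ge (δ := fun r => Θ₂ r - Θ₁ r)
    (δ' := fun r => _) (m := fun r => (μ - lam) * r ^ n * Real.cos (Θ₁ r) ^ 2)
    (C := K₁ + K₂ + 2 * |μ| * R ^ n) hR (by positivity) (hc₂.sub hc₁) (by simp [hΘ₁, hΘ₂])
    (fun r hr => (h₂.hasDerivAt_phaseAngle one_lt_two hg₂ one_pos hne₂ hr).sub
      (h₁.hasDerivAt_phaseAngle one_lt_two hg₁ one_pos hne₁ hr)) ?_ ?_ ?_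
  · linarith
  · intro r hr
    have hr' := Ioo_subset_Icc_self hr
    have hr0 := hr.1
    obtain ⟨c₁, hb₁, hs₁, hcos₁, hq₁⟩ := H₁ r hr
    obtain ⟨c₂, hb₂, hs₂, hcos₂, hq₂⟩ := H₂ r hr
    have hD₁ := phase_sq_pos (hne₁ r hr')
    have hD₂ := phase_sq_pos (hne₂ r hr')
    simp only [one_mul, Real.rpow_two, sq_abs]
    have e₁ : r ^ n * (radFlux n (g₁ ∘ x₁) r ^ 2 + x₁ r * g₁ (x₁ r)) /
        (x₁ r ^ 2 + radMom n (g₁ ∘ x₁) r ^ 2) ≤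
        r ^ n * c₁ ^ 2 + lam * r ^ n * Real.cos (Θ₁ r) ^ 2 := by
      rw [hcos₁, hq₁, div_le_iff₀ hD₁, add_mul, mul_assoc, div_mul_cancel₀ _ hD₁.ne', mul_assoc,
        div_mul_cancel₀ _ hD₁.ne']
      have := mul_le_mul_of_nonneg_left (hle r hr') (by positivity : 0 ≤ r ^ n)
      linarith
    have e₂ : r ^ n * c₂ ^ 2 + μ * r ^ n * Real.cos (Θ₂ r) ^ 2 ≤
        r ^ n * (radFlux n (g₂ ∘ x₂) r ^ 2 + x₂ r * g₂ (x₂ r)) /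
        (x₂ r ^ 2 + radMom n (g₂ ∘ x₂) r ^ 2) := by
      rw [hcos₂, hq₂, le_div_iff₀ hD₂, add_mul, mul_assoc, div_mul_cancel₀ _ hD₂.ne', mul_assoc,
        div_mul_cancel₀ _ hD₂.ne']
      have := mul_le_mul_of_nonneg_left (hge r hr') (by positivity : 0 ≤ r ^ n)
      linarith
    have hsin : |Real.sin (Θ₂ r) - Real.sin (Θ₁ r)| ≤ |Θ₂ r - Θ₁ r| := by
      simpa using Real.abs_sin_sub_sin_le (Θ₂ r) (Θ₁ r)
    have hcos : |Real.cos (Θ₂ r) - Real.cos (Θ₁ r)| ≤ |Θ₂ r - Θ₁ r| := by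
      simpa using Real.abs_cos_sub_cos_le (Θ₂ r) (Θ₁ r)
    -- the two error terms
    have t₁ : -((K₁ + K₂) * |Θ₂ r - Θ₁ r|) ≤ r ^ n * c₂ ^ 2 - r ^ n * c₁ ^ 2 := by
      have h1 : r ^ n * c₂ ^ 2 - r ^ n * c₁ ^ 2 =
          (c₂ + c₁) * (Real.sin (Θ₂ r) - Real.sin (Θ₁ r)) := by
        rw [hs₁, hs₂]
        ring
      rw [h1]
      refine (neg_le_neg ?_).trans (neg_abs_le _)
      rw [abs_mul]
      exact mul_le_mul ((abs_add_le _ _).trans (by linarith)) hsin (abs_nonneg _) (by positivity)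
    have t₂ : -(2 * |μ| * R ^ n * |Θ₂ r - Θ₁ r|) ≤
        μ * r ^ n * Real.cos (Θ₂ r) ^ 2 - μ * r ^ n * Real.cos (Θ₁ r) ^ 2 := by
      have h1 : μ * r ^ n * Real.cos (Θ₂ r) ^ 2 - μ * r ^ n * Real.cos (Θ₁ r) ^ 2 =
          (μ * r ^ n * (Real.cos (Θ₂ r) + Real.cos (Θ₁ r))) *
          (Real.cos (Θ₂ r) - Real.cos (Θ₁ r)) := by ring
      rw [h1]
      refine (neg_le_neg ?_).trans (neg_abs_le _)
      rw [abs_mul]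
      refine mul_le_mul ?_ hcos (abs_nonneg _) (by positivity)
      rw [abs_mul, abs_mul, abs_of_nonneg (by positivity : 0 ≤ r ^ n)]
      have h2 : |Real.cos (Θ₂ r) + Real.cos (Θ₁ r)| ≤ 2 := by
        refine (abs_add_le _ _).trans ?_
        linarith [Real.abs_cos_le_one (Θ₂ r), Real.abs_cos_le_one (Θ₁ r)]
      have h3 : r ^ n ≤ R ^ n := pow_le_pow_left₀ hr0.le hr.2.le n
      calc |μ| * r ^ n * |Real.cos (Θ₂ r) + Real.cos (Θ₁ r)| ≤ |μ| * R ^ n * 2 :=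
            mul_le_mul (mul_le_mul_of_nonneg_left h3 (abs_nonneg _)) h2 (abs_nonneg _)
              (by positivity)
        _ = 2 * |μ| * R ^ n := by ring
    linarith
  · intro r hr
    have := hr.1
    have := sub_pos.2 hlt
    positivity
  · have hev : ∀ᶠ r in 𝓝[>] (0 : ℝ), x₁ r < 0 :=
      (h₁.continuous.continuousAt.eventually (gt_mem_nhds hx₁)).filter_mono nhdsWithin_le_nhds
    filter_upwards [hev, Ioo_mem_nhdsGT hR] with r hxr hr
    obtain ⟨ρ, hρ, hx1, -⟩ :=
      h₁.polar one_lt_two hg₁ one_pos hne₁ hx₁ (Ioo_subset_Icc_self hr)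
    have hcos : Real.cos (Θ₁ r) ≠ 0 := by
      intro h0
      rw [← hΘ₁, h0, mul_zero, neg_zero] at hx1
      exact hxr.ne hx1
    have := hr.1
    have := sub_pos.2 hlt
    positivity

/-- Sturm comparison of the two eigenfunctions; it applies to any choice of index, so none needs to
be unique beforehand. -/
lemma HasIndex.lt {n : ℕ} {R lam μ : ℝ} {i j : ℕ} (hR : 0 < R) (hi : HasIndex n R lam i)
    (hj : HasIndex n R μ j) (hlt : lam < μ) : i < j := by
  rcases hj with ⟨rfl, -⟩ | ⟨hμ, hj1, y, hy, hy0, hyj⟩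
  · rcases hi with ⟨rfl, -⟩ | ⟨hlam, -⟩
    · exact absurd hlt (lt_irrefl _)
    · exact absurd hlt hlam.not_gt
  rcases hi with ⟨-, rfl⟩ | ⟨hlam, -, x, hx, hx0, hxi⟩
  · omega
  have h := phaseAngle_lt_phaseAngle (lam := lam) (μ := μ) hR (by fun_prop) (by fun_prop) hx hy
    (hx.phase_ne_zero_linear hlam hx0.ne) (hy.phase_ne_zero_linear hμ hy0.ne) hx0 hy0
    (fun r _ => le_of_eq (by ring)) (fun r _ => le_of_eq (by ring)) hlt
  rw [hxi, hyj] at h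
  exact_mod_cast lt_of_mul_lt_mul_right h Real.pi_pos.le

/-- The `(k+1)`-st radial eigenvalue of the Laplacian is positive and its eigenfunction has angle at
least `k π`. -/
lemma exists_index_ge {n : ℕ} {R lam : ℝ} {k : ℕ} (hR : 0 < R) (hk : 1 ≤ k)
    (h : IsKthRadialEigenvalue (n + 1) 2 R (k + 1) lam) :
    ∃ i, k ≤ i ∧ 0 < lam ∧ ∃ x, IsRadialSol n 2 (fun s => lam * s) R x ∧ x 0 < 0 ∧
      phaseAngle n 2 (fun s => lam * s) x 1 R = i * Real.pi := by
  obtain ⟨heig, hcard⟩ := h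
  set T := {μ : ℝ | IsRadialEigenvalue (n + 1) 2 R μ ∧ μ < lam} with hT
  have hTk : T.encard = k := by
    have : T.encard + 1 = (k : ℕ∞) + 1 := by rw [hcard]; push_cast; rfl
    exact (ENat.add_left_injective_of_ne_top ENat.one_ne_top) this
  obtain ⟨i, hi⟩ := exists_hasIndex hR heig
  have hex : ∀ μ : ℝ, ∃ j, μ ∈ T → HasIndex n R μ j := by
    intro μ
    by_cases hμ : μ ∈ T
    · obtain ⟨j, hj⟩ := exists_hasIndex hR hμ.1
      exact ⟨j, fun _ => hj⟩
    · exact ⟨0, fun h => absurd h hμ⟩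
  choose J hJ using hex
  -- The indices embed the k smaller eigenvalues into {0, ..., i - 1}, whence k ≤ i.
  have hmaps : MapsTo J T (Finset.range i : Set ℕ) := fun μ hμ => by
    simpa using (hJ μ hμ).lt hR hi hμ.2
  have hinj : InjOn J T := by
    intro μ hμ ν hν hμν
    by_contra hne
    rcases lt_or_gt_of_ne hne with hlt | hlt
    · exact ((hJ μ hμ).lt hR (hJ ν hν) hlt).ne hμν
    · exact ((hJ ν hν).lt hR (hJ μ hμ) hlt).ne' hμν
  have hki : k ≤ i := by
    have h1 := encard_le_encard_of_injOn hmaps hinj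
    rw [hTk, encard_coe_eq_coe_finsetCard, Finset.card_range] at h1
    exact_mod_cast h1
  rcases hi with ⟨-, rfl⟩ | ⟨hlam, -, x, hx, hx0, hxi⟩
  · omega
  · exact ⟨i, hki, hlam, x, hx, hx0, hxi⟩

/-! ### Solutions with a prescribed number of half turns -/

/-- For `p = 2` and `lam < q - 2`, truncated solutions starting near `0` turn more than solutions of
the linear equation. -/
lemma exists_phaseAngle_lt_of_near_zero_two {n : ℕ} {q R lam : ℝ} {y : ℝ → ℝ} (hq : 2 < q)
    (hR : 0 < R) (hlam : 0 < lam) (hlq : lam < q - 2)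
    (hy : IsRadialSol n 2 (fun s => lam * s) R y) (hy0 : y 0 < 0) :
    ∃ η > 0, ∀ x : ℝ → ℝ, IsTruncSol n 2 q R x → x 0 ∈ Ioo (-1) 0 → -(x 0) < η →
      phaseAngle n 2 (fun s => lam * s) y 1 R <
        phaseAngle n (conjExp 2) (truncNonlin 2 q) x 1 R := by
  have hM := one_lt_topValue one_lt_two hq
  obtain ⟨μ, hμ1, hμ2⟩ := exists_between hlq
  obtain ⟨η, hη, hη'⟩ := exists_mul_truncNonlin_ge one_lt_two hq hμ2
  obtain ⟨k₁, hk₁, k₂, hk₂, H⟩ := exists_quadratic_bounds one_lt_two hq (δ := 1 / 2)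
    (by norm_num) (by norm_num)
  have hlim : Tendsto (fun t : ℝ => k₂ / k₁ * t ^ 2) (𝓝 0) (𝓝 0) := by
    have : Continuous fun t : ℝ => k₂ / k₁ * t ^ 2 := by fun_prop
    simpa using this.tendsto 0
  obtain ⟨ε, hε, hε'⟩ := Metric.eventually_nhds_iff.1
    (hlim.eventually (gt_mem_nhds (pow_pos hη 2)))
  refine ⟨min ε (1 / 2), lt_min hε (by norm_num), fun x h hx hxε => ?_⟩
  have hne := IsTruncSol.phase_ne_zero one_lt_two hq h hx
  have hx1 : -(1 / 2) ≤ x 0 := by linarith [hxε.trans_le (min_le_right _ _)]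
  -- The energy gives k₁ x(r)² ≤ k₂ x(0)², so the solution stays where g dominates the line of slope
  -- μ.
  have hsmall : ∀ r ∈ Icc 0 R, |x r| ≤ η := by
    intro r hr
    have hm := IsTruncSol.mem_Icc one_lt_two hq h hx hr
    have h1 := (H (x r) ⟨by linarith [hm.1], hm.2⟩).2.1
    have h2 := (H (x 0) ⟨by linarith, by linarith [hx.2]⟩).2.2
    have h3 := IsRadialSol.potential_le (one_lt_conjExp one_lt_two)
      (continuous_truncNonlin one_lt_two hq) (hasDerivAt_potential one_lt_two hq) h hr
    have h4 : k₂ / k₁ * (x 0) ^ 2 < η ^ 2 := hε' (by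
      rw [Real.dist_eq, sub_zero, abs_of_neg hx.2]
      exact hxε.trans_le (min_le_left _ _))
    have h5 : x r ^ 2 ≤ k₂ / k₁ * (x 0) ^ 2 := by
      rw [div_mul_eq_mul_div, le_div_iff₀ hk₁]
      linarith
    exact abs_le_of_sq_le_sq (h5.trans h4.le) hη.le
  have hsol : IsRadialSol n 2 (truncNonlin 2 q) R x := by
    have := h
    rwa [IsTruncSol, conjExp_two] at this
  rw [conjExp_two]
  exact phaseAngle_lt_phaseAngle (lam := lam) (μ := μ) hR (by fun_prop)
    (continuous_truncNonlin one_lt_two hq) hy hsol (hy.phase_ne_zero_linear hlam hy0.ne) hne hy0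
    hx.2 (fun r _ => le_of_eq (by ring)) (fun r hr => hη' _ (hsmall r hr)) hμ1

/-- The exclusion of B holds since every solution from B exceeds τ; it separates the two families of
solutions when p < 2. -/
lemma exists_isTruncSol {p q R : ℝ} (n : ℕ) (hp : 1 < p) (hpq : p < q) (hR : 0 ≤ R) {A B τ : ℝ}
    (hA : A ∈ Ioo (-1) 0) (hB : B ∈ Ioo (-1) 0)
    (hAlt : ∀ x, IsTruncSol n p q R x → x 0 = A →
      phaseAngle n (conjExp p) (truncNonlin p q) x 1 R < τ)
    (hBgt : ∀ x, IsTruncSol n p q R x → x 0 = B →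
      τ < phaseAngle n (conjExp p) (truncNonlin p q) x 1 R) :
    ∃ x, IsTruncSol n p q R x ∧ x 0 ∈ uIcc A B ∧ x 0 ∈ Ioo (-1) 0 ∧ x 0 ≠ B ∧
      phaseAngle n (conjExp p) (truncNonlin p q) x 1 R = τ := by
  obtain ⟨M, hM⟩ := exists_abs_truncNonlin_le hp hpq
  have hsub : uIcc A B ⊆ Ioo (-1) 0 := ordConnected_Ioo.uIcc_subset hA hB
  obtain ⟨x, hx, hx0, hxτ⟩ := exists_isRadialSol_phaseAngle_eq (n := n) (one_lt_conjExp hp)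
    (uniformContinuous_truncNonlin hp hpq) hM hR
    (fun x hx hx0 => IsTruncSol.phase_ne_zero hp hpq hx (hsub hx0)) hAlt hBgt
  exact ⟨x, hx, hx0, hsub hx0, fun h => (hBgt x hx h).ne' hxτ, hxτ⟩

lemma pi_div_two_lt {j : ℕ} (hj : 1 ≤ j) : Real.pi / 2 < j * Real.pi := by
  have h1 : (1 : ℝ) ≤ j := by exact_mod_cast hj
  nlinarith [Real.pi_pos]

/-- If solutions starting near `0` turn more than `j` half turns, some solution makes exactly `j`
half turns. -/
lemma exists_isTruncSol_of_near_zero {p q R : ℝ} {n j : ℕ} (hp : 1 < p) (hpq : p < q) (hR : 0 < R)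
    (hj : 1 ≤ j)
    (h : ∃ η > 0, ∀ x : ℝ → ℝ, IsTruncSol n p q R x → x 0 ∈ Ioo (-1) 0 → -(x 0) < η →
      j * Real.pi < phaseAngle n (conjExp p) (truncNonlin p q) x 1 R) :
    ∃ u : RN (n + 1) → ℝ, IsNonconstantRadialSolution p (fun s : ℝ => s ^ (q - 1)) R u ∧
      (zeroRadii R u).encard = j := by
  obtain ⟨d, hd, Hd⟩ := IsTruncSol.exists_phaseAngle_lt_of_near_bot hp hpq hR.le
  obtain ⟨η, hη, Hη⟩ := h
  have hd' : 0 < min d (1 / 2) := lt_min hd (by norm_num)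
  have hη' : 0 < min (η / 2) (1 / 2) := lt_min (half_pos hη) (by norm_num)
  have hA : min d (1 / 2) - 1 ∈ Ioo (-1 : ℝ) 0 :=
    ⟨by linarith, by linarith [min_le_right d (1 / 2)]⟩
  have hB : -min (η / 2) (1 / 2) ∈ Ioo (-1 : ℝ) 0 :=
    ⟨by linarith [min_le_right (η / 2) (1 / 2)], by linarith⟩
  obtain ⟨x, hx, -, hx0, -, hxj⟩ := exists_isTruncSol n hp hpq hR.le hA hB (τ := j * Real.pi)
    (fun x hx h0 => (Hd n x hx (h0 ▸ hA) (by rw [h0]; linarith [min_le_left d (1 / 2)])).trans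
      (pi_div_two_lt hj))
    (fun x hx h0 => Hη x hx (h0 ▸ hB) (by rw [h0]; linarith [min_le_left (η / 2) (1 / 2)]))
  exact ⟨_, IsTruncSol.isNonconstantRadialSolution hp hpq hR hx hx0 hj hxj⟩

/-- For `p < 2` and large `R` there are two solutions with `j` half turns, told apart by their
values at the origin. -/
lemma exists_isTruncSol_pair {p q : ℝ} (n k : ℕ) (hp : 1 < p) (hpq : p < q) (hp2 : p < 2) :
    ∃ x₀ : ℝ, ∃ R₀ > 0, ∀ R > R₀, ∀ b : Bool, ∀ j ∈ Icc 1 k, ∃ x, IsTruncSol n p q R x ∧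
      x 0 ∈ Ioo (-1) 0 ∧ (b = true ↔ x₀ < x 0) ∧
      phaseAngle n (conjExp p) (truncNonlin p q) x 1 R = j * Real.pi := by
  obtain ⟨x₀, hx₀, R₀, hR₀, H⟩ :=
    IsTruncSol.exists_lt_phaseAngle_of_large n hp hpq hp2 (k * Real.pi)
  refine ⟨x₀, R₀, hR₀, fun R hR b j hj => ?_⟩
  have hR0 : 0 < R := hR₀.trans hR
  have hB : ∀ x, IsTruncSol n p q R x → x 0 = x₀ →
      j * Real.pi < phaseAngle n (conjExp p) (truncNonlin p q) x 1 R := fun x hx h0 =>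
    (mul_le_mul_of_nonneg_right (by exact_mod_cast hj.2) Real.pi_pos.le).trans_lt
      (H R hR.le x hx h0)
  -- Shooting between x₀ and a value near -1 gives one family, between x₀ and a value near 0 the
  -- other.
  cases b
  · obtain ⟨d, hd, Hd⟩ := IsTruncSol.exists_phaseAngle_lt_of_near_bot hp hpq hR0.le
    have hd' : 0 < min d (1 + x₀) := lt_min hd (by linarith [hx₀.1])
    have hle : min d (1 + x₀) - 1 ≤ x₀ := by linarith [min_le_right d (1 + x₀)]
    have hA : min d (1 + x₀) - 1 ∈ Ioo (-1 : ℝ) 0 := ⟨by linarith, by linarith [hx₀.2]⟩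
    obtain ⟨x, hx, hxu, hx0, -, hxj⟩ := exists_isTruncSol n hp hpq hR0.le hA hx₀ (τ := j * Real.pi)
      (fun x hx h0 => (Hd n x hx (h0 ▸ hA) (by rw [h0]; linarith [min_le_left d (1 + x₀)])).trans
        (pi_div_two_lt hj.1)) hB
    rw [uIcc_of_le hle] at hxu
    exact ⟨x, hx, hx0, by simpa using hxu.2, hxj⟩
  · obtain ⟨η, hη, Hη⟩ := IsTruncSol.exists_phaseAngle_lt_of_near_zero hp hpq hp2 hR0
    have hη' : 0 < min (η / 2) (-x₀) := lt_min (half_pos hη) (by linarith [hx₀.2])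
    have hle : x₀ ≤ -min (η / 2) (-x₀) := by linarith [min_le_right (η / 2) (-x₀)]
    have hA : -min (η / 2) (-x₀) ∈ Ioo (-1 : ℝ) 0 := ⟨by linarith [hx₀.1], by linarith⟩
    obtain ⟨x, hx, hxu, hx0, hne, hxj⟩ :=
      exists_isTruncSol n hp hpq hR0.le hA hx₀ (τ := j * Real.pi)
      (fun x hx h0 => (Hη n x hx (h0 ▸ hA) (by
        rw [h0]
        linarith [min_le_left (η / 2) (-x₀)])).trans (pi_div_two_lt hj.1)) hB
    rw [uIcc_of_ge hle] at hxu
    exact ⟨x, hx, hx0, by simpa using lt_of_le_of_ne hxu.1 hne.symm, hxj⟩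

lemma zeroRadii_congr {N : ℕ} {R : ℝ} {u v : RN N → ℝ}
    (h : (closedBall (0 : RN N) R).domRestrict u = (closedBall (0 : RN N) R).domRestrict v) :
    zeroRadii R u = zeroRadii R v := by
  have huv : ∀ z : RN N, ‖z‖ ≤ R → u z = v z := fun z hz =>
    congrFun h ⟨z, mem_closedBall_zero_iff.2 hz⟩
  ext r
  refine and_congr_right fun hr => exists_congr fun z => and_congr_right fun hz => ?_
  rw [huv z (hz.trans_le hr.2)]

end

end RadialShooting

/-! ### The three regimes of p -/

theorem corollary1p3 (N : ℕ) (hN : 1 ≤ N) (p q : ℝ) (hp : 1 < p) (hpq : p < q) :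
    (p = 2 → ∀ R : ℝ, 0 < R → ∀ k : ℕ, 1 ≤ k →
      ∀ lam : ℝ, IsKthRadialEigenvalue N p R (k + 1) lam → q - 2 > lam →
      ∃ u : ℕ → RN N → ℝ,
        Set.InjOn (fun j : ℕ => (Metric.closedBall (0 : RN N) R).domRestrict (u j)) (Set.Icc 1 k) ∧
        ∀ j ∈ Set.Icc 1 k,
          IsNonconstantRadialSolution p (fun s : ℝ => s ^ (q - 1)) R (u j) ∧
          (zeroRadii R (u j)).encard = (j : ℕ∞)) ∧
    (2 < p → ∀ R : ℝ, 0 < R →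
      Set.Infinite ((Metric.closedBall (0 : RN N) R).domRestrict ''
        {u : RN N → ℝ | IsNonconstantRadialSolution p (fun s : ℝ => s ^ (q - 1)) R u})) ∧
    (p < 2 → ∀ k : ℕ, 1 ≤ k → ∃ Rstar : ℝ, 0 < Rstar ∧ ∀ R : ℝ, Rstar < R →
      ∃ u : Bool → ℕ → RN N → ℝ,
        Set.InjOn
          (fun i : Bool × ℕ => (Metric.closedBall (0 : RN N) R).domRestrict (u i.1 i.2))
          (Set.univ ×ˢ Set.Icc 1 k) ∧
        ∀ s : Bool, ∀ j ∈ Set.Icc 1 k,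
          IsNonconstantRadialSolution p (fun t : ℝ => t ^ (q - 1)) R (u s j) ∧
          (zeroRadii R (u s j)).encard = (j : ℕ∞)) := by
  obtain ⟨n, rfl⟩ : ∃ n, N = n + 1 := ⟨N - 1, by omega⟩
  refine ⟨?_, ?_, ?_⟩
  · rintro rfl R hR k hk lam hlam hq
    obtain ⟨i, hki, hlam0, y, hy, hy0, hyi⟩ := RadialShooting.exists_index_ge hR hk hlam
    have hex : ∀ j ∈ Set.Icc 1 k, ∃ u : RN (n + 1) → ℝ,
        IsNonconstantRadialSolution 2 (fun s : ℝ => s ^ (q - 1)) R u ∧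
        (zeroRadii R u).encard = j := by
      intro j hj
      obtain ⟨η, hη, H⟩ :=
        RadialShooting.exists_phaseAngle_lt_of_near_zero_two hpq hR hlam0 hq hy hy0
      refine RadialShooting.exists_isTruncSol_of_near_zero hp hpq hR hj.1
        ⟨η, hη, fun x hx hx0 hxη => lt_of_le_of_lt ?_ (H x hx hx0 hxη)⟩
      rw [hyi]
      exact mul_le_mul_of_nonneg_right (by exact_mod_cast hj.2.trans hki) Real.pi_pos.le
    choose! u hu using hex
    refine ⟨u, fun i hi j hj hij => ?_, hu⟩
    have h1 := (hu i hi).2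
    rw [RadialShooting.zeroRadii_congr hij, (hu j hj).2] at h1
    exact_mod_cast h1.symm
  · intro hp2 R hR
    have hex : ∀ j : ℕ, ∃ u : RN (n + 1) → ℝ,
        IsNonconstantRadialSolution p (fun s : ℝ => s ^ (q - 1)) R u ∧
        (zeroRadii R u).encard = (j + 1 : ℕ) := fun j =>
      RadialShooting.exists_isTruncSol_of_near_zero hp hpq hR (by omega)
        (RadialShooting.IsTruncSol.exists_lt_phaseAngle_of_near_zero n hp hpq hp2 hR _)
    choose u hu using hex
    refine Set.infinite_of_injective_forall_mem
      (f := fun j => (Metric.closedBall (0 : RN (n + 1)) R).domRestrict (u j)) (fun i j hij => ?_)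
      fun j => Set.mem_image_of_mem _ (hu j).1
    have h1 := (hu i).2
    rw [RadialShooting.zeroRadii_congr hij, (hu j).2] at h1
    have h2 : j + 1 = i + 1 := by exact_mod_cast h1
    omega
  · intro hp2 k hk
    obtain ⟨x₀, R₀, hR₀, H⟩ := RadialShooting.exists_isTruncSol_pair n k hp hpq hp2
    refine ⟨R₀, hR₀, fun R hR => ?_⟩
    have hR0 : 0 < R := hR₀.trans hR
    choose! x hx using H R hR
    have hsol : ∀ b, ∀ j ∈ Set.Icc 1 k, _ := fun b j hj =>
      RadialShooting.IsTruncSol.isNonconstantRadialSolution hp hpq hR0 (hx b j hj).1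
        (hx b j hj).2.1 hj.1 (hx b j hj).2.2.2
    refine ⟨fun b j z => 1 + x b j ‖z‖, ?_, hsol⟩
    -- The number of zeros determines j, and the side of x₀ on which the value at the origin lies
    -- determines the sign.
    rintro ⟨b, i⟩ ⟨-, hi⟩ ⟨c, j⟩ ⟨-, hj⟩ hij
    have h1 := (hsol b i hi).2
    rw [RadialShooting.zeroRadii_congr hij, (hsol c j hj).2] at h1
    obtain rfl : j = i := by exact_mod_cast h1
    have h2 : 1 + x b j ‖(0 : RN (n + 1))‖ = 1 + x c j ‖(0 : RN (n + 1))‖ :=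
      congrFun hij ⟨0, Metric.mem_closedBall_self hR0.le⟩
    rw [norm_zero] at h2
    have h3 : b = true ↔ c = true := by
      rw [(hx b j hi).2.2.1, (hx c j hj).2.2.1, add_left_cancel h2]
    rw [Bool.eq_iff_iff.2 h3]
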